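/- **Setting.** Let $\hat e=\{(\pm1,0),(0,\pm1)\}$, $\partial^\mu f(x)=f(x+\mu)-f(x)$ for $\mu\in\hat e$, and $|x|=\max(|x_1|,|x_2|)$. Let $$W(x|0)=\int_{[-\pi,\pi]^2}\frac{dp}{(2\pi)^2}\,\frac{\cos(p\cdot x)-1}{2\sum_{i=1,2}(1-\cos p_i)},\qquad x\in\mathbb Z^2,$$ be the normalized two-dimensional lattice Coulomb potential. For odd $\gamma$, a *finite range decomposition on the scales $\gamma^h$* is a sequence $C_h:\mathbb Z^2\to\mathbb R$ ($h=0,1,2,\dots$) such that: each $C_h(x-y)$ is positive semidefinite; $C_h(x)=0$ if $|x|>\gamma^{h+1}/2$; for every $n\ge0$ there is a constant $K_n$ with $|\partial^{\mu_1}\cdots\partial^{\mu_n}C_h(x)|\le K_n\gamma^{-hn}$ for all $h,x,\mu_1,\dots,\mu_n$; and $\sum_{h\ge0}(C_h(x)-C_h(0))=W(x|0)$ for all $x$. Let $L=\gamma^M$ with $M\ge1$, $0\le j<R$, and let $\Lambda=(\mathbb Z/L^R\mathbb Z)^2$. Put $\Gamma_j=\sum_{h=jM}^{(j+1)M-1}C_h$,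 and let $\mathbb E_j$ be the expectation over the centred real Gaussian field $\zeta$ on $\Lambda$ with covariance $\Gamma_j(x-y)$, where $x-y$ is represented in $\mathbb Z^2$ with coordinates of absolute value less than $L^R/2$. For $i=j,j+1$, the $i$-blocks are the translates by $L^i\mathbb Z^2$ of $\{x\in\Lambda:|x|\le L^i/2\}$, and $i$-polymers are unions of $i$-blocks. $\mathcal B_i(X)$ is the set of $i$-blocks in the $i$-polymer $X$, and $|X|_i=\#\mathcal B_i(X)$. Two blocks touch if they contain sites $x,y$ with $\|x-y\|=1$; here $\|\cdot\|$ is either the Euclidean or the maximum norm (the result holds for both choices). $\mathcal P_i^c$ is the set of non-empty $i$-polymers that are connected with respect to touching, and $\mathcal S_i$ is the set of those with $|X|_i\le4$. For an $i$-polymer $X$, $X^*$ is the union of the $Y\in\mathcal S_i$ that meet $X$. $\partial X$ is the set of sites of $X$ with a nearest neighbour outside $X$. For a $j$-polymer $X$, $\bar X$ is the smallest $(j+1)$-polymer containing $X$. For $\varphi:\Lambda\to\mathbb C$ let $$\|\nabla_i^n\varphi\|_{L^\infty(X)}=\max_{\mu_1,\dots,\mu_n}\max_{x\in X}L^{ni}|\partial^{\mu_1}\cdots\partial^{\mu_n}\varphi_x|,$$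 $$\|\nabla_i\varphi\|^2_{L^2_i(X)}=L^{-2i}\sum_{x\in X}\tfrac12\sum_{\mu\in\hat e}L^{2i}|\partial^\mu\varphi_x|^2,\qquad \|\nabla_i\varphi\|^2_{L^2_i(\partial X)}=L^{-i}\sum_{x\in\partial X}\tfrac12\sum_{\mu\in\hat e}L^{2i}|\partial^\mu\varphi_x|^2 .$$ With constants $c_1,c_3,\kappa_L>0$ the field regulator $G_i$ is defined by $$\ln G_i(\varphi,X)=c_1\kappa_L\|\nabla_i\varphi\|^2_{L^2_i(X)}+c_3\kappa_L\|\nabla_i\varphi\|^2_{L^2_i(\partial X)}+c_1\kappa_L\sum_{B\in\mathcal B_i(X)}\|\nabla_i^2\varphi\|^2_{L^\infty(B^*)} .$$ **Lemma.** There is $r>0$ such that for all $c_1,c_3>0$ with $c_3\le r\,c_1$ there is $\gamma_0$ such that for every odd $\gamma\ge\gamma_0$: finite range decompositions on the scales $\gamma^h$ exist; and for each of them there are $c_0>0$ and $C>1$ such that, for every $0<c\le c_0$, every $M\ge1$, $L=\gamma^M$, $\kappa_L=c/\ln L$, every $0\le j<R$ and every $\varphi':\Lambda\to\mathbb C$,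 the matrix $(\Gamma_j(x-y))_{x,y\in\Lambda}$ is positive semidefinite and, writing $\varphi=\varphi'+\zeta$: a) for $X\in\mathcal P_j^c$, the function $G_j(\varphi,X)$ of $\zeta$ is integrable and $$\mathbb E_j[G_j(\varphi,X)]\le 2^{|X|_j}\,G_{j+1}(\varphi',\bar X);$$ b) for $X\in\mathcal S_j$, $$\Big(1+\max_{n=1,2}\|\nabla^n_{j+1}\varphi'\|_{L^\infty(X^*)}\Big)^3\,\mathbb E_j[G_j(\varphi,X)]\le C\,\frac{2^{|X|_j}}{\kappa_L^{3/2}}\,G_{j+1}(\varphi',\bar X),$$ where $X^*$ is taken on scale $j$; and the same holds, with integrability, if $G_j(\varphi,X)$ is replaced by $\sup_{t\in[0,1]}G_j(t\varphi'+\zeta,X)$. -/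

import Mathlib

open MeasureTheory ProbabilityTheory
open scoped NNReal

namespace CoulombGas

/-! ### Lattice derivatives -/

/-- The four lattice directions `ê`. -/
def dir : Fin 4 → ℤ × ℤ := ![(1, 0), (0, 1), (-1, 0), (0, -1)]

/-- The discrete derivative `(∂ᵘ f)(x) = f (x + u) - f x`. -/
def diff {A V : Type*} [Add A] [Sub V] (u : A) (f : A → V) : A → V :=
  fun x => f (x + u) - f x

/-- The iterated discrete derivative `∂^{u 0} ⋯ ∂^{u (n-1)} f`. -/
def diffs {A V : Type*} [Add A] [Sub V] {n : ℕ} (u : Fin n → A) (f : A → V) : A → V :=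
  (List.ofFn u).foldr diff f

/-! ### Finite range decompositions of the two-dimensional lattice Coulomb potential -/

/-- The Coulomb potential on `ℤ²`, normalized to vanish at the origin:
`W(x|0) = ∫_{[-π,π]²} (dp / (2π)²) (cos (p·x) - 1) / (2 ∑ᵢ (1 - cos pᵢ))`. -/
noncomputable def coulomb (x : ℤ × ℤ) : ℝ :=
  ((2 * Real.pi) ^ 2)⁻¹ *
    ∫ p in Set.Icc (-Real.pi) Real.pi ×ˢ Set.Icc (-Real.pi) Real.pi,
      (Real.cos (p.1 * x.1 + p.2 * x.2) - 1) /
        (2 * ((1 - Real.cos p.1) + (1 - Real.cos p.2)))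

/-- `Cov h`, `h = 0, 1, 2, …`, is a finite range decomposition, on the scales `γ ^ h`, of the
massless lattice Gaussian free field in two dimensions. -/
structure IsFiniteRangeDecomposition (γ : ℕ) (Cov : ℕ → ℤ × ℤ → ℝ) : Prop where
  /-- every `Cov h` is a (possibly degenerate) translation invariant covariance -/
  posSemidef : ∀ h, (Matrix.of fun x y : ℤ × ℤ => Cov h (x - y)).PosSemidef
  /-- `Cov h x = 0` if `|x|_∞ > γ ^ (h + 1) / 2` -/
  finiteRange : ∀ h x, (γ : ℤ) ^ (h + 1) < 2 * max |x.1| |x.2| → Cov h x = 0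
  /-- `|∂^a Cov h| ≤ K_{|a|} γ ^ (- h |a|)`, uniformly in the scale -/
  derivBound : ∀ n : ℕ, ∃ K : ℝ, ∀ (h : ℕ) (x : ℤ × ℤ) (μ : Fin n → Fin 4),
    |diffs (fun i => dir (μ i)) (Cov h) x| ≤ K / (γ : ℝ) ^ (h * n)
  /-- the covariances sum up to the Coulomb potential -/
  hasSum : ∀ x, HasSum (fun h => Cov h x - Cov h 0) (coulomb x)

/-- The covariance `Γ_j` between the scales `L ^ j` and `L ^ (j + 1)`, where `L = γ ^ M`:
the sum of the covariances on the scales `γ ^ h` with `L ^ j ≤ γ ^ h < L ^ (j + 1)`. -/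
def scaleCov (Cov : ℕ → ℤ × ℤ → ℝ) (M j : ℕ) (x : ℤ × ℤ) : ℝ :=
  ∑ h ∈ Finset.Ico (j * M) ((j + 1) * M), Cov h x

/-! ### The periodic lattice, blocks and polymers

Below `N` is the side of the periodic lattice and `ℓ` is the side of the blocks
(`ℓ = L ^ j` for `j`-blocks, and `N = L ^ R`). -/

/-- The periodic square lattice of side `N`. -/
abbrev Torus (N : ℕ) : Type := ZMod N × ZMod N

/-- The projection of `ℤ²` onto the periodic lattice. -/
def toTorus (N : ℕ) (v : ℤ × ℤ) : Torus N := ((v.1 : ZMod N), (v.2 : ZMod N))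

/-- The covariance matrix `Γ (x - y)` on the periodic lattice, `x - y` being represented by the
lattice vector with coordinates in `(-N/2, N/2]`. For `Γ` of range less than `N / 2` it is the
periodization of `Γ`. -/
def torusCov (N : ℕ) (Γ : ℤ × ℤ → ℝ) : Matrix (Torus N) (Torus N) ℝ :=
  Matrix.of fun x y => Γ ((x.1 - y.1).valMinAbs, (x.2 - y.2).valMinAbs)

/-- The two norms on `ℤ²` that can be used to define when two blocks touch. -/
inductive Touch
  /-- Euclidean norm: nearest neighbours -/
  | euclidean
  /-- maximum norm: nearest neighbours and diagonal neighbours -/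
  | maximum

/-- The lattice vectors of length one. -/
def Touch.unitVectors : Touch → Set (ℤ × ℤ)
  | .euclidean => {v | v.1 ^ 2 + v.2 ^ 2 = 1}
  | .maximum => {v | max |v.1| |v.2| = 1}

section

open scoped Classical

variable {N : ℕ} [NeZero N]

/-- The block of side `ℓ` centred at `ℓ v`, i.e. the translation by `ℓ v` of the central square
`{x : |x|_∞ ≤ ℓ / 2}`. -/
noncomputable def block (N : ℕ) [NeZero N] (ℓ : ℕ) (v : ℤ × ℤ) : Finset (Torus N) :=
  Finset.univ.filter fun x => ∃ d : ℤ × ℤ,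
    2 * max |d.1| |d.2| ≤ (ℓ : ℤ) ∧ x = toTorus N (ℓ * v.1 + d.1, ℓ * v.2 + d.2)

/-- The set of all blocks of side `ℓ`. -/
noncomputable def blocks (N : ℕ) [NeZero N] (ℓ : ℕ) : Finset (Finset (Torus N)) :=
  Finset.univ.filter fun B => ∃ v : ℤ × ℤ, B = block N ℓ v

/-- A polymer is a union of blocks. -/
def IsPolymer (ℓ : ℕ) (X : Finset (Torus N)) : Prop :=
  ∃ S ⊆ blocks N ℓ, X = S.biUnion id

/-- `ℬ(X)`: the blocks of side `ℓ` contained in `X`; `(blocksIn ℓ X).card` is the size of `X`. -/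
noncomputable def blocksIn (ℓ : ℕ) (X : Finset (Torus N)) : Finset (Finset (Torus N)) :=
  (blocks N ℓ).filter fun B => B ⊆ X

/-- The closure of `X` on the scale `ℓ`: the union of the blocks of side `ℓ` that meet `X`. -/
noncomputable def polymerClosure (ℓ : ℕ) (X : Finset (Torus N)) : Finset (Torus N) :=
  ((blocks N ℓ).filter fun B => (B ∩ X).Nonempty).biUnion id

/-- Two blocks touch if `‖x - y‖ = 1` for a site `x` of the one and a site `y` of the other. -/
def Touches (t : Touch) (B D : Finset (Torus N)) : Prop :=
  ∃ x ∈ B, ∃ y ∈ D, ∃ v ∈ t.unitVectors, y = x + toTorus N v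

/-- Non-empty connected polymers. -/
def IsConnectedPolymer (t : Touch) (ℓ : ℕ) (X : Finset (Torus N)) : Prop :=
  IsPolymer ℓ X ∧ X.Nonempty ∧
    ∀ B ∈ blocksIn ℓ X, ∀ D ∈ blocksIn ℓ X,
      Relation.ReflTransGen (fun B₁ B₂ => B₂ ∈ blocksIn ℓ X ∧ Touches t B₁ B₂) B D

/-- Small polymers: connected and made of at most four blocks. -/
def IsSmallPolymer (t : Touch) (ℓ : ℕ) (X : Finset (Torus N)) : Prop :=
  IsConnectedPolymer t ℓ X ∧ (blocksIn ℓ X).card ≤ 4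

/-- The small set neighbourhood `X^*`: the union of the small polymers that meet `X`. -/
noncomputable def nbhd (t : Touch) (ℓ : ℕ) (X : Finset (Torus N)) : Finset (Torus N) :=
  (Finset.univ.filter fun Y => IsSmallPolymer t ℓ Y ∧ (Y ∩ X).Nonempty).biUnion id

/-- The boundary `∂X`: the sites of `X` with a nearest neighbour outside `X`. -/
noncomputable def boundary (X : Finset (Torus N)) : Finset (Torus N) :=
  X.filter fun x => ∃ μ : Fin 4, x + toTorus N (dir μ) ∉ X

/-! ### Norms and field regulators -/

/-- `∂^{μ 1} ⋯ ∂^{μ n} φ` for a field on the periodic lattice. -/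
def grad {n : ℕ} (μ : Fin n → Fin 4) (φ : Torus N → ℂ) : Torus N → ℂ :=
  diffs (fun i => toTorus N (dir (μ i))) φ

/-- `‖∇ⁿ φ‖_{L^∞(X)}`, the maximum over `x ∈ X` and over all directions of
`ℓ ^ n |∂^{μ 1} ⋯ ∂^{μ n} φ_x|`. -/
noncomputable def supNorm (n ℓ : ℕ) (φ : Torus N → ℂ) (X : Finset (Torus N)) : ℝ :=
  (ℓ : ℝ) ^ n * ((X.sup fun x => Finset.univ.sup fun μ : Fin n → Fin 4 => ‖grad μ φ x‖₊ : ℝ≥0) : ℝ)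

/-- `∑_{μ 1, …, μ n} ℓ ^ (2 n) |∂^{μ 1} ⋯ ∂^{μ n} φ_x|²`, each sum over the four directions
carrying a factor `1 / 2` by convention. -/
noncomputable def gradSq (n ℓ : ℕ) (φ : Torus N → ℂ) (x : Torus N) : ℝ :=
  (1 / 2) ^ n * ∑ μ : Fin n → Fin 4, (ℓ : ℝ) ^ (2 * n) * ‖grad μ φ x‖ ^ 2

/-- `‖∇ⁿ φ‖²_{L²(X)}`. -/
noncomputable def sqNormL2 (n ℓ : ℕ) (φ : Torus N → ℂ) (X : Finset (Torus N)) : ℝ :=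
  ((ℓ : ℝ) ^ 2)⁻¹ * ∑ x ∈ X, gradSq n ℓ φ x

/-- `‖∇ⁿ φ‖²_{L²(∂X)}`. -/
noncomputable def sqNormL2Boundary (n ℓ : ℕ) (φ : Torus N → ℂ) (X : Finset (Torus N)) : ℝ :=
  (ℓ : ℝ)⁻¹ * ∑ x ∈ boundary X, gradSq n ℓ φ x

/-- `W(∇ⁿ φ, X)² = ∑_{B ∈ ℬ(X)} ‖∇ⁿ φ‖²_{L^∞(B^*)}`. -/
noncomputable def sqW (t : Touch) (n ℓ : ℕ) (φ : Torus N → ℂ) (X : Finset (Torus N)) : ℝ :=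
  ∑ B ∈ blocksIn ℓ X, supNorm n ℓ φ (nbhd t ℓ B) ^ 2

/-- The field regulator `G(φ, X)` on the scale `ℓ`. -/
noncomputable def regulator (t : Touch) (c₁ c₃ κ : ℝ) (ℓ : ℕ) (φ : Torus N → ℂ)
    (X : Finset (Torus N)) : ℝ :=
  Real.exp (c₁ * κ * sqNormL2 1 ℓ φ X + c₃ * κ * sqNormL2Boundary 1 ℓ φ X
    + c₁ * κ * sqW t 2 ℓ φ X)

/-- The field `t φ' + ζ`, for a complex field `φ'` and a real fluctuation field `ζ`. -/
def shiftField (t : ℝ) (φ' : Torus N → ℂ) (ζ : EuclideanSpace ℝ (Torus N)) : Torus N → ℂ :=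
  fun x => (t : ℂ) * φ' x + ((ζ x : ℝ) : ℂ)

end

section

variable {N : ℕ} [NeZero N]

lemma mem_block {ℓ : ℕ} {v : ℤ × ℤ} {x : Torus N} : x ∈ block N ℓ v ↔ ∃ d : ℤ × ℤ,
    2 * max |d.1| |d.2| ≤ (ℓ : ℤ) ∧ x = toTorus N (ℓ * v.1 + d.1, ℓ * v.2 + d.2) := by
  simp [block]

lemma centred_rep_unique {ℓ : ℕ} (hodd : Odd ℓ) (hN : ℓ ∣ N) {v w d e : ℤ}
    (hd : 2 * |d| ≤ ℓ) (he : 2 * |e| ≤ ℓ)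
    (h : ((ℓ * v + d : ℤ) : ZMod N) = ((ℓ * w + e : ℤ) : ZMod N)) : d = e := by
  rw [ZMod.intCast_eq_intCast_iff_dvd_sub] at h
  have h1 : (ℓ : ℤ) ∣ ℓ * w + e - (ℓ * v + d) := (Int.natCast_dvd_natCast.2 hN).trans h
  have h2 : (ℓ : ℤ) ∣ e - d := by
    have h4 : (ℓ : ℤ) ∣ ℓ * (w - v) := Dvd.intro _ rfl
    have h5 := dvd_sub h1 h4
    rwa [show (ℓ : ℤ) * w + e - (ℓ * v + d) - ℓ * (w - v) = e - d by ring] at h5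
  obtain ⟨k, hk⟩ := hodd
  have h3 : |e - d| < ℓ := by
    have a1 := abs_le.1 (show |d| ≤ k by omega)
    have a2 := abs_le.1 (show |e| ≤ k by omega)
    rw [abs_lt]; constructor <;> push_cast [hk] <;> omega
  have := Int.eq_zero_of_abs_lt_dvd h2 h3
  omega

/-- Blocks of odd side dividing `N` are equal or disjoint. -/
lemma blocks_eq_of_mem {ℓ : ℕ} (hodd : Odd ℓ) (hN : ℓ ∣ N) {B D : Finset (Torus N)}
    (hB : B ∈ blocks N ℓ) (hD : D ∈ blocks N ℓ) {x : Torus N} (hxB : x ∈ B) (hxD : x ∈ D) :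
    B = D := by
  classical
  simp only [blocks, Finset.mem_filter, Finset.mem_univ, true_and] at hB hD
  obtain ⟨v, rfl⟩ := hB
  obtain ⟨w, rfl⟩ := hD
  obtain ⟨d, hd, hx⟩ := mem_block.1 hxB
  obtain ⟨e, he, hx'⟩ := mem_block.1 hxD
  have h := hx.symm.trans hx'
  simp only [toTorus, Prod.mk.injEq] at h
  have e1 := centred_rep_unique hodd hN (by have := le_max_left |d.1| |d.2|; omega)
    (by have := le_max_left |e.1| |e.2|; omega) h.1
  have e2 := centred_rep_unique hodd hN (by have := le_max_right |d.1| |d.2|; omega)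
    (by have := le_max_right |e.1| |e.2|; omega) h.2
  rw [e1, e2] at h
  push_cast at h
  have g1 := add_right_cancel h.1
  have g2 := add_right_cancel h.2
  ext y
  simp only [mem_block, toTorus]
  push_cast
  rw [g1, g2]

/-- The closure is a polymer. -/
lemma isPolymer_polymerClosure (ℓ : ℕ) (X : Finset (Torus N)) :
    IsPolymer ℓ (polymerClosure ℓ X) := by
  classical
  exact ⟨_, Finset.filter_subset _ _, rfl⟩

/-- The closure is contained in every polymer that contains `X`. -/
lemma polymerClosure_subset {ℓ : ℕ} (hodd : Odd ℓ) (hN : ℓ ∣ N) {X Y : Finset (Torus N)}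
    (hY : IsPolymer ℓ Y) (hXY : X ⊆ Y) : polymerClosure ℓ X ⊆ Y := by
  classical
  obtain ⟨S, hS, rfl⟩ := hY
  intro y hy
  simp only [polymerClosure, Finset.mem_biUnion, Finset.mem_filter, id] at hy
  obtain ⟨B, ⟨hB, ⟨x, hx⟩⟩, hyB⟩ := hy
  obtain ⟨hxB, hxX⟩ := Finset.mem_inter.1 hx
  obtain ⟨D, hD, hxD⟩ := Finset.mem_biUnion.1 (hXY hxX)
  rw [blocks_eq_of_mem hodd hN hB (hS hD) hxB hxD] at hyB
  exact Finset.mem_biUnion.2 ⟨D, hD, hyB⟩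

/-- The closure contains `X`. -/
lemma subset_polymerClosure {ℓ : ℕ} (hodd : Odd ℓ) (X : Finset (Torus N)) :
    X ⊆ polymerClosure ℓ X := by
  classical
  have key : ∀ a : ZMod N, ∃ v d : ℤ, 2 * |d| ≤ ℓ ∧ a = ((ℓ * v + d : ℤ) : ZMod N) := by
    intro a
    obtain ⟨k, hk⟩ := hodd
    refine ⟨(a.val + k : ℤ) / ℓ, (a.val + k : ℤ) % ℓ - k, ?_, ?_⟩
    · have h1 := Int.emod_nonneg (a.val + k : ℤ) (show (ℓ : ℤ) ≠ 0 by omega)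
      have h2 := Int.emod_lt_of_pos (a.val + k : ℤ) (show (0 : ℤ) < ℓ by omega)
      have : |(a.val + k : ℤ) % ℓ - k| ≤ k := by rw [abs_le]; omega
      omega
    · have := Int.mul_ediv_add_emod (a.val + k : ℤ) ℓ
      rw [show (ℓ : ℤ) * ((a.val + k : ℤ) / ℓ) + ((a.val + k : ℤ) % ℓ - k) = a.val by omega]
      simp
  intro x hx
  obtain ⟨v, d, hd, hv⟩ := key x.1
  obtain ⟨w, e, he, hw⟩ := key x.2
  have hxB : x ∈ block N ℓ (v, w) := by
    refine mem_block.2 ⟨(d, e), ?_, Prod.ext hv hw⟩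
    rcases max_cases |d| |e| with h | h <;> simp only [] <;> omega
  simp only [polymerClosure, Finset.mem_biUnion, Finset.mem_filter, id]
  refine ⟨_, ⟨?_, x, Finset.mem_inter.2 ⟨hxB, hx⟩⟩, hxB⟩
  simp only [blocks, Finset.mem_filter, Finset.mem_univ, true_and]
  exact ⟨_, rfl⟩

end

/-- The Gaussian measure of the fluctuation field on the periodic lattice of side `N`, with
mean zero and covariance `Γ (x - y)`. -/
noncomputable def gaussianField (N : ℕ) [NeZero N] (Γ : ℤ × ℤ → ℝ) :
    Measure (EuclideanSpace ℝ (Torus N)) :=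
  multivariateGaussian 0 (torusCov N Γ)

end CoulombGas

open CoulombGas

set_option linter.unusedSectionVars false

namespace CoulombGas

/-! ### Blocks and polymers -/

section Geometry

variable {N : ℕ} [NeZero N] {ℓ : ℕ}

/-! Write G = exp (κ E), where E is `energy`. The fluctuation field is a sum of M independent
Gaussian layers, one for each scale γ^h, and the layers are integrated out one after the other.

The heart is a deterministic inequality for one layer, `energy_step`: E(φ + ζ, X) on the scale ℓ is
at most `stepEnergy`, which is slightly less than E(φ, closure of X) on the scale γℓ, plus a
constant times ∑_B z_B², where z_B bounds ζ and its scaled derivatives up to order two near B. The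
bulk term ∑_X |∂φ|² has the same coefficient on both scales, so no factor may be lost in it. Its
cross term is therefore kept exactly and summed by parts (`sum_by_parts`). What is left is ζ times
the Laplacian of φ, absorbed by the second-derivative term, and a sum over the faces of X, absorbed
by the boundary term. Both of these have room: on the coarse scale the second-derivative term is at
least γ² times larger (`sqW_coarse`), and the weight of the boundary term grows by γ. The part of ∂X
in the interior of the closure is handled by comparing gradients along the lattice lines that leave
X (`boundary_transfer`). This costs bulk energy in the region that the closure adds to X, and is
affordable because c₃ is small compared with c₁.

For the integration, a discrete Sobolev inequality bounds z_B² by block averages of squares of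
scaled derivatives of ζ up to order four. Jensen's inequality reduces the exponential moment to
families with one linear functional per block. By finite range each functional is correlated with
boundedly many others, so `lintegral_exp_sum_sq_le` gives at most exp (const κ |X|) for each layer.
The supremum over all background fields, `excess`, turns the one-step inequality into a recursion,
and `lintegral_excess_le` gives exp (κ A M |X|) for M layers. Since κ M = c / ln γ, a small c makes
this at most 2^|X|, uniformly in M.

In b) the cubic prefactor is paid with the slack between `stepEnergy` and E on the last step. A
small polymer covers less than half of each coarse block, so the slack controls both supremum norms
of φ' (`stepEnergy_add_le`), and (1 + y)³ is at most a multiple of κ^(-3/2) exp (κ a y²). The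
supremum over t needs nothing new: t φ' is one more background field, and `stepEnergy` is monotone
in t.

The covariance on the torus is the periodization of a covariance on ℤ². Its quadratic form is a
limit of normalized quadratic forms on large boxes, hence nonnegative.

Finite range decompositions are built from polynomials in the nearest neighbour average, whose
symbol is u. Products of normalized Fejér kernels give low pass filters F_h with F_0 = 1 and F_h → 0
for u < 1. The slices (F_h - F_{h+1}) / (4 (1 - u)) are nonnegative polynomials on [-1, 1], and they
telescope to the Coulomb symbol. Their degree gives the range, and the decay of F_h in γ^(2h) (1 -
u) gives the derivative bounds. -/

lemma toTorus_add (N : ℕ) (a b : ℤ × ℤ) : toTorus N (a + b) = toTorus N a + toTorus N b := by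
  simp [toTorus]

lemma toTorus_neg (N : ℕ) (a : ℤ × ℤ) : toTorus N (-a) = -toTorus N a := by
  simp [toTorus]

lemma toTorus_sub (N : ℕ) (a b : ℤ × ℤ) : toTorus N (a - b) = toTorus N a - toTorus N b := by
  simp [toTorus]

lemma toTorus_zero (N : ℕ) : toTorus N 0 = 0 := by
  simp [toTorus]

lemma toTorus_surjective (N : ℕ) [NeZero N] : Function.Surjective (toTorus N) := by
  intro x
  exact ⟨((x.1.val : ℤ), (x.2.val : ℤ)), by simp [toTorus]⟩

lemma mem_block_iff {v : ℤ × ℤ} {x : Torus N} : x ∈ block N ℓ v ↔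
    ∃ d : ℤ × ℤ, (2 * |d.1| ≤ ℓ ∧ 2 * |d.2| ≤ ℓ) ∧ x = toTorus N ((ℓ : ℤ) • v + d) := by
  rw [mem_block]
  refine exists_congr fun d => and_congr ?_ Iff.rfl
  rcases max_cases |d.1| |d.2| with h | h <;> omega

lemma block_congr {v w : ℤ × ℤ} (h : toTorus N ((ℓ : ℤ) • v) = toTorus N ((ℓ : ℤ) • w)) :
    block N ℓ v = block N ℓ w := by
  ext x
  simp only [mem_block_iff, toTorus_add, h]

lemma mem_blocks {B : Finset (Torus N)} : B ∈ blocks N ℓ ↔ ∃ v, B = block N ℓ v := by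
  classical
  simp [blocks]

lemma block_mem_blocks (v : ℤ × ℤ) : block N ℓ v ∈ blocks N ℓ := mem_blocks.2 ⟨v, rfl⟩

lemma mem_blocksIn {B X : Finset (Torus N)} : B ∈ blocksIn ℓ X ↔ B ∈ blocks N ℓ ∧ B ⊆ X := by
  classical
  simp [blocksIn]

lemma centre_mem_block (v : ℤ × ℤ) : toTorus N ((ℓ : ℤ) • v) ∈ block N ℓ v :=
  mem_block_iff.2 ⟨0, by simp⟩

lemma blocks_nonempty {B : Finset (Torus N)} (hB : B ∈ blocks N ℓ) : B.Nonempty := by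
  obtain ⟨v, rfl⟩ := mem_blocks.1 hB
  exact ⟨_, centre_mem_block v⟩

lemma int_exists_centred (hodd : Odd ℓ) (a : ℤ) : ∃ v d : ℤ, 2 * |d| ≤ ℓ ∧ a = ℓ * v + d := by
  obtain ⟨k, hk⟩ := hodd
  refine ⟨(a + k) / ℓ, (a + k) % ℓ - k, ?_, ?_⟩
  · have h1 := Int.emod_nonneg (a + k) (show (ℓ : ℤ) ≠ 0 by omega)
    have h2 := Int.emod_lt_of_pos (a + k) (show (0 : ℤ) < ℓ by omega)
    have : |(a + k) % ℓ - k| ≤ k := by rw [abs_le]; omega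
    omega
  · have := Int.mul_ediv_add_emod (a + k) ℓ
    omega

lemma exists_centred (hodd : Odd ℓ) (a : ℤ × ℤ) : ∃ v d : ℤ × ℤ,
    (2 * |d.1| ≤ ℓ ∧ 2 * |d.2| ≤ ℓ) ∧ a = (ℓ : ℤ) • v + d := by
  obtain ⟨v, d, hd, hv⟩ := int_exists_centred hodd a.1
  obtain ⟨w, e, he, hw⟩ := int_exists_centred hodd a.2
  exact ⟨(v, w), (d, e), ⟨hd, he⟩, Prod.ext hv hw⟩

lemma exists_mem_block (hodd : Odd ℓ) (x : Torus N) : ∃ v, x ∈ block N ℓ v := by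
  obtain ⟨a, rfl⟩ := toTorus_surjective N x
  obtain ⟨v, d, hd, rfl⟩ := exists_centred hodd a
  exact ⟨v, mem_block_iff.2 ⟨d, hd, rfl⟩⟩

lemma centred_unique (hodd : Odd ℓ) (hN : ℓ ∣ N) {v w d e : ℤ × ℤ}
    (hd : 2 * |d.1| ≤ ℓ ∧ 2 * |d.2| ≤ ℓ) (he : 2 * |e.1| ≤ ℓ ∧ 2 * |e.2| ≤ ℓ)
    (h : toTorus N ((ℓ : ℤ) • v + d) = toTorus N ((ℓ : ℤ) • w + e)) : d = e := by
  simp only [toTorus, Prod.mk.injEq] at h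
  exact Prod.ext (centred_rep_unique hodd hN hd.1 he.1 h.1)
    (centred_rep_unique hodd hN hd.2 he.2 h.2)

/-- The offsets of the sites of a block from its centre. -/
noncomputable def offsets (ℓ : ℕ) : Finset (ℤ × ℤ) :=
  Finset.Icc (-((ℓ / 2 : ℕ) : ℤ)) ((ℓ / 2 : ℕ) : ℤ) ×ˢ Finset.Icc (-((ℓ / 2 : ℕ) : ℤ)) ((ℓ / 2 : ℕ) : ℤ)

lemma mem_offsets {d : ℤ × ℤ} : d ∈ offsets ℓ ↔ 2 * |d.1| ≤ ℓ ∧ 2 * |d.2| ≤ ℓ := by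
  simp only [offsets, Finset.mem_product, Finset.mem_Icc, ← abs_le]
  omega

lemma card_offsets (hodd : Odd ℓ) : (offsets ℓ).card = ℓ ^ 2 := by
  obtain ⟨k, rfl⟩ := hodd
  simp only [offsets, Finset.card_product, Int.card_Icc]
  rw [sq]
  congr 1 <;> omega

lemma block_eq_image (v : ℤ × ℤ) :
    block N ℓ v = (offsets ℓ).image fun d => toTorus N ((ℓ : ℤ) • v + d) := by
  ext x
  simp only [mem_block_iff, Finset.mem_image, mem_offsets]
  exact exists_congr fun d => and_congr Iff.rfl eq_comm

lemma offset_injOn (hodd : Odd ℓ) (hN : ℓ ∣ N) (v : ℤ × ℤ) :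
    Set.InjOn (fun d => toTorus N ((ℓ : ℤ) • v + d)) (offsets ℓ) := by
  intro d hd e he h
  exact centred_unique hodd hN (mem_offsets.1 hd) (mem_offsets.1 he) h

lemma card_block (hodd : Odd ℓ) (hN : ℓ ∣ N) {B : Finset (Torus N)} (hB : B ∈ blocks N ℓ) :
    B.card = ℓ ^ 2 := by
  obtain ⟨v, rfl⟩ := mem_blocks.1 hB
  rw [block_eq_image, Finset.card_image_of_injOn (offset_injOn hodd hN v), card_offsets hodd]

lemma polymer_block_subset (hodd : Odd ℓ) (hN : ℓ ∣ N) {X B : Finset (Torus N)}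
    (hX : IsPolymer ℓ X) (hB : B ∈ blocks N ℓ) {x : Torus N} (hxX : x ∈ X) (hxB : x ∈ B) :
    B ⊆ X := by
  classical
  obtain ⟨S, hS, rfl⟩ := hX
  obtain ⟨D, hD, hxD⟩ := Finset.mem_biUnion.1 hxX
  rw [blocks_eq_of_mem hodd hN hB (hS hD) hxB hxD]
  exact Finset.subset_biUnion_of_mem id hD

lemma exists_blocksIn (hodd : Odd ℓ) (hN : ℓ ∣ N) {X : Finset (Torus N)}
    (hX : IsPolymer ℓ X) {x : Torus N} (hx : x ∈ X) : ∃ B ∈ blocksIn ℓ X, x ∈ B := by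
  obtain ⟨v, hv⟩ := exists_mem_block hodd x
  exact ⟨_, mem_blocksIn.2 ⟨block_mem_blocks v,
    polymer_block_subset hodd hN hX (block_mem_blocks v) hx hv⟩, hv⟩

lemma biUnion_blocksIn (hodd : Odd ℓ) (hN : ℓ ∣ N) {X : Finset (Torus N)}
    (hX : IsPolymer ℓ X) : (blocksIn ℓ X).biUnion id = X := by
  classical
  ext x
  simp only [Finset.mem_biUnion, id]
  constructor
  · rintro ⟨B, hB, hx⟩
    exact (mem_blocksIn.1 hB).2 hx
  · exact exists_blocksIn hodd hN hX

lemma sum_polymer (hodd : Odd ℓ) (hN : ℓ ∣ N) {X : Finset (Torus N)}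
    (hX : IsPolymer ℓ X) (f : Torus N → ℝ) :
    ∑ x ∈ X, f x = ∑ B ∈ blocksIn ℓ X, ∑ x ∈ B, f x := by
  classical
  conv_lhs => rw [← biUnion_blocksIn hodd hN hX]
  rw [Finset.sum_biUnion]
  · rfl
  · intro B hB D hD hne
    rw [Function.onFun, Finset.disjoint_left]
    intro x hxB hxD
    exact hne (blocks_eq_of_mem hodd hN (mem_blocksIn.1 hB).1 (mem_blocksIn.1 hD).1 hxB hxD)

/-- This is how pointwise bounds near a block become sums over blocks. It is used with S = X and n =
ℓ² for bulk terms, and with S inside the boundary and n = 4ℓ for surface terms. -/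
lemma sum_subset_polymer_le (hodd : Odd ℓ) (hN : ℓ ∣ N) {X S : Finset (Torus N)}
    (hX : IsPolymer ℓ X) (hS : S ⊆ X) (f : Torus N → ℝ) (b : Finset (Torus N) → ℝ) (n : ℝ)
    (hn : ∀ B ∈ blocksIn ℓ X, ((S ∩ B).card : ℝ) ≤ n) (hb : ∀ B ∈ blocksIn ℓ X, 0 ≤ b B)
    (hf : ∀ B ∈ blocksIn ℓ X, ∀ x ∈ B, x ∈ S → f x ≤ b B) :
    ∑ x ∈ S, f x ≤ ∑ B ∈ blocksIn ℓ X, n * b B := by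
  classical
  have h1 : ∑ x ∈ S, f x = ∑ x ∈ X, if x ∈ S then f x else 0 := by
    rw [← Finset.sum_filter]
    congr 1
    ext x
    simp only [Finset.mem_filter]
    exact ⟨fun h => ⟨hS h, h⟩, fun h => h.2⟩
  rw [h1, sum_polymer hodd hN hX]
  refine Finset.sum_le_sum fun B hB => ?_
  rw [← Finset.sum_filter]
  have h2 : B.filter (· ∈ S) = S ∩ B := by
    ext x; simp [and_comm]
  rw [h2]
  calc ∑ x ∈ S ∩ B, f x ≤ (S ∩ B).card • b B :=
        Finset.sum_le_card_nsmul _ _ _ fun x hx =>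
          hf B hB x (Finset.mem_inter.1 hx).2 (Finset.mem_inter.1 hx).1
    _ = (S ∩ B).card * b B := by simp
    _ ≤ n * b B := mul_le_mul_of_nonneg_right (hn B hB) (hb B hB)

/-! #### Closure on coarser scales -/

lemma mem_polymerClosure {X : Finset (Torus N)} {x : Torus N} :
    x ∈ polymerClosure ℓ X ↔ ∃ B ∈ blocks N ℓ, (B ∩ X).Nonempty ∧ x ∈ B := by
  classical
  simp only [polymerClosure, Finset.mem_biUnion, Finset.mem_filter, id]
  constructor
  · rintro ⟨B, ⟨h1, y, hy⟩, h2⟩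
    exact ⟨B, h1, ⟨y, by simpa using hy⟩, h2⟩
  · rintro ⟨B, h1, ⟨y, hy⟩, h2⟩
    exact ⟨B, ⟨h1, y, by simpa using hy⟩, h2⟩

variable {γ : ℕ}

lemma odd_coarse (hodd : Odd ℓ) (hγ : Odd γ) : Odd (γ * ℓ) := hγ.mul hodd

lemma subBlock_subset (hodd : Odd ℓ) (hγ : Odd γ) (w u : ℤ × ℤ)
    (hu : 2 * |u.1| ≤ γ ∧ 2 * |u.2| ≤ γ) :
    block N ℓ ((γ : ℤ) • w + u) ⊆ block N (γ * ℓ) w := by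
  intro x hx
  obtain ⟨d, hd, rfl⟩ := mem_block_iff.1 hx
  have key : ∀ u d : ℤ, 2 * |u| ≤ γ → 2 * |d| ≤ ℓ → 2 * |(ℓ : ℤ) * u + d| ≤ (γ * ℓ : ℕ) := by
    intro u d hu hd
    obtain ⟨k, hk⟩ := hodd
    obtain ⟨g, hg⟩ := hγ
    have h1 : |u| ≤ g := by omega
    have h2 : |d| ≤ k := by omega
    have h3 : |(ℓ : ℤ) * u + d| ≤ ℓ * g + k := by
      refine (abs_add_le _ _).trans (add_le_add ?_ h2)
      rw [abs_mul, abs_of_nonneg (by positivity : (0 : ℤ) ≤ ℓ)]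
      exact mul_le_mul_of_nonneg_left h1 (by positivity)
    have h4 : ((γ * ℓ : ℕ) : ℤ) = 2 * (ℓ * g + k) + 1 := by
      push_cast [hg, hk]; ring
    omega
  refine mem_block_iff.2 ⟨(ℓ : ℤ) • u + d, ⟨key _ _ hu.1 hd.1, key _ _ hu.2 hd.2⟩, ?_⟩
  congr 1
  push_cast
  ext <;> simp <;> ring

lemma exists_coarse_block (hodd : Odd ℓ) (hγ : Odd γ) {B : Finset (Torus N)}
    (hB : B ∈ blocks N ℓ) : ∃ B' ∈ blocks N (γ * ℓ), B ⊆ B' := by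
  obtain ⟨v, rfl⟩ := mem_blocks.1 hB
  obtain ⟨w, u, hu, rfl⟩ := exists_centred hγ v
  exact ⟨_, block_mem_blocks w, subBlock_subset hodd hγ w u hu⟩

lemma block_subset_coarse (hodd : Odd ℓ) (hγ : Odd γ) (hN : γ * ℓ ∣ N) {B B' : Finset (Torus N)}
    (hB : B ∈ blocks N ℓ) (hB' : B' ∈ blocks N (γ * ℓ)) {x : Torus N} (hx : x ∈ B)
    (hx' : x ∈ B') : B ⊆ B' := by
  obtain ⟨D, hD, hBD⟩ := exists_coarse_block hodd hγ hB
  rwa [blocks_eq_of_mem (odd_coarse hodd hγ) hN hB' hD hx' (hBD hx)]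

lemma polymer_coarse (hodd : Odd ℓ) (hγ : Odd γ) (hN : γ * ℓ ∣ N) {X : Finset (Torus N)}
    (hX : IsPolymer (γ * ℓ) X) : IsPolymer ℓ X := by
  classical
  refine ⟨blocksIn ℓ X, Finset.filter_subset _ _, ?_⟩
  ext x
  simp only [Finset.mem_biUnion, id]
  constructor
  · intro hx
    obtain ⟨B', hB', hxB'⟩ := exists_blocksIn (odd_coarse hodd hγ) hN hX hx
    obtain ⟨v, hv⟩ := exists_mem_block hodd x
    exact ⟨_, mem_blocksIn.2 ⟨block_mem_blocks v, (block_subset_coarse hodd hγ hN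
      (block_mem_blocks v) (mem_blocksIn.1 hB').1 hv hxB').trans (mem_blocksIn.1 hB').2⟩, hv⟩
  · rintro ⟨B, hB, hx⟩
    exact (mem_blocksIn.1 hB).2 hx

lemma mem_blocksIn_closure (hodd : Odd ℓ) (hN : ℓ ∣ N) {X B : Finset (Torus N)} :
    B ∈ blocksIn ℓ (polymerClosure ℓ X) ↔ B ∈ blocks N ℓ ∧ (B ∩ X).Nonempty := by
  rw [mem_blocksIn]
  refine and_congr_right fun hB => ⟨fun h => ?_, fun h x hx => ?_⟩
  · obtain ⟨x, hx⟩ := blocks_nonempty hB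
    obtain ⟨D, hD, hDX, hxD⟩ := mem_polymerClosure.1 (h hx)
    rwa [blocks_eq_of_mem hodd hN hB hD hx hxD]
  · exact mem_polymerClosure.2 ⟨B, hB, h, hx⟩

/-- Every block of the closure of a polymer contains a block of the polymer. -/
lemma exists_subBlock (hodd : Odd ℓ) (hγ : Odd γ) (hN : γ * ℓ ∣ N) {X B' : Finset (Torus N)}
    (hX : IsPolymer ℓ X) (hB' : B' ∈ blocksIn (γ * ℓ) (polymerClosure (γ * ℓ) X)) :
    ∃ B ∈ blocksIn ℓ X, B ⊆ B' := by
  classical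
  obtain ⟨h1, x, hx⟩ := (mem_blocksIn_closure (odd_coarse hodd hγ) hN).1 hB'
  obtain ⟨hxB, hxX⟩ := Finset.mem_inter.1 hx
  obtain ⟨B, hB, hx⟩ := exists_blocksIn hodd (dvd_of_mul_left_dvd hN) hX hxX
  exact ⟨B, hB, block_subset_coarse hodd hγ hN (mem_blocksIn.1 hB).1 h1 hx hxB⟩

/-- Every block of a polymer is contained in a block of the closure. -/
lemma exists_superBlock (hodd : Odd ℓ) (hγ : Odd γ) (hN : γ * ℓ ∣ N) {X B : Finset (Torus N)}
    (hB : B ∈ blocksIn ℓ X) : ∃ B' ∈ blocksIn (γ * ℓ) (polymerClosure (γ * ℓ) X), B ⊆ B' := by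
  classical
  obtain ⟨B', hB', hBB'⟩ := exists_coarse_block hodd hγ (mem_blocksIn.1 hB).1
  refine ⟨B', (mem_blocksIn_closure (odd_coarse hodd hγ) hN).2 ⟨hB', ?_⟩, hBB'⟩
  obtain ⟨x, hx⟩ := blocks_nonempty (mem_blocksIn.1 hB).1
  exact ⟨x, Finset.mem_inter.2 ⟨hBB' hx, (mem_blocksIn.1 hB).2 hx⟩⟩

/-- Choosing a fine block of X inside each coarse block is injective, because coarse blocks are
disjoint. It keeps the exponent |X| from growing along the scales. -/
lemma card_blocksIn_closure_le (hodd : Odd ℓ) (hγ : Odd γ) (hN : γ * ℓ ∣ N)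
    {X : Finset (Torus N)} (hX : IsPolymer ℓ X) :
    (blocksIn (γ * ℓ) (polymerClosure (γ * ℓ) X)).card ≤ (blocksIn ℓ X).card := by
  classical
  choose! f hf hf' using fun B' hB' => exists_subBlock hodd hγ hN (B' := B') hX hB'
  refine Finset.card_le_card_of_injOn f hf ?_
  intro B hB D hD h
  obtain ⟨x, hx⟩ := blocks_nonempty (mem_blocksIn.1 (hf B hB)).1
  exact blocks_eq_of_mem (odd_coarse hodd hγ) hN (mem_blocksIn.1 hB).1 (mem_blocksIn.1 hD).1
    (hf' B hB hx) (hf' D hD (h ▸ hx))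

lemma closure_closure {γ' : ℕ} (hodd : Odd ℓ) (hγ' : Odd γ') (hN : γ' * ℓ ∣ N)
    (X : Finset (Torus N)) :
    polymerClosure (γ' * ℓ) (polymerClosure ℓ X) = polymerClosure (γ' * ℓ) X := by
  classical
  ext x
  simp only [mem_polymerClosure]
  refine exists_congr fun B => and_congr_right fun hB => and_congr_left fun _ => ?_
  constructor
  · rintro ⟨y, hy⟩
    obtain ⟨hyB, hyX⟩ := Finset.mem_inter.1 hy
    obtain ⟨D, hD, ⟨z, hz⟩, hyD⟩ := mem_polymerClosure.1 hyX
    obtain ⟨hzD, hzX⟩ := Finset.mem_inter.1 hz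
    exact ⟨z, Finset.mem_inter.2 ⟨block_subset_coarse hodd hγ' hN hD hB hyD hyB hzD, hzX⟩⟩
  · rintro ⟨y, hy⟩
    obtain ⟨hyB, hyX⟩ := Finset.mem_inter.1 hy
    exact ⟨y, Finset.mem_inter.2 ⟨hyB, subset_polymerClosure hodd X hyX⟩⟩

/-- A block of side `γ ℓ` contains at most `γ ^ 2` blocks of side `ℓ`. -/
lemma card_subBlocks_le (hodd : Odd ℓ) (hγ : Odd γ) (hN : γ * ℓ ∣ N) {B' : Finset (Torus N)}
    (hB' : B' ∈ blocks N (γ * ℓ)) : (blocksIn ℓ B').card ≤ γ ^ 2 := by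
  classical
  obtain ⟨w, rfl⟩ := mem_blocks.1 hB'
  rw [← card_offsets hγ]
  refine (Finset.card_le_card (t := (offsets γ).image fun u => block N ℓ ((γ : ℤ) • w + u))
    fun B hB => ?_).trans Finset.card_image_le
  obtain ⟨h1, h2⟩ := mem_blocksIn.1 hB
  obtain ⟨v, rfl⟩ := mem_blocks.1 h1
  obtain ⟨w', u, hu, rfl⟩ := exists_centred hγ v
  refine Finset.mem_image.2 ⟨u, mem_offsets.2 hu, ?_⟩
  have h3 := subBlock_subset (N := N) hodd hγ w' u hu (centre_mem_block _)
  have h4 : block N (γ * ℓ) w = block N (γ * ℓ) w' :=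
    blocks_eq_of_mem (odd_coarse hodd hγ) hN hB' (block_mem_blocks _) (h2 (centre_mem_block _)) h3
  -- On the torus, equal blocks can have different indices w and w'. Uniqueness of centred offsets
  -- shows that the two centres are the same site, which is all that `block_congr` needs.
  have h5 := centre_mem_block (N := N) (ℓ := γ * ℓ) w
  rw [h4] at h5
  obtain ⟨d, hd, h6⟩ := mem_block_iff.1 h5
  have h7 : (0 : ℤ × ℤ) = d := by
    refine centred_unique (odd_coarse hodd hγ) hN (v := w) (w := w') (by simp; positivity) hd ?_
    rw [add_zero]; exact h6
  subst h7
  refine block_congr ?_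
  have e : ∀ z : ℤ × ℤ, (ℓ : ℤ) • ((γ : ℤ) • z + u) = ((γ * ℓ : ℕ) : ℤ) • z + (ℓ : ℤ) • u := by
    intro z; ext <;> simp <;> ring
  rw [e, e, toTorus_add, toTorus_add, h6, add_zero]

/-- Summing over blocks a quantity that depends on the coarse block containing it. -/
lemma sum_blocksIn_le_coarse (hodd : Odd ℓ) (hγ : Odd γ) (hN : γ * ℓ ∣ N) {X : Finset (Torus N)}
    (f g : Finset (Torus N) → ℝ) (hg : ∀ B', 0 ≤ g B')
    (h : ∀ B ∈ blocks N ℓ, ∀ B' ∈ blocks N (γ * ℓ), B ⊆ B' → f B ≤ g B') :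
    ∑ B ∈ blocksIn ℓ X, f B ≤
      (γ : ℝ) ^ 2 * ∑ B' ∈ blocksIn (γ * ℓ) (polymerClosure (γ * ℓ) X), g B' := by
  classical
  choose! s hs hs' using fun B hB => exists_superBlock hodd hγ hN (X := X) (B := B) hB
  rw [← Finset.sum_fiberwise_of_maps_to hs, Finset.mul_sum]
  refine Finset.sum_le_sum fun B' hB' => ?_
  calc ∑ B ∈ (blocksIn ℓ X).filter (fun B => s B = B'), f B
      ≤ ((blocksIn ℓ X).filter (fun B => s B = B')).card • g B' := by
        refine Finset.sum_le_card_nsmul _ _ _ fun B hB => ?_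
        obtain ⟨h1, rfl⟩ := Finset.mem_filter.1 hB
        exact h B (mem_blocksIn.1 h1).1 _ (mem_blocksIn.1 hB').1 (hs' B h1)
    _ = ((blocksIn ℓ X).filter (fun B => s B = B')).card * g B' := by simp
    _ ≤ (γ : ℝ) ^ 2 * g B' := by
        refine mul_le_mul_of_nonneg_right ?_ (hg _)
        have : ((blocksIn ℓ X).filter (fun B => s B = B')).card ≤ γ ^ 2 := by
          refine (Finset.card_le_card fun B hB => ?_).trans
            (card_subBlocks_le hodd hγ hN (mem_blocksIn.1 hB').1)
          obtain ⟨h1, rfl⟩ := Finset.mem_filter.1 hB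
          exact mem_blocksIn.2 ⟨(mem_blocksIn.1 h1).1, hs' B h1⟩
        exact_mod_cast this

end Geometry

/-! ### Touching blocks, small set neighbourhoods and boundaries -/

section Touching

variable {N : ℕ} [NeZero N] {ℓ : ℕ} {t : Touch}

lemma neg_mem_unitVectors {v : ℤ × ℤ} (hv : v ∈ t.unitVectors) : -v ∈ t.unitVectors := by
  cases t
  · simpa [Touch.unitVectors] using hv
  · simpa [Touch.unitVectors] using hv

lemma Touches.symm {B D : Finset (Torus N)} (h : Touches t B D) : Touches t D B := by
  obtain ⟨x, hx, y, hy, v, hv, rfl⟩ := h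
  exact ⟨_, hy, x, hx, -v, neg_mem_unitVectors hv, by rw [toTorus_neg]; abel⟩

lemma Touches.mono {B D B' D' : Finset (Torus N)} (h : Touches t B D) (hB : B ⊆ B')
    (hD : D ⊆ D') : Touches t B' D' := by
  obtain ⟨x, hx, y, hy, v⟩ := h
  exact ⟨x, hB hx, y, hD hy, v⟩

lemma dir_mem_unitVectors (t : Touch) (μ : Fin 4) : dir μ ∈ t.unitVectors := by
  cases t <;> fin_cases μ <;> simp [dir, Touch.unitVectors]

lemma abs_le_one_of_mem_unitVectors {v : ℤ × ℤ} (hv : v ∈ t.unitVectors) :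
    |v.1| ≤ 1 ∧ |v.2| ≤ 1 := by
  cases t
  · simp only [Touch.unitVectors, Set.mem_ofPred_eq] at hv
    constructor <;> rw [← sq_le_one_iff_abs_le_one] <;> nlinarith [sq_nonneg v.1, sq_nonneg v.2]
  · simp only [Touch.unitVectors, Set.mem_ofPred_eq] at hv
    exact ⟨hv ▸ le_max_left _ _, hv ▸ le_max_right _ _⟩

lemma touches_of_add_dir {B D : Finset (Torus N)} {x : Torus N} {μ : Fin 4} (hx : x ∈ B)
    (hy : x + toTorus N (dir μ) ∈ D) : Touches t B D :=
  ⟨x, hx, _, hy, dir μ, dir_mem_unitVectors t μ, rfl⟩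

lemma int_shift_offset (hodd : Odd ℓ) {d u : ℤ} (hd : 2 * |d| ≤ ℓ) (hu : |u| ≤ 1) :
    ∃ s e : ℤ, |s| ≤ 1 ∧ 2 * |e| ≤ ℓ ∧ d + u = ℓ * s + e := by
  obtain ⟨s, e, he, h⟩ := int_exists_centred hodd (d + u)
  refine ⟨s, e, ?_, he, h⟩
  obtain ⟨k, hk⟩ := hodd
  have h1 := abs_le.1 (show |d| ≤ k by omega)
  have h2 := abs_le.1 (show |e| ≤ k by omega)
  have h3 := abs_le.1 hu
  rw [abs_le]
  have hℓ : (ℓ : ℤ) = 2 * k + 1 := by omega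
  rw [hℓ] at h
  constructor <;> nlinarith

lemma Touches.exists_shift (hodd : Odd ℓ) (hN : ℓ ∣ N) {v : ℤ × ℤ} {D : Finset (Torus N)}
    (hD : D ∈ blocks N ℓ) (h : Touches t (block N ℓ v) D) :
    ∃ s : ℤ × ℤ, |s.1| ≤ 1 ∧ |s.2| ≤ 1 ∧ D = block N ℓ (v + s) := by
  obtain ⟨x, hx, y, hy, u, hu, rfl⟩ := h
  obtain ⟨d, hd, rfl⟩ := mem_block_iff.1 hx
  obtain ⟨hu1, hu2⟩ := abs_le_one_of_mem_unitVectors hu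
  obtain ⟨s₁, e₁, hs₁, he₁, h₁⟩ := int_shift_offset hodd hd.1 hu1
  obtain ⟨s₂, e₂, hs₂, he₂, h₂⟩ := int_shift_offset hodd hd.2 hu2
  refine ⟨(s₁, s₂), hs₁, hs₂, blocks_eq_of_mem hodd hN hD (block_mem_blocks _) hy ?_⟩
  refine mem_block_iff.2 ⟨(e₁, e₂), ⟨he₁, he₂⟩, ?_⟩
  rw [← toTorus_add]
  congr 1
  ext <;> simp <;> linarith

lemma mem_nbhd {X : Finset (Torus N)} {x : Torus N} : x ∈ nbhd t ℓ X ↔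
    ∃ Y, IsSmallPolymer t ℓ Y ∧ (∃ y, y ∈ Y ∧ y ∈ X) ∧ x ∈ Y := by
  classical
  simp only [nbhd, Finset.mem_biUnion, Finset.mem_filter, Finset.mem_univ, true_and, id]
  constructor
  · rintro ⟨Y, ⟨h1, y, hy⟩, h2⟩
    exact ⟨Y, h1, ⟨y, by simpa using hy⟩, h2⟩
  · rintro ⟨Y, h1, ⟨y, hy⟩, h2⟩
    exact ⟨Y, ⟨h1, y, by simpa using hy⟩, h2⟩

lemma nbhd_mono {X Y : Finset (Torus N)} (h : X ⊆ Y) : nbhd t ℓ X ⊆ nbhd t ℓ Y := by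
  intro x hx
  obtain ⟨Z, hZ, ⟨y, hy, hy'⟩, hx⟩ := mem_nbhd.1 hx
  exact mem_nbhd.2 ⟨Z, hZ, ⟨y, hy, h hy'⟩, hx⟩

/-- Any two blocks of a small polymer are joined by a chain of at most three steps between touching
blocks. -/
lemma IsSmallPolymer.chain {Y : Finset (Torus N)} (hY : IsSmallPolymer t ℓ Y)
    {B D : Finset (Torus N)} (hB : B ∈ blocksIn ℓ Y) (hD : D ∈ blocksIn ℓ Y)
    (P : ℕ → Finset (Torus N) → Prop) (h0 : P 0 B)
    (hstep : ∀ n, ∀ E ∈ blocksIn ℓ Y, ∀ F ∈ blocksIn ℓ Y, Touches t E F → P n E → P (n + 1) F)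
    (hmono : ∀ n m E, n ≤ m → P n E → P m E) : P 3 D := by
  classical
  -- A reflexive transitive chain carries no bound on its length. In a graph with at most four
  -- vertices it can be shortened to a path, which has at most three edges.
  let G : SimpleGraph {E // E ∈ blocksIn ℓ Y} :=
    { Adj := fun E F => E ≠ F ∧ Touches t E.1 F.1
      symm := ⟨fun E F h => ⟨h.1.symm, h.2.symm⟩⟩
      loopless := ⟨fun E h => h.1 rfl⟩ }
  have hreach : ∀ E, Relation.ReflTransGen
      (fun B₁ B₂ => B₂ ∈ blocksIn ℓ Y ∧ Touches t B₁ B₂) B E →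
      ∃ hE : E ∈ blocksIn ℓ Y, G.Reachable ⟨B, hB⟩ ⟨E, hE⟩ := by
    intro E h
    induction h with
    | refl => exact ⟨hB, SimpleGraph.Reachable.refl _⟩
    | tail _ hst ih =>
      obtain ⟨hE, hr⟩ := ih
      refine ⟨hst.1, ?_⟩
      rename_i E F _
      by_cases hEF : E = F
      · subst hEF; exact hr
      · exact hr.trans (SimpleGraph.Adj.reachable ⟨fun h => hEF (congrArg Subtype.val h), hst.2⟩)
  obtain ⟨_, ⟨w⟩⟩ := hreach D (hY.1.2.2 B hB D hD)
  have hlen : w.toPath.1.length ≤ 3 := by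
    have h1 := w.toPath.2.length_lt
    have h2 : Fintype.card {E // E ∈ blocksIn ℓ Y} = (blocksIn ℓ Y).card := Fintype.card_coe _
    have := hY.2
    omega
  have hwalk : ∀ (E F : {E // E ∈ blocksIn ℓ Y}) (p : G.Walk E F) (n : ℕ), P n E.1 →
      P (n + p.length) F.1 := by
    intro E F p
    induction p with
    | nil => intro n h; exact h
    | cons hadj p ih =>
      intro n h
      have := ih (n + 1) (hstep n _ (Subtype.mem _) _ (Subtype.mem _) hadj.2 h)
      rwa [SimpleGraph.Walk.length_cons, show n + (p.length + 1) = n + 1 + p.length by ring]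
  have := hwalk _ _ w.toPath.1 0 h0
  exact hmono _ _ _ (by omega) this

/-- The small set neighbourhood of a block is covered by the `7 × 7` neighbouring blocks. -/
lemma exists_shift_of_mem_nbhd (hodd : Odd ℓ) (hN : ℓ ∣ N) {v : ℤ × ℤ} {x : Torus N}
    (hx : x ∈ nbhd t ℓ (block N ℓ v)) :
    ∃ s ∈ Finset.Icc (-3 : ℤ) 3 ×ˢ Finset.Icc (-3 : ℤ) 3, x ∈ block N ℓ (v + s) := by
  obtain ⟨Y, hY, ⟨y, hyY, hyB⟩, hxY⟩ := mem_nbhd.1 hx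
  have hB : block N ℓ v ∈ blocksIn ℓ Y := mem_blocksIn.2 ⟨block_mem_blocks v,
    polymer_block_subset hodd hN hY.1.1 (block_mem_blocks v) hyY hyB⟩
  obtain ⟨D, hD, hxD⟩ := exists_blocksIn hodd hN hY.1.1 hxY
  obtain ⟨s, h1, h2, rfl⟩ := hY.chain hB hD
    (fun n E => ∃ s : ℤ × ℤ, |s.1| ≤ n ∧ |s.2| ≤ n ∧ E = block N ℓ (v + s))
    ⟨0, by simp, by simp, by simp⟩
    (by
      rintro n E hE F hF hEF ⟨s, h1, h2, rfl⟩
      obtain ⟨u, h3, h4, rfl⟩ := hEF.exists_shift hodd hN (mem_blocksIn.1 hF).1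
      refine ⟨s + u, ?_, ?_, by rw [add_assoc]⟩
      · push_cast; exact (abs_add_le _ _).trans (add_le_add h1 h3)
      · push_cast; exact (abs_add_le _ _).trans (add_le_add h2 h4))
    (by
      rintro n m E hnm ⟨s, h1, h2, h3⟩
      exact ⟨s, h1.trans (by exact_mod_cast hnm), h2.trans (by exact_mod_cast hnm), h3⟩)
  refine ⟨s, ?_, hxD⟩
  simp only [Finset.mem_product, Finset.mem_Icc, ← abs_le]
  exact ⟨by exact_mod_cast h1, by exact_mod_cast h2⟩

/-- This serves to show that the neighbourhood B^* contains every block touching B, so that norms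
over B^* control derivatives along lines leaving B. -/
lemma isSmallPolymer_union (hodd : Odd ℓ) (hN : ℓ ∣ N) {B D : Finset (Torus N)}
    (hB : B ∈ blocks N ℓ) (hD : D ∈ blocks N ℓ) (h : B = D ∨ Touches t B D) :
    IsSmallPolymer t ℓ (B ∪ D) := by
  classical
  have hsub : ∀ E ∈ blocksIn ℓ (B ∪ D), E = B ∨ E = D := by
    intro E hE
    obtain ⟨h1, h2⟩ := mem_blocksIn.1 hE
    obtain ⟨x, hx⟩ := blocks_nonempty h1
    rcases Finset.mem_union.1 (h2 hx) with h3 | h3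
    · exact Or.inl (blocks_eq_of_mem hodd hN h1 hB hx h3)
    · exact Or.inr (blocks_eq_of_mem hodd hN h1 hD hx h3)
  refine ⟨⟨⟨{B, D}, ?_, ?_⟩, ?_, ?_⟩, ?_⟩
  · intro E hE
    rcases Finset.mem_insert.1 hE with rfl | hE
    · exact hB
    · rw [Finset.mem_singleton.1 hE]; exact hD
  · simp
  · exact (blocks_nonempty hB).mono Finset.subset_union_left
  · intro E hE F hF
    rcases hsub E hE with rfl | rfl <;> rcases hsub F hF with rfl | rfl
    · exact .refl
    · rcases h with rfl | h
      · exact .refl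
      · exact .single ⟨hF, h⟩
    · rcases h with rfl | h
      · exact .refl
      · exact .single ⟨hF, h.symm⟩
    · exact .refl
  · refine (Finset.card_le_card (t := {B, D}) fun E hE => ?_).trans
      (Finset.card_le_two.trans (by norm_num))
    simpa using hsub E hE

lemma subset_nbhd_of_touches (hodd : Odd ℓ) (hN : ℓ ∣ N) {B D : Finset (Torus N)}
    (hB : B ∈ blocks N ℓ) (hD : D ∈ blocks N ℓ) (h : B = D ∨ Touches t B D) :
    D ⊆ nbhd t ℓ B := by
  classical
  intro x hx
  obtain ⟨y, hy⟩ := blocks_nonempty hB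
  exact mem_nbhd.2 ⟨_, isSmallPolymer_union hodd hN hB hD h, ⟨y, Finset.mem_union_left _ hy, hy⟩,
    Finset.mem_union_right _ hx⟩

lemma subset_nbhd (hodd : Odd ℓ) (hN : ℓ ∣ N) {B : Finset (Torus N)} (hB : B ∈ blocks N ℓ) :
    B ⊆ nbhd t ℓ B :=
  subset_nbhd_of_touches hodd hN hB hB (Or.inl rfl)

variable {γ : ℕ}

/-- The closure of a small polymer is small. -/
lemma IsSmallPolymer.closure (hodd : Odd ℓ) (hγ : Odd γ) (hN : γ * ℓ ∣ N)
    {Y : Finset (Torus N)} (hY : IsSmallPolymer t ℓ Y) :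
    IsSmallPolymer t (γ * ℓ) (polymerClosure (γ * ℓ) Y) := by
  classical
  refine ⟨⟨isPolymer_polymerClosure _ _, hY.1.2.1.mono
    (subset_polymerClosure (odd_coarse hodd hγ) Y), ?_⟩,
    (card_blocksIn_closure_le hodd hγ hN hY.1.1).trans hY.2⟩
  intro B' hB' D' hD'
  obtain ⟨B, hB, hBB⟩ := exists_subBlock hodd hγ hN hY.1.1 hB'
  obtain ⟨D, hD, hDD⟩ := exists_subBlock hodd hγ hN hY.1.1 hD'
  have key : ∀ E, Relation.ReflTransGen
      (fun B₁ B₂ => B₂ ∈ blocksIn ℓ Y ∧ Touches t B₁ B₂) B E → E ∈ blocksIn ℓ Y ∧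
      ∀ E' ∈ blocksIn (γ * ℓ) (polymerClosure (γ * ℓ) Y), E ⊆ E' →
      Relation.ReflTransGen
        (fun B₁ B₂ => B₂ ∈ blocksIn (γ * ℓ) (polymerClosure (γ * ℓ) Y) ∧ Touches t B₁ B₂)
        B' E' := by
    intro E h
    induction h with
    | refl =>
      refine ⟨hB, fun E' hE' hBE => ?_⟩
      obtain ⟨x, hx⟩ := blocks_nonempty (mem_blocksIn.1 hB).1
      rw [blocks_eq_of_mem (odd_coarse hodd hγ) hN (mem_blocksIn.1 hB').1 (mem_blocksIn.1 hE').1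
        (hBB hx) (hBE hx)]
    | tail _ hst ih =>
      refine ⟨hst.1, fun F' hF' hF => ?_⟩
      obtain ⟨E', hE', hEE⟩ := exists_superBlock hodd hγ hN ih.1
      exact (ih.2 E' hE' hEE).tail ⟨hF', hst.2.mono hEE hF⟩
  exact (key D (hY.1.2.2 B hB D hD)).2 D' hD' hDD

lemma nbhd_subset_coarse (hodd : Odd ℓ) (hγ : Odd γ) (hN : γ * ℓ ∣ N) (X : Finset (Torus N)) :
    nbhd t ℓ X ⊆ nbhd t (γ * ℓ) X := by
  intro x hx
  obtain ⟨Y, hY, ⟨y, hyY, hyX⟩, hxY⟩ := mem_nbhd.1 hx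
  have hs := subset_polymerClosure (odd_coarse hodd hγ) Y
  exact mem_nbhd.2 ⟨_, hY.closure hodd hγ hN, ⟨y, hs hyY, hyX⟩, hs hxY⟩

lemma exists_block_of_mem_nbhd (hodd : Odd ℓ) (hN : ℓ ∣ N) {X : Finset (Torus N)}
    (hX : IsPolymer ℓ X) {x : Torus N} (hx : x ∈ nbhd t ℓ X) :
    ∃ B ∈ blocksIn ℓ X, x ∈ nbhd t ℓ B := by
  obtain ⟨Y, hY, ⟨y, hyY, hyX⟩, hxY⟩ := mem_nbhd.1 hx
  obtain ⟨B, hB, hyB⟩ := exists_blocksIn hodd hN hX hyX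
  exact ⟨B, hB, mem_nbhd.2 ⟨Y, hY, ⟨y, hyY, hyB⟩, hxY⟩⟩

/-! #### Boundaries -/

lemma mem_boundary {X : Finset (Torus N)} {x : Torus N} :
    x ∈ boundary X ↔ x ∈ X ∧ ∃ μ : Fin 4, x + toTorus N (dir μ) ∉ X := by
  classical
  simp [boundary]

/-- `dir (μ + 1)` is `dir μ` turned by a right angle, so offsets can be written in the frame normal
and tangent to a face, and the four faces are treated at once. -/
lemma frame_offset (μ : Fin 4) {a i : ℤ} (ha : 2 * |a| ≤ ℓ) (hi : 2 * |i| ≤ ℓ) :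
    2 * |(a • dir μ + i • dir (μ + 1)).1| ≤ ℓ ∧ 2 * |(a • dir μ + i • dir (μ + 1)).2| ≤ ℓ := by
  fin_cases μ <;> simp [dir, ha, hi]

lemma exit_offset (hodd : Odd ℓ) (μ : Fin 4) {d : ℤ × ℤ} (hd : 2 * |d.1| ≤ ℓ ∧ 2 * |d.2| ≤ ℓ)
    (h : ¬ (2 * |(d + dir μ).1| ≤ ℓ ∧ 2 * |(d + dir μ).2| ≤ ℓ)) :
    ∃ i : ℤ, 2 * |i| ≤ ℓ ∧ d = ((ℓ / 2 : ℕ) : ℤ) • dir μ + i • dir (μ + 1) := by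
  obtain ⟨k, hk⟩ := hodd
  have e : ((ℓ / 2 : ℕ) : ℤ) = k := by omega
  have conv : ∀ a : ℤ, 2 * |a| ≤ ℓ ↔ -(k : ℤ) ≤ a ∧ a ≤ k := by
    intro a; rw [← abs_le]; omega
  obtain ⟨d₁, d₂⟩ := d
  rw [e]
  simp only [conv] at hd h ⊢
  fin_cases μ
  · refine ⟨d₂, hd.2, ?_⟩
    simp [dir] at h ⊢; omega
  · refine ⟨-d₁, by omega, ?_⟩
    simp [dir] at h ⊢; omega
  · refine ⟨-d₂, by omega, ?_⟩
    simp [dir] at h ⊢; omega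
  · refine ⟨d₁, hd.1, ?_⟩
    simp [dir] at h ⊢; omega

lemma exit_site (hodd : Odd ℓ) {v : ℤ × ℤ} {x : Torus N} {μ : Fin 4} (hx : x ∈ block N ℓ v)
    (hx' : x + toTorus N (dir μ) ∉ block N ℓ v) : ∃ i : ℤ, 2 * |i| ≤ ℓ ∧
      x = toTorus N ((ℓ : ℤ) • v + (((ℓ / 2 : ℕ) : ℤ) • dir μ + i • dir (μ + 1))) := by
  obtain ⟨d, hd, rfl⟩ := mem_block_iff.1 hx
  obtain ⟨i, hi, h⟩ := exit_offset hodd μ hd (fun h => hx' (mem_block_iff.2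
    ⟨d + dir μ, h, by rw [← toTorus_add, add_assoc]⟩))
  exact ⟨i, hi, by rw [h]⟩

/-- The lattice line that leaves a block through a face runs through the opposite block. -/
lemma line_mem_block (hodd : Odd ℓ) {v : ℤ × ℤ} {x : Torus N} {μ : Fin 4}
    (hx : x ∈ block N ℓ v) (hx' : x + toTorus N (dir μ) ∉ block N ℓ v) {m : ℕ} (h1 : 1 ≤ m)
    (hm : m ≤ ℓ) : x + toTorus N ((m : ℤ) • dir μ) ∈ block N ℓ (v + dir μ) := by
  obtain ⟨i, hi, rfl⟩ := exit_site hodd hx hx'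
  obtain ⟨k, hk⟩ := hodd
  -- The normal coordinate (ℓ-1)/2 + m, counted from the old centre, is reduced by ℓ for the new
  -- centre. For 1 ≤ m ≤ ℓ it runs from -(ℓ-1)/2 to (ℓ-1)/2.
  refine mem_block_iff.2 ⟨((ℓ / 2 : ℕ) + m - ℓ : ℤ) • dir μ + i • dir (μ + 1),
    frame_offset μ ?_ hi, ?_⟩
  · have : |((ℓ / 2 : ℕ) + m - ℓ : ℤ)| ≤ k := by rw [abs_le]; omega
    omega
  · rw [← toTorus_add]
    congr 1
    module

lemma card_exit_le (hodd : Odd ℓ) (v : ℤ × ℤ) (μ : Fin 4) :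
    ((block N ℓ v).filter fun x => x + toTorus N (dir μ) ∉ block N ℓ v).card ≤ ℓ := by
  classical
  refine (Finset.card_le_card (t := (Finset.Icc (-((ℓ / 2 : ℕ) : ℤ)) ((ℓ / 2 : ℕ) : ℤ)).image
    fun i => toTorus N ((ℓ : ℤ) • v + (((ℓ / 2 : ℕ) : ℤ) • dir μ + i • dir (μ + 1))))
    fun x hx => ?_).trans (Finset.card_image_le.trans ?_)
  · obtain ⟨h1, h2⟩ := Finset.mem_filter.1 hx
    obtain ⟨i, hi, rfl⟩ := exit_site hodd h1 h2
    refine Finset.mem_image.2 ⟨i, ?_, rfl⟩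
    rw [Finset.mem_Icc, ← abs_le]
    omega
  · obtain ⟨k, rfl⟩ := hodd
    simp
    omega

lemma card_boundary_inter_le (hodd : Odd ℓ)
    {X B : Finset (Torus N)} (hB : B ∈ blocksIn ℓ X) :
    ((boundary X ∩ B).card : ℝ) ≤ 4 * ℓ := by
  obtain ⟨h1, h2⟩ := mem_blocksIn.1 hB
  obtain ⟨v, rfl⟩ := mem_blocks.1 h1
  have hsub : boundary X ∩ block N ℓ v ⊆ Finset.univ.biUnion fun μ : Fin 4 =>
      (block N ℓ v).filter fun x => x + toTorus N (dir μ) ∉ block N ℓ v := by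
    intro x hx
    obtain ⟨h3, h4⟩ := Finset.mem_inter.1 hx
    obtain ⟨-, μ, hμ⟩ := mem_boundary.1 h3
    exact Finset.mem_biUnion.2 ⟨μ, Finset.mem_univ _,
      Finset.mem_filter.2 ⟨h4, fun h => hμ (h2 h)⟩⟩
  have : (boundary X ∩ block N ℓ v).card ≤ ∑ μ : Fin 4, ℓ :=
    (Finset.card_le_card hsub).trans
      (Finset.card_biUnion_le.trans (Finset.sum_le_sum fun μ _ => card_exit_le hodd v μ))
  simp only [Finset.sum_const, Finset.card_univ, Fintype.card_fin, smul_eq_mul] at this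
  exact_mod_cast this

/-- The lines that leave `X` through the part of its boundary in the interior of `X'` are disjoint
and contained in `X' \ X`. -/
lemma sum_lines_le (hodd : Odd ℓ) (hN : ℓ ∣ N) {X X' : Finset (Torus N)}
    (hX : IsPolymer ℓ X) (hX' : IsPolymer ℓ X') (hXX : X ⊆ X') (μ : Fin 4) (f : Torus N → ℝ)
    (hf : ∀ x, 0 ≤ f x) :
    ∑ x ∈ (boundary X \ boundary X').filter (fun x => x + toTorus N (dir μ) ∉ X),
      ∑ m ∈ Finset.Icc 1 ℓ, f (x + toTorus N ((m : ℤ) • dir μ)) ≤ ∑ x ∈ X' \ X, f x := by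
  set T := (boundary X \ boundary X').filter (fun x => x + toTorus N (dir μ) ∉ X) with hT
  have hD : ∀ x ∈ T, ∃ D ∈ blocks N ℓ, D ⊆ X' ∧ Disjoint D X ∧
      ∀ m ∈ Finset.Icc 1 ℓ, x + toTorus N ((m : ℤ) • dir μ) ∈ D := by
    intro x hx
    obtain ⟨h1, h2⟩ := Finset.mem_filter.1 hx
    obtain ⟨h3, h4⟩ := Finset.mem_sdiff.1 h1
    have hxX := (mem_boundary.1 h3).1
    obtain ⟨B, hB, hxB⟩ := exists_blocksIn hodd hN hX hxX
    obtain ⟨v, rfl⟩ := mem_blocks.1 (mem_blocksIn.1 hB).1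
    have hline := fun m (hm : m ∈ Finset.Icc 1 ℓ) => line_mem_block (m := m) hodd hxB
      (fun h => h2 ((mem_blocksIn.1 hB).2 h)) (Finset.mem_Icc.1 hm).1 (Finset.mem_Icc.1 hm).2
    have hfirst := hline 1 (Finset.mem_Icc.2 ⟨le_rfl, hodd.pos⟩)
    rw [Nat.cast_one, one_smul] at hfirst
    refine ⟨_, block_mem_blocks (v + dir μ), ?_, ?_, hline⟩
    · refine polymer_block_subset hodd hN hX' (block_mem_blocks _) ?_ hfirst
      by_contra h
      exact h4 (mem_boundary.2 ⟨hXX hxX, μ, h⟩)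
    · rw [Finset.disjoint_left]
      intro y hy hyX
      exact h2 (polymer_block_subset hodd hN hX (block_mem_blocks _) hyX hy hfirst)
  have hTX : ∀ x ∈ T, x ∈ X := fun x hx =>
    (mem_boundary.1 (Finset.mem_sdiff.1 (Finset.mem_filter.1 hx).1).1).1
  -- If two parallel lines collided at different times, the starting site x of one would lie on the
  -- line of the other. But x belongs to X, and the lines avoid X.
  have aux : ∀ x ∈ T, ∀ y ∈ T, ∀ m ∈ Finset.Icc 1 ℓ, ∀ n ∈ Finset.Icc 1 ℓ, m < n →
      x + toTorus N ((m : ℤ) • dir μ) ≠ y + toTorus N ((n : ℤ) • dir μ) := by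
    intro x hx y hy m hm n hn hmn h
    obtain ⟨D, -, -, h3, h4⟩ := hD y hy
    have h5 := h4 (n - m) (Finset.mem_Icc.2 ⟨by omega, by have := (Finset.mem_Icc.1 hn).2; omega⟩)
    rw [Nat.cast_sub hmn.le, sub_smul, toTorus_sub, ← add_sub_assoc, ← h, add_sub_cancel_right]
      at h5
    exact Finset.disjoint_left.1 h3 h5 (hTX x hx)
  rw [← Finset.sum_product', ← Finset.sum_image (s := T ×ˢ Finset.Icc 1 ℓ)
    (g := fun p => p.1 + toTorus N ((p.2 : ℤ) • dir μ)) (f := f)]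
  · refine Finset.sum_le_sum_of_subset_of_nonneg ?_ fun x _ _ => hf x
    intro z hz
    obtain ⟨⟨x, m⟩, hp, rfl⟩ := Finset.mem_image.1 hz
    obtain ⟨hx, hm⟩ := Finset.mem_product.1 hp
    obtain ⟨D, -, h2, h3, h4⟩ := hD x hx
    exact Finset.mem_sdiff.2 ⟨h2 (h4 m hm), Finset.disjoint_left.1 h3 (h4 m hm)⟩
  · rintro ⟨x, m⟩ hp ⟨y, n⟩ hq h
    obtain ⟨hx, hm⟩ := Finset.mem_product.1 hp
    obtain ⟨hy, hn⟩ := Finset.mem_product.1 hq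
    simp only at h hx hm hy hn
    rcases lt_trichotomy m n with hmn | rfl | hmn
    · exact absurd h (aux x hx y hy m hm n hn hmn)
    · rw [add_left_inj] at h
      rw [h]
    · exact absurd h.symm (aux y hy x hx n hn m hm hmn)

end Touching

/-! ### Deterministic bounds on the field regulator -/

section Regulator

variable {N : ℕ} [NeZero N] {ℓ : ℕ} {t : Touch}

/-- The lattice derivative in the direction `dir μ` on the periodic lattice. -/
def deriv1 {V : Type*} [Sub V] (μ : Fin 4) (f : Torus N → V) : Torus N → V :=
  diff (toTorus N (dir μ)) f

lemma deriv1_apply {V : Type*} [Sub V] (μ : Fin 4) (f : Torus N → V) (x : Torus N) :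
    deriv1 μ f x = f (x + toTorus N (dir μ)) - f x := rfl

lemma grad_one (μ : Fin 1 → Fin 4) (φ : Torus N → ℂ) : grad μ φ = deriv1 (μ 0) φ := by
  simp [grad, diffs, deriv1]

lemma grad_two (μ : Fin 2 → Fin 4) (φ : Torus N → ℂ) :
    grad μ φ = deriv1 (μ 0) (deriv1 (μ 1) φ) := by
  simp [grad, diffs, deriv1]

/-- The sum of the squares of the four lattice derivatives. -/
noncomputable def gradSum (φ : Torus N → ℂ) (x : Torus N) : ℝ := ∑ μ, ‖deriv1 μ φ x‖ ^ 2

lemma gradSum_nonneg (φ : Torus N → ℂ) (x : Torus N) : 0 ≤ gradSum φ x :=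
  Finset.sum_nonneg fun _ _ => by positivity

lemma gradSq_one (φ : Torus N → ℂ) (x : Torus N) :
    gradSq 1 ℓ φ x = 1 / 2 * (ℓ : ℝ) ^ 2 * gradSum φ x := by
  rw [gradSq, gradSum, pow_one, mul_assoc, Finset.mul_sum (s := Finset.univ) (a := (ℓ : ℝ) ^ 2)]
  congr 1

lemma le_supNorm {n : ℕ} (φ : Torus N → ℂ) {X : Finset (Torus N)} {x : Torus N} (hx : x ∈ X)
    (μ : Fin n → Fin 4) : (ℓ : ℝ) ^ n * ‖grad μ φ x‖ ≤ supNorm n ℓ φ X := by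
  refine mul_le_mul_of_nonneg_left ?_ (by positivity)
  rw [← coe_nnnorm, NNReal.coe_le_coe]
  exact (Finset.le_sup (f := fun μ : Fin n → Fin 4 => ‖grad μ φ x‖₊) (Finset.mem_univ μ)).trans
    (Finset.le_sup (f := fun x => Finset.univ.sup fun μ : Fin n → Fin 4 => ‖grad μ φ x‖₊) hx)

lemma supNorm_nonneg (n : ℕ) (φ : Torus N → ℂ) (X : Finset (Torus N)) : 0 ≤ supNorm n ℓ φ X := by
  unfold supNorm; positivity

lemma supNorm_le {n : ℕ} (hℓ : 0 < ℓ) (φ : Torus N → ℂ) {X : Finset (Torus N)} {a : ℝ}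
    (ha : 0 ≤ a) (h : ∀ x ∈ X, ∀ μ : Fin n → Fin 4, (ℓ : ℝ) ^ n * ‖grad μ φ x‖ ≤ a) :
    supNorm n ℓ φ X ≤ a := by
  have hℓ' : (0 : ℝ) < (ℓ : ℝ) ^ n := by positivity
  have h1 : (X.sup fun x => Finset.univ.sup fun μ : Fin n → Fin 4 => ‖grad μ φ x‖₊) ≤
      Real.toNNReal (a / (ℓ : ℝ) ^ n) := by
    refine Finset.sup_le fun x hx => Finset.sup_le fun μ _ => ?_
    rw [← norm_toNNReal]
    refine Real.toNNReal_le_toNNReal ?_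
    rw [le_div_iff₀ hℓ', mul_comm]
    exact h x hx μ
  have h2 := NNReal.coe_le_coe.2 h1
  rw [Real.coe_toNNReal _ (by positivity), le_div_iff₀ hℓ', mul_comm] at h2
  exact h2

lemma supNorm_mono (n : ℕ) (φ : Torus N → ℂ) {X Y : Finset (Torus N)} (h : X ⊆ Y) :
    supNorm n ℓ φ X ≤ supNorm n ℓ φ Y := by
  refine mul_le_mul_of_nonneg_left ?_ (by positivity)
  exact_mod_cast Finset.sup_mono h

lemma deriv2_le_supNorm (φ : Torus N → ℂ) {X : Finset (Torus N)} {x : Torus N} (hx : x ∈ X)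
    (μ ν : Fin 4) : (ℓ : ℝ) ^ 2 * ‖deriv1 μ (deriv1 ν φ) x‖ ≤ supNorm 2 ℓ φ X := by
  have := le_supNorm (ℓ := ℓ) φ hx ![μ, ν]
  simpa [grad_two] using this

lemma supNorm_one_le (hℓ : 0 < ℓ) (φ : Torus N → ℂ) {X : Finset (Torus N)} {a : ℝ}
    (ha : 0 ≤ a) (h : ∀ x ∈ X, ∀ μ, (ℓ : ℝ) * ‖deriv1 μ φ x‖ ≤ a) : supNorm 1 ℓ φ X ≤ a :=
  supNorm_le hℓ φ ha fun x hx μ => by rw [grad_one, pow_one]; exact h x hx _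

lemma supNorm_two_le (hℓ : 0 < ℓ) (φ : Torus N → ℂ) {X : Finset (Torus N)} {a : ℝ}
    (ha : 0 ≤ a) (h : ∀ x ∈ X, ∀ μ ν, (ℓ : ℝ) ^ 2 * ‖deriv1 μ (deriv1 ν φ) x‖ ≤ a) :
    supNorm 2 ℓ φ X ≤ a :=
  supNorm_le hℓ φ ha fun x hx μ => by rw [grad_two]; exact h x hx _ _

lemma supNorm_coarse {γ n : ℕ} (φ : Torus N → ℂ) (X : Finset (Torus N)) :
    supNorm n (γ * ℓ) φ X = (γ : ℝ) ^ n * supNorm n ℓ φ X := by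
  unfold supNorm; push_cast; ring

/-- `κ⁻¹ ln G(φ, X)`. -/
noncomputable def energy (t : Touch) (c₁ c₃ : ℝ) (ℓ : ℕ) (φ : Torus N → ℂ)
    (X : Finset (Torus N)) : ℝ :=
  c₁ / 2 * ∑ x ∈ X, gradSum φ x + c₃ * ℓ / 2 * ∑ x ∈ boundary X, gradSum φ x
    + c₁ * sqW t 2 ℓ φ X

lemma regulator_eq (hℓ : 0 < ℓ) (t : Touch) (c₁ c₃ κ : ℝ) (φ : Torus N → ℂ)
    (X : Finset (Torus N)) :
    regulator t c₁ c₃ κ ℓ φ X = Real.exp (κ * energy t c₁ c₃ ℓ φ X) := by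
  have h : (ℓ : ℝ) ≠ 0 := by positivity
  rw [regulator, energy, sqNormL2, sqNormL2Boundary]
  simp only [gradSq_one, ← Finset.mul_sum]
  congr 1
  field_simp

lemma deriv1_shift (φ : Torus N → ℂ) (ζ : Torus N → ℝ) (μ : Fin 4) :
    deriv1 μ (fun x => φ x + (ζ x : ℂ)) = fun x => deriv1 μ φ x + ((deriv1 μ ζ x : ℝ) : ℂ) := by
  ext x
  simp only [deriv1_apply]
  push_cast
  ring

/-- The exact expansion, for the bulk term, where the coefficient of |∂φ|² has to stay one. As ζ is
real, only the real part of φ enters the cross term. -/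
lemma gradSum_shift (φ : Torus N → ℂ) (ζ : Torus N → ℝ) (x : Torus N) :
    gradSum (fun x => φ x + (ζ x : ℂ)) x = gradSum φ x
      + 2 * ∑ μ, deriv1 μ (fun y => (φ y).re) x * deriv1 μ ζ x + ∑ μ, deriv1 μ ζ x ^ 2 := by
  unfold gradSum
  rw [Finset.mul_sum, ← Finset.sum_add_distrib, ← Finset.sum_add_distrib]
  refine Finset.sum_congr rfl fun μ _ => ?_
  rw [deriv1_shift, ← Complex.normSq_eq_norm_sq, ← Complex.normSq_eq_norm_sq]
  simp only [Complex.normSq_apply, deriv1_apply, Complex.add_re, Complex.add_im, Complex.ofReal_re,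
    Complex.ofReal_im, Complex.sub_re]
  ring

/-- The cruder version, for the boundary term, where a factor two can be afforded. -/
lemma gradSum_shift_le (φ : Torus N → ℂ) (ζ : Torus N → ℝ) (x : Torus N) :
    gradSum (fun x => φ x + (ζ x : ℂ)) x ≤ 2 * gradSum φ x + 2 * ∑ μ, deriv1 μ ζ x ^ 2 := by
  unfold gradSum
  rw [Finset.mul_sum, Finset.mul_sum, ← Finset.sum_add_distrib]
  refine Finset.sum_le_sum fun μ _ => ?_
  rw [deriv1_shift]
  have h1 := norm_add_le (deriv1 μ φ x) ((deriv1 μ ζ x : ℝ) : ℂ)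
  rw [Complex.norm_real, Real.norm_eq_abs] at h1
  have h2 := norm_nonneg (deriv1 μ φ x + ((deriv1 μ ζ x : ℝ) : ℂ))
  rw [← sq_abs (deriv1 μ ζ x)]
  nlinarith [sq_nonneg (‖deriv1 μ φ x‖ - |deriv1 μ ζ x|)]

/-! #### Summation by parts -/

lemma dir_add_two (μ : Fin 4) : dir (μ + 2) = -dir μ := by
  fin_cases μ <;> simp [dir]

/-- Pairing opposite directions turns the sum of first derivatives into second derivatives, which
`supNorm 2` controls. -/
lemma laplacian_eq {V : Type*} [AddCommGroup V] (f : Torus N → V) (x : Torus N) :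
    ∑ μ, deriv1 μ f x = -(deriv1 0 (deriv1 2 f) x + deriv1 1 (deriv1 3 f) x) := by
  have h2 : toTorus N (dir 2) = -toTorus N (dir 0) := by
    rw [← toTorus_neg, ← dir_add_two]; rfl
  have h3 : toTorus N (dir 3) = -toTorus N (dir 1) := by
    rw [← toTorus_neg, ← dir_add_two]; rfl
  simp only [Fin.sum_univ_four, deriv1_apply, h2, h3, add_neg_cancel_right]
  abel

/-- Each bond inside X is counted from both of its ends: ∂a changes sign while the sum of the two
values of ζ does not, so opposite directions cancel. -/
lemma sum_antisymm (a ζ : Torus N → ℝ) (X : Finset (Torus N)) :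
    ∑ μ, ∑ x ∈ X, (if x + toTorus N (dir μ) ∈ X then
      deriv1 μ a x * (ζ x + ζ (x + toTorus N (dir μ))) else 0) = 0 := by
  have key : ∀ μ : Fin 4, ∑ x ∈ X, (if x + toTorus N (dir (μ + 2)) ∈ X then
      deriv1 (μ + 2) a x * (ζ x + ζ (x + toTorus N (dir (μ + 2)))) else 0) =
      -∑ x ∈ X, (if x + toTorus N (dir μ) ∈ X then
      deriv1 μ a x * (ζ x + ζ (x + toTorus N (dir μ))) else 0) := by
    intro μ
    rw [← Finset.sum_filter, ← Finset.sum_filter, ← Finset.sum_neg_distrib]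
    refine Finset.sum_bij' (fun x _ => x - toTorus N (dir μ)) (fun x _ => x + toTorus N (dir μ))
      ?_ ?_ ?_ ?_ ?_
    · intro x hx
      simp only [Finset.mem_filter, dir_add_two, toTorus_neg, ← sub_eq_add_neg] at hx ⊢
      exact ⟨hx.2, by simpa using hx.1⟩
    · intro x hx
      simp only [Finset.mem_filter, dir_add_two, toTorus_neg, ← sub_eq_add_neg] at hx ⊢
      exact ⟨hx.2, by simpa using hx.1⟩
    · intro x _; simp
    · intro x _; simp
    · intro x _
      simp only [deriv1_apply, dir_add_two, toTorus_neg, ← sub_eq_add_neg, sub_add_cancel]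
      ring
  rw [Fin.sum_univ_four]
  have h0 := key 0
  have h1 := key 1
  rw [show (0 : Fin 4) + 2 = 2 from rfl] at h0
  rw [show (1 : Fin 4) + 2 = 3 from rfl] at h1
  rw [h0, h1]
  ring

/-- Write ∂ζ(x) = (ζ(x) + ζ(x+μ)) - 2 ζ(x). The symmetric part cancels on the bonds inside X by
`sum_antisymm`, and only the bonds leaving X keep it. -/
lemma sum_by_parts (a ζ : Torus N → ℝ) (X : Finset (Torus N)) :
    ∑ x ∈ X, ∑ μ, deriv1 μ a x * deriv1 μ ζ x =
      -2 * ∑ x ∈ X, ζ x * ∑ μ, deriv1 μ a x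
      + ∑ x ∈ X, ∑ μ, (if x + toTorus N (dir μ) ∈ X then 0 else
        deriv1 μ a x * (ζ x + ζ (x + toTorus N (dir μ)))) := by
  have h := sum_antisymm a ζ X
  rw [Finset.sum_comm] at h
  refine sub_eq_zero.1 (Eq.trans ?_ h)
  rw [Finset.mul_sum, ← Finset.sum_add_distrib, ← Finset.sum_sub_distrib]
  refine Finset.sum_congr rfl fun x _ => ?_
  rw [Finset.mul_sum, Finset.mul_sum, ← Finset.sum_add_distrib, ← Finset.sum_sub_distrib]
  refine Finset.sum_congr rfl fun μ _ => ?_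
  split_ifs <;> simp only [deriv1_apply] <;> ring

/-- `z B` bounds the field `ζ` and its first and second derivatives in the small set
neighbourhoods of the blocks of `X`. -/
structure FieldBound (t : Touch) (ℓ : ℕ) (ζ : Torus N → ℝ) (X : Finset (Torus N))
    (z : Finset (Torus N) → ℝ) : Prop where
  nonneg : ∀ B, 0 ≤ z B
  zero : ∀ B ∈ blocksIn ℓ X, ∀ x ∈ nbhd t ℓ B, |ζ x| ≤ z B
  one : ∀ B ∈ blocksIn ℓ X, ∀ x ∈ nbhd t ℓ B, ∀ μ, ℓ * |deriv1 μ ζ x| ≤ z B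
  two : ∀ B ∈ blocksIn ℓ X, ∀ x ∈ nbhd t ℓ B, ∀ μ ν, (ℓ : ℝ) ^ 2 * |deriv1 μ (deriv1 ν ζ) x| ≤ z B

variable {X : Finset (Torus N)} {ζ : Torus N → ℝ} {z : Finset (Torus N) → ℝ}

lemma FieldBound.gradSum_le (hz : FieldBound t ℓ ζ X z) (hℓ : 0 < ℓ) {B : Finset (Torus N)}
    (hB : B ∈ blocksIn ℓ X) {x : Torus N} (hx : x ∈ nbhd t ℓ B) :
    ∑ μ, deriv1 μ ζ x ^ 2 ≤ 4 * z B ^ 2 / (ℓ : ℝ) ^ 2 := by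
  have hℓ' : (0 : ℝ) < ℓ := by positivity
  have h : ∀ μ ∈ (Finset.univ : Finset (Fin 4)), deriv1 μ ζ x ^ 2 ≤ z B ^ 2 / (ℓ : ℝ) ^ 2 := by
    intro μ _
    rw [le_div_iff₀ (by positivity), ← sq_abs, ← mul_pow, mul_comm]
    exact pow_le_pow_left₀ (by positivity) (hz.one B hB x hx μ) 2
  refine (Finset.sum_le_card_nsmul _ _ _ h).trans (le_of_eq ?_)
  simp
  ring

lemma sqW_shift_le (hodd : Odd ℓ) (φ : Torus N → ℂ) (hz : FieldBound t ℓ ζ X z) :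
    sqW t 2 ℓ (fun x => φ x + (ζ x : ℂ)) X ≤
      2 * sqW t 2 ℓ φ X + 2 * ∑ B ∈ blocksIn ℓ X, z B ^ 2 := by
  unfold sqW
  rw [Finset.mul_sum, Finset.mul_sum, ← Finset.sum_add_distrib]
  refine Finset.sum_le_sum fun B hB => ?_
  have h : supNorm 2 ℓ (fun x => φ x + (ζ x : ℂ)) (nbhd t ℓ B) ≤
      supNorm 2 ℓ φ (nbhd t ℓ B) + z B := by
    refine supNorm_two_le hodd.pos _ (add_nonneg (supNorm_nonneg _ _ _) (hz.nonneg B)) ?_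
    intro x hx μ ν
    rw [deriv1_shift, deriv1_shift]
    refine (mul_le_mul_of_nonneg_left (norm_add_le _ _) (by positivity)).trans ?_
    rw [mul_add, Complex.norm_real, Real.norm_eq_abs]
    exact add_le_add (deriv2_le_supNorm φ hx μ ν) (hz.two B hB x hx μ ν)
  have h0 := supNorm_nonneg (ℓ := ℓ) 2 (fun x => φ x + (ζ x : ℂ)) (nbhd t ℓ B)
  nlinarith [sq_nonneg (supNorm 2 ℓ φ (nbhd t ℓ B) - z B)]

/-- The ℓ² sites of a block compensate the factor ℓ⁻² of the scaled second derivatives. With S the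
second-derivative norm near a block, what remains is 2 S (2z) ≤ S² + 4 z². -/
lemma bulk_le (hodd : Odd ℓ) (hN : ℓ ∣ N) (hX : IsPolymer ℓ X) (φ : Torus N → ℂ)
    (hz : FieldBound t ℓ ζ X z) :
    |2 * ∑ x ∈ X, ζ x * ∑ μ, deriv1 μ (fun y => (φ y).re) x| ≤
      sqW t 2 ℓ φ X + 4 * ∑ B ∈ blocksIn ℓ X, z B ^ 2 := by
  have hℓ : (0 : ℝ) < ℓ := by exact_mod_cast hodd.pos
  rw [abs_mul, abs_two]
  have h1 : |∑ x ∈ X, ζ x * ∑ μ, deriv1 μ (fun y => (φ y).re) x| ≤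
      ∑ B ∈ blocksIn ℓ X, (ℓ : ℝ) ^ 2 *
        (z B * (2 * supNorm 2 ℓ φ (nbhd t ℓ B) / (ℓ : ℝ) ^ 2)) := by
    refine (Finset.abs_sum_le_sum_abs _ _).trans ?_
    refine sum_subset_polymer_le hodd hN hX le_rfl _
      (fun B => z B * (2 * supNorm 2 ℓ φ (nbhd t ℓ B) / (ℓ : ℝ) ^ 2)) _ ?_ ?_ ?_
    · intro B hB
      rw [← Nat.cast_pow, ← card_block hodd hN (mem_blocksIn.1 hB).1]
      exact_mod_cast Finset.card_le_card Finset.inter_subset_right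
    · intro B _
      have := hz.nonneg B
      have := supNorm_nonneg (ℓ := ℓ) 2 φ (nbhd t ℓ B)
      positivity
    · intro B hB x hxB _
      have hxn := subset_nbhd (t := t) hodd hN (mem_blocksIn.1 hB).1 hxB
      rw [abs_mul]
      refine mul_le_mul (hz.zero B hB x hxn) ?_ (abs_nonneg _) (hz.nonneg B)
      have e : ∑ μ, deriv1 μ (fun y => (φ y).re) x = (∑ μ, deriv1 μ φ x).re := by
        simp [deriv1_apply]
      rw [e, le_div_iff₀ (by positivity), laplacian_eq]
      refine (mul_le_mul_of_nonneg_right (Complex.abs_re_le_norm _) (by positivity)).trans ?_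
      rw [norm_neg]
      refine (mul_le_mul_of_nonneg_right (norm_add_le _ _) (by positivity)).trans ?_
      have := deriv2_le_supNorm (ℓ := ℓ) φ hxn 0 2
      have := deriv2_le_supNorm (ℓ := ℓ) φ hxn 1 3
      linarith
  refine (mul_le_mul_of_nonneg_left h1 zero_le_two).trans ?_
  unfold sqW
  rw [Finset.mul_sum, Finset.mul_sum, ← Finset.sum_add_distrib]
  refine Finset.sum_le_sum fun B _ => ?_
  rw [show 2 * ((ℓ : ℝ) ^ 2 * (z B * (2 * supNorm 2 ℓ φ (nbhd t ℓ B) / (ℓ : ℝ) ^ 2))) =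
    2 * supNorm 2 ℓ φ (nbhd t ℓ B) * (2 * z B) by field_simp]
  nlinarith [sq_nonneg (supNorm 2 ℓ φ (nbhd t ℓ B) - 2 * z B)]

lemma abs_deriv1_re_le (φ : Torus N → ℂ) (μ : Fin 4) (x : Torus N) :
    |deriv1 μ (fun y => (φ y).re) x| ≤ ‖deriv1 μ φ x‖ := by
  have : deriv1 μ (fun y => (φ y).re) x = (deriv1 μ φ x).re := by simp [deriv1_apply]
  rw [this]
  exact Complex.abs_re_le_norm _

/-- Young's inequality with weight εℓ on the bonds leaving X. On such a bond |ζ(x) + ζ(x+μ)| ≤ 3z,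
and a block has at most 4ℓ boundary sites with four directions each, so the cost is 4ℓ · 4 · (3z)² /
(4εℓ) = 36 z² / ε. -/
lemma face_le (hodd : Odd ℓ) (hN : ℓ ∣ N) (hX : IsPolymer ℓ X) (φ : Torus N → ℂ)
    (hz : FieldBound t ℓ ζ X z) {ε : ℝ} (hε : 0 < ε) :
    ∑ x ∈ X, ∑ μ, (if x + toTorus N (dir μ) ∈ X then 0 else
        deriv1 μ (fun y => (φ y).re) x * (ζ x + ζ (x + toTorus N (dir μ)))) ≤
      ε * ℓ * ∑ x ∈ boundary X, gradSum φ x + 36 / ε * ∑ B ∈ blocksIn ℓ X, z B ^ 2 := by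
  have hℓ : (0 : ℝ) < ℓ := by exact_mod_cast hodd.pos
  have h1 : ∑ x ∈ X, ∑ μ, (if x + toTorus N (dir μ) ∈ X then 0 else
        deriv1 μ (fun y => (φ y).re) x * (ζ x + ζ (x + toTorus N (dir μ)))) =
      ∑ x ∈ boundary X, ∑ μ, (if x + toTorus N (dir μ) ∈ X then 0 else
        deriv1 μ (fun y => (φ y).re) x * (ζ x + ζ (x + toTorus N (dir μ)))) := by
    symm
    refine Finset.sum_subset (fun x hx => (mem_boundary.1 hx).1) fun x hx hxb => ?_
    refine Finset.sum_eq_zero fun μ _ => if_pos ?_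
    by_contra h
    exact hxb (mem_boundary.2 ⟨hx, μ, h⟩)
  have h2 : ∀ x ∈ boundary X, ∑ μ, (if x + toTorus N (dir μ) ∈ X then 0 else
        deriv1 μ (fun y => (φ y).re) x * (ζ x + ζ (x + toTorus N (dir μ)))) ≤
      ε * ℓ * gradSum φ x + ∑ μ, (ζ x + ζ (x + toTorus N (dir μ))) ^ 2 / (4 * (ε * ℓ)) := by
    intro x _
    unfold gradSum
    rw [Finset.mul_sum, ← Finset.sum_add_distrib]
    refine Finset.sum_le_sum fun μ _ => ?_
    have hp : 0 < ε * ℓ := by positivity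
    split_ifs
    · positivity
    · have h3 := abs_deriv1_re_le φ μ x
      set a := deriv1 μ (fun y => (φ y).re) x
      set b := ζ x + ζ (x + toTorus N (dir μ))
      have h4 : a ^ 2 ≤ ‖deriv1 μ φ x‖ ^ 2 := by rw [← sq_abs]; gcongr
      have h5 : a * b ≤ ε * ℓ * a ^ 2 + b ^ 2 / (4 * (ε * ℓ)) := by
        have : ε * ℓ * a ^ 2 + b ^ 2 / (4 * (ε * ℓ)) - a * b =
            (2 * (ε * ℓ) * a - b) ^ 2 / (4 * (ε * ℓ)) := by field_simp; ring
        have : 0 ≤ (2 * (ε * ℓ) * a - b) ^ 2 / (4 * (ε * ℓ)) := by positivity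
        linarith
      nlinarith [mul_le_mul_of_nonneg_left h4 hp.le]
  rw [h1]
  refine (Finset.sum_le_sum h2).trans ?_
  rw [Finset.sum_add_distrib, Finset.mul_sum (s := boundary X)]
  refine add_le_add le_rfl ?_
  refine (sum_subset_polymer_le hodd hN hX (fun x hx => (mem_boundary.1 hx).1) _
    (fun B => 9 * z B ^ 2 / (ε * ℓ)) (4 * ℓ) (fun B hB => card_boundary_inter_le hodd hB)
    (fun B _ => by positivity) ?_).trans (le_of_eq ?_)
  · intro B hB x hxB _
    have hxn := subset_nbhd (t := t) hodd hN (mem_blocksIn.1 hB).1 hxB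
    have h : ∀ μ ∈ (Finset.univ : Finset (Fin 4)),
        (ζ x + ζ (x + toTorus N (dir μ))) ^ 2 / (4 * (ε * ℓ)) ≤
        (3 * z B) ^ 2 / (4 * (ε * ℓ)) := by
      intro μ _
      refine div_le_div_of_nonneg_right ?_ (by positivity)
      rw [← sq_abs]
      refine pow_le_pow_left₀ (abs_nonneg _) ?_ 2
      have a1 := hz.zero B hB x hxn
      have a2 := hz.one B hB x hxn μ
      have a3 : |deriv1 μ ζ x| ≤ z B := by
        refine le_trans ?_ a2
        have : (1 : ℝ) ≤ ℓ := by exact_mod_cast hodd.pos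
        nlinarith [abs_nonneg (deriv1 μ ζ x)]
      have : ζ x + ζ (x + toTorus N (dir μ)) = 2 * ζ x + deriv1 μ ζ x := by
        rw [deriv1_apply]; ring
      rw [this]
      refine (abs_add_le _ _).trans ?_
      rw [abs_mul, abs_two]
      linarith
    refine (Finset.sum_le_card_nsmul _ _ _ h).trans (le_of_eq ?_)
    simp
    field_simp
    ring
  · rw [Finset.mul_sum]
    refine Finset.sum_congr rfl fun B _ => ?_
    field_simp
    ring

/-! #### The boundary term -/

lemma sum_biUnion_le {ι α : Type*} [DecidableEq α] (s : Finset ι) (T : ι → Finset α)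
    (f : α → ℝ) (hf : ∀ x, 0 ≤ f x) : ∑ x ∈ s.biUnion T, f x ≤ ∑ i ∈ s, ∑ x ∈ T i, f x := by
  classical
  induction s using Finset.induction_on with
  | empty => simp
  | insert i s hi ih =>
    rw [Finset.biUnion_insert, Finset.sum_insert hi]
    refine le_trans ?_ (add_le_add le_rfl ih)
    rw [← Finset.sum_union_inter]
    exact le_add_of_nonneg_right (Finset.sum_nonneg fun x _ => hf x)

lemma norm_le_along_line {V : Type*} [SeminormedAddCommGroup V] (f : Torus N → V) (x : Torus N)
    (μ : Fin 4) (b : ℝ) (m : ℕ)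
    (h : ∀ i < m, ‖deriv1 μ f (x + toTorus N ((i : ℤ) • dir μ))‖ ≤ b) :
    ‖f x‖ ≤ ‖f (x + toTorus N ((m : ℤ) • dir μ))‖ + m * b := by
  induction m with
  | zero => simp [toTorus_zero]
  | succ m ih =>
    have h1 := ih fun i hi => h i (by omega)
    have h2 := h m (by omega)
    rw [deriv1_apply, add_assoc, ← toTorus_add, show (m : ℤ) • dir μ + dir μ =
      ((m + 1 : ℕ) : ℤ) • dir μ by push_cast; module] at h2
    have h3 := norm_sub_norm_le (f (x + toTorus N ((m : ℤ) • dir μ)))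
      (f (x + toTorus N (((m + 1 : ℕ) : ℤ) • dir μ)))
    rw [norm_sub_rev] at h3
    push_cast at *
    linarith

/-- At a site of ∂X that is not in ∂X', some nearest neighbour lies in X' \ X. The squared gradient
there is at most twice its average over the ℓ sites of the outgoing line plus the squared variation
of the gradient along the line. The lines for one direction are disjoint, so the averages add up to
bulk energy in X' \ X, and the variation is bounded by second derivatives. Summing over four
directions gives 8 = 4 · 2 and 128 = 4 · 32. -/
lemma boundary_transfer (hodd : Odd ℓ) (hN : ℓ ∣ N) (t : Touch) {X' : Finset (Torus N)}
    (hX : IsPolymer ℓ X) (hX' : IsPolymer ℓ X') (hXX : X ⊆ X') (φ : Torus N → ℂ) :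
    ℓ * ∑ x ∈ boundary X, gradSum φ x ≤ ℓ * ∑ x ∈ boundary X', gradSum φ x
      + 8 * ∑ x ∈ X' \ X, gradSum φ x + 128 * sqW t 2 ℓ φ X := by
  classical
  have hℓ : (0 : ℝ) < ℓ := by exact_mod_cast hodd.pos
  have hg := gradSum_nonneg φ
  set T : Fin 4 → Finset (Torus N) := fun μ =>
    (boundary X \ boundary X').filter (fun x => x + toTorus N (dir μ) ∉ X) with hT
  have h1 : ∑ x ∈ boundary X, gradSum φ x ≤ ∑ x ∈ boundary X', gradSum φ x +
      ∑ μ, ∑ x ∈ T μ, gradSum φ x := by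
    calc ∑ x ∈ boundary X, gradSum φ x
        ≤ ∑ x ∈ boundary X' ∪ Finset.univ.biUnion T, gradSum φ x := by
          refine Finset.sum_le_sum_of_subset_of_nonneg (fun x hx => ?_) fun x _ _ => hg x
          by_cases hx' : x ∈ boundary X'
          · exact Finset.mem_union_left _ hx'
          · obtain ⟨-, μ, hμ⟩ := mem_boundary.1 hx
            exact Finset.mem_union_right _ (Finset.mem_biUnion.2 ⟨μ, Finset.mem_univ _,
              Finset.mem_filter.2 ⟨Finset.mem_sdiff.2 ⟨hx, hx'⟩, hμ⟩⟩)
      _ ≤ ∑ x ∈ boundary X', gradSum φ x + ∑ x ∈ Finset.univ.biUnion T, gradSum φ x := by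
          rw [← Finset.sum_union_inter]
          exact le_add_of_nonneg_right (Finset.sum_nonneg fun x _ => hg x)
      _ ≤ _ := by
          gcongr
          exact sum_biUnion_le _ _ _ hg
  have h2 : ∀ μ, ℓ * ∑ x ∈ T μ, gradSum φ x ≤ 2 * ∑ x ∈ X' \ X, gradSum φ x +
      32 * sqW t 2 ℓ φ X := by
    intro μ
    have hsub : T μ ⊆ boundary X := fun x hx =>
      (Finset.mem_sdiff.1 (Finset.mem_filter.1 hx).1).1
    have hlines := sum_lines_le hodd hN hX hX' hXX μ _ hg
    have h3 : ∑ x ∈ T μ, (ℓ * gradSum φ x - 2 * ∑ m ∈ Finset.Icc 1 ℓ,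
        gradSum φ (x + toTorus N ((m : ℤ) • dir μ))) ≤ 32 * sqW t 2 ℓ φ X := by
      refine (sum_subset_polymer_le hodd hN hX (hsub.trans fun x hx => (mem_boundary.1 hx).1) _
        (fun B => 8 / ℓ * supNorm 2 ℓ φ (nbhd t ℓ B) ^ 2) (4 * ℓ) (fun B hB => ?_)
        (fun B _ => by positivity) ?_).trans (le_of_eq ?_)
      · refine le_trans ?_ (card_boundary_inter_le hodd hB)
        exact_mod_cast Finset.card_le_card (Finset.inter_subset_inter_right hsub)
      · intro B hB x hxB hxT
        obtain ⟨v, rfl⟩ := mem_blocks.1 (mem_blocksIn.1 hB).1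
        set S := supNorm 2 ℓ φ (nbhd t ℓ (block N ℓ v)) with hS
        have hS0 : 0 ≤ S := supNorm_nonneg _ _ _
        have hout : x + toTorus N (dir μ) ∉ block N ℓ v := fun h =>
          (Finset.mem_filter.1 hxT).2 ((mem_blocksIn.1 hB).2 h)
        have hin : ∀ i < ℓ, x + toTorus N ((i : ℤ) • dir μ) ∈ nbhd t ℓ (block N ℓ v) := by
          intro i hi
          rcases Nat.eq_zero_or_pos i with rfl | hi0
          · simpa [toTorus_zero] using subset_nbhd (t := t) hodd hN (block_mem_blocks v) hxB
          · refine subset_nbhd_of_touches (t := t) hodd hN (block_mem_blocks v)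
              (block_mem_blocks (v + dir μ)) (Or.inr ?_) (line_mem_block hodd hxB hout hi0 hi.le)
            refine touches_of_add_dir (μ := μ) hxB ?_
            have := line_mem_block hodd hxB hout le_rfl hodd.pos
            rwa [Nat.cast_one, one_smul] at this
        have hpt : ∀ m ∈ Finset.Icc 1 ℓ,
            gradSum φ x ≤ 2 * gradSum φ (x + toTorus N ((m : ℤ) • dir μ)) + 8 * (S / ℓ) ^ 2 := by
          intro m hm
          have hm' := (Finset.mem_Icc.1 hm).2
          have h4 : ∀ ν ∈ (Finset.univ : Finset (Fin 4)), ‖deriv1 ν φ x‖ ^ 2 ≤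
              2 * ‖deriv1 ν φ (x + toTorus N ((m : ℤ) • dir μ))‖ ^ 2 + 2 * (S / ℓ) ^ 2 := by
            intro ν _
            have h5 := norm_le_along_line (deriv1 ν φ) x μ (S / (ℓ : ℝ) ^ 2) m fun i hi => by
              rw [le_div_iff₀ (by positivity), mul_comm]
              exact deriv2_le_supNorm φ (hin i (by omega)) μ ν
            have h6 : m * (S / (ℓ : ℝ) ^ 2) ≤ S / ℓ := by
              have : (m : ℝ) ≤ ℓ := by exact_mod_cast hm'
              calc m * (S / (ℓ : ℝ) ^ 2) ≤ ℓ * (S / (ℓ : ℝ) ^ 2) := by gcongr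
                _ = S / ℓ := by field_simp
            have h7 := norm_nonneg (deriv1 ν φ x)
            have h8 : 0 ≤ S / ℓ := by positivity
            nlinarith [sq_nonneg (‖deriv1 ν φ (x + toTorus N ((m : ℤ) • dir μ))‖ - S / ℓ),
              norm_nonneg (deriv1 ν φ (x + toTorus N ((m : ℤ) • dir μ)))]
          refine (Finset.sum_le_sum h4).trans (le_of_eq ?_)
          rw [Finset.sum_add_distrib, ← Finset.mul_sum]
          simp [gradSum]
          ring
        have h9 := Finset.sum_le_sum hpt
        rw [Finset.sum_const, Finset.sum_add_distrib, ← Finset.mul_sum, Finset.sum_const] at h9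
        simp only [Nat.card_Icc, add_tsub_cancel_right, nsmul_eq_mul] at h9
        have : (ℓ : ℝ) * (8 * (S / ℓ) ^ 2) = 8 / ℓ * S ^ 2 := by field_simp
        linarith
      · unfold sqW
        rw [Finset.mul_sum]
        refine Finset.sum_congr rfl fun B _ => ?_
        field_simp
        ring
    rw [Finset.sum_sub_distrib, ← Finset.mul_sum, ← Finset.mul_sum] at h3
    linarith
  have h4 := Finset.sum_le_sum fun μ (_ : μ ∈ (Finset.univ : Finset (Fin 4))) => h2 μ
  rw [← Finset.mul_sum] at h4
  simp only [Finset.sum_const, Finset.card_univ, Fintype.card_fin, nsmul_eq_mul] at h4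
  push_cast at h4
  nlinarith [mul_le_mul_of_nonneg_left h1 hℓ.le]

/-! #### The bound for one step of the scale -/

variable {γ : ℕ}

/-- The part of the exponent on the coarse scale that is produced by the fluctuation integral. -/
noncomputable def stepEnergy (t : Touch) (c₁ c₃ : ℝ) (γ ℓ : ℕ) (φ : Torus N → ℂ)
    (X : Finset (Torus N)) : ℝ :=
  c₁ / 2 * ∑ x ∈ X, gradSum φ x
    + c₁ / 4 * ∑ x ∈ polymerClosure (γ * ℓ) X \ X, gradSum φ x
    + c₃ * (γ * ℓ) / 2 * ∑ x ∈ boundary (polymerClosure (γ * ℓ) X), gradSum φ x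
    + c₁ / 2 * sqW t 2 (γ * ℓ) φ (polymerClosure (γ * ℓ) X)

lemma sqW_nonneg (n : ℕ) (φ : Torus N → ℂ) : 0 ≤ sqW t n ℓ φ X :=
  Finset.sum_nonneg fun _ _ => by positivity

/-- Squares of scaled second derivatives gain γ⁴ on the coarse scale, while a coarse block contains
at most γ² fine blocks. The net gain is γ². -/
lemma sqW_coarse (hodd : Odd ℓ) (hγ : Odd γ) (hN : γ * ℓ ∣ N) (φ : Torus N → ℂ) :
    (γ : ℝ) ^ 2 * sqW t 2 ℓ φ X ≤ sqW t 2 (γ * ℓ) φ (polymerClosure (γ * ℓ) X) := by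
  have hγ' : (0 : ℝ) < γ := by exact_mod_cast hγ.pos
  have h := sum_blocksIn_le_coarse hodd hγ hN (X := X)
    (fun B => supNorm 2 ℓ φ (nbhd t ℓ B) ^ 2)
    (fun B' => supNorm 2 (γ * ℓ) φ (nbhd t (γ * ℓ) B') ^ 2 / (γ : ℝ) ^ 4)
    (fun B' => by positivity) (fun B _ B' _ hBB => by
      rw [supNorm_coarse, mul_pow, ← pow_mul, mul_comm, mul_div_assoc, div_self (by positivity),
        mul_one]
      exact pow_le_pow_left₀ (supNorm_nonneg _ _ _) (supNorm_mono _ _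
        ((nbhd_mono hBB).trans (nbhd_subset_coarse hodd hγ hN _))) 2)
  unfold sqW
  rw [← Finset.sum_div] at h
  refine (mul_le_mul_of_nonneg_left h (by positivity)).trans (le_of_eq ?_)
  field_simp

/-- The balance of all terms. The fine second-derivative term W collects 3 c₁ + 192 c₃ ≤ 4 c₁,
against the available (c₁/2) γ² ≥ 9 c₁ / 2. The energy in the added region collects 12 c₃ ≤ c₁ / 4.
The coarse boundary term collects 3 c₃ ℓ / 2 ≤ c₃ γ ℓ / 2. The hypotheses on c₃ and γ serve exactly
here. -/
theorem energy_step (hodd : Odd ℓ) (hγ : Odd γ) (hγ3 : 3 ≤ γ) (hN : γ * ℓ ∣ N)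
    (hX : IsPolymer ℓ X) {c₁ c₃ : ℝ} (hc₁ : 0 < c₁) (hc₃ : 0 < c₃) (hc : 200 * c₃ ≤ c₁)
    (φ : Torus N → ℂ) (hz : FieldBound t ℓ ζ X z) :
    energy t c₁ c₃ ℓ (fun x => φ x + (ζ x : ℂ)) X ≤ stepEnergy t c₁ c₃ γ ℓ φ X
      + (8 * c₁ + 72 * c₁ ^ 2 / c₃ + 16 * c₃) * ∑ B ∈ blocksIn ℓ X, z B ^ 2 := by
  have hℓ : (0 : ℝ) < ℓ := by exact_mod_cast hodd.pos
  have hN' : ℓ ∣ N := dvd_of_mul_left_dvd hN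
  set X' := polymerClosure (γ * ℓ) X with hX'
  have hbd := boundary_transfer hodd hN' t hX
    (polymer_coarse hodd hγ hN (isPolymer_polymerClosure (γ * ℓ) X))
    (subset_polymerClosure (odd_coarse hodd hγ) X) φ
  rw [← hX'] at hbd
  have hparts := sum_by_parts (fun y => (φ y).re) ζ X
  have hbulk := (abs_le.1 (bulk_le hodd hN' hX φ hz)).1
  -- With this ε the face term, multiplied by c₁, uses c₃ ℓ / 2 times the boundary sum. Expanding
  -- the boundary term itself uses another c₃ ℓ.
  have hface := face_le hodd hN' hX φ hz (ε := c₃ / (2 * c₁)) (by positivity)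
  have hW := sqW_shift_le hodd φ hz
  have hcoarse := sqW_coarse (t := t) (X := X) hodd hγ hN φ
  have hb1 : ∑ x ∈ X, ∑ μ, deriv1 μ ζ x ^ 2 ≤ 4 * ∑ B ∈ blocksIn ℓ X, z B ^ 2 := by
    refine (sum_subset_polymer_le hodd hN' hX le_rfl _ (fun B => 4 * z B ^ 2 / (ℓ : ℝ) ^ 2)
      ((ℓ : ℝ) ^ 2) (fun B hB => ?_) (fun B _ => by positivity) ?_).trans (le_of_eq ?_)
    · rw [← Nat.cast_pow, ← card_block hodd hN' (mem_blocksIn.1 hB).1]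
      exact_mod_cast Finset.card_le_card Finset.inter_subset_right
    · intro B hB x hxB _
      exact hz.gradSum_le hodd.pos hB (subset_nbhd hodd hN' (mem_blocksIn.1 hB).1 hxB)
    · rw [Finset.mul_sum]
      exact Finset.sum_congr rfl fun B _ => by field_simp
  have hb2 : ℓ * ∑ x ∈ boundary X, ∑ μ, deriv1 μ ζ x ^ 2 ≤
      16 * ∑ B ∈ blocksIn ℓ X, z B ^ 2 := by
    have := sum_subset_polymer_le hodd hN' hX (fun x hx => (mem_boundary.1 hx).1)
      (fun x => ∑ μ, deriv1 μ ζ x ^ 2) (fun B => 4 * z B ^ 2 / (ℓ : ℝ) ^ 2)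
      (4 * ℓ) (fun B hB => card_boundary_inter_le hodd hB) (fun B _ => by positivity)
      (fun B hB x hxB _ =>
        hz.gradSum_le hodd.pos hB (subset_nbhd hodd hN' (mem_blocksIn.1 hB).1 hxB))
    refine (mul_le_mul_of_nonneg_left this hℓ.le).trans (le_of_eq ?_)
    rw [Finset.mul_sum, Finset.mul_sum]
    exact Finset.sum_congr rfl fun B _ => by field_simp; ring
  have hb3 := Finset.sum_le_sum fun x (_ : x ∈ boundary X) => gradSum_shift_le φ ζ x
  rw [Finset.sum_add_distrib, ← Finset.mul_sum, ← Finset.mul_sum] at hb3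
  have hb4 : ∑ x ∈ X, gradSum (fun x => φ x + (ζ x : ℂ)) x = ∑ x ∈ X, gradSum φ x
      + 2 * ∑ x ∈ X, ∑ μ, deriv1 μ (fun y => (φ y).re) x * deriv1 μ ζ x
      + ∑ x ∈ X, ∑ μ, deriv1 μ ζ x ^ 2 := by
    rw [Finset.mul_sum, ← Finset.sum_add_distrib, ← Finset.sum_add_distrib]
    exact Finset.sum_congr rfl fun x _ => gradSum_shift φ ζ x
  have hγr : (3 : ℝ) ≤ γ := by exact_mod_cast hγ3
  have hG1 : 0 ≤ ∑ x ∈ X' \ X, gradSum φ x := Finset.sum_nonneg fun x _ => gradSum_nonneg φ x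
  have hG2 : 0 ≤ ∑ x ∈ boundary X', gradSum φ x := Finset.sum_nonneg fun x _ => gradSum_nonneg φ x
  have hW0 := sqW_nonneg (t := t) (ℓ := ℓ) (X := X) 2 φ
  unfold energy stepEnergy
  rw [← hX']
  rw [hb4, hparts]
  generalize ∑ x ∈ X, gradSum φ x = A at *
  generalize ∑ x ∈ boundary X, gradSum φ x = Bd at *
  generalize ∑ x ∈ boundary X', gradSum φ x = Bd' at *
  generalize ∑ x ∈ X' \ X, gradSum φ x = V at *
  generalize ∑ B ∈ blocksIn ℓ X, z B ^ 2 = Z at *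
  generalize sqW t 2 ℓ φ X = W at *
  generalize sqW t 2 (γ * ℓ) φ X' = W' at *
  generalize sqW t 2 ℓ (fun x => φ x + (ζ x : ℂ)) X = Wζ at *
  generalize ∑ x ∈ boundary X, gradSum (fun x => φ x + (ζ x : ℂ)) x = Bζ at *
  generalize ∑ x ∈ boundary X, ∑ μ, deriv1 μ ζ x ^ 2 = Bz at *
  generalize ∑ x ∈ X, ∑ μ, deriv1 μ ζ x ^ 2 = Az at *
  have e1 : c₁ * (c₃ / (2 * c₁) * ℓ * Bd + 36 / (c₃ / (2 * c₁)) * Z) =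
      c₃ / 2 * ℓ * Bd + 72 * c₁ ^ 2 / c₃ * Z := by
    field_simp; ring
  have f1 := mul_le_mul_of_nonneg_left hface hc₁.le
  rw [e1] at f1
  have f2 := mul_le_mul_of_nonneg_left hbulk hc₁.le
  have f3 := mul_le_mul_of_nonneg_left hb1 hc₁.le
  have f4 := mul_le_mul_of_nonneg_left hb3 (show 0 ≤ c₃ * ℓ / 2 by positivity)
  have f5 := mul_le_mul_of_nonneg_left hb2 hc₃.le
  have f6 := mul_le_mul_of_nonneg_left hW hc₁.le
  have f7 := mul_le_mul_of_nonneg_left hbd hc₃.le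
  have f8 : 9 * W ≤ W' := le_trans (mul_le_mul_of_nonneg_right (by nlinarith) hW0) hcoarse
  have f9 := mul_le_mul_of_nonneg_left f8 hc₁.le
  have f10 : 3 * (c₃ * ℓ * Bd') ≤ γ * (c₃ * ℓ * Bd') :=
    mul_le_mul_of_nonneg_right hγr (by positivity)
  have f11 := mul_le_mul_of_nonneg_right hc hW0
  have f12 := mul_le_mul_of_nonneg_right hc hG1
  have f13 : 0 ≤ c₁ * W := by positivity
  nlinarith

end Regulator

/-! ### Bounds on the first derivatives of the field in a small set neighbourhood -/

section Oscillation

variable {N : ℕ} [NeZero N] {ℓ : ℕ} {t : Touch} {V : Type*} [SeminormedAddCommGroup V]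

lemma int_norm_sub_le (g : ℤ → V) {b : ℝ} {i j : ℤ} (hij : i ≤ j)
    (h : ∀ m, i ≤ m → m < j → ‖g (m + 1) - g m‖ ≤ b) : ‖g j - g i‖ ≤ (j - i) * b := by
  induction j, hij using Int.leInduction with
  | base => simp
  | succ j hij ih =>
    have h1 := ih fun m hm hm' => h m hm (by omega)
    have h2 := h j hij (by omega)
    have h3 := norm_sub_le_norm_sub_add_norm_sub (g (j + 1)) (g j) (g i)
    push_cast
    linarith

lemma norm_sub_le_of_mem_block {v : ℤ × ℤ} (f : Torus N → V) {b : ℝ} (hb : 0 ≤ b)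
    (h : ∀ x ∈ block N ℓ v, ∀ μ, ‖deriv1 μ f x‖ ≤ b) {x y : Torus N} (hx : x ∈ block N ℓ v)
    (hy : y ∈ block N ℓ v) : ‖f x - f y‖ ≤ 2 * ℓ * b := by
  obtain ⟨d, hd, rfl⟩ := mem_block_iff.1 hx
  obtain ⟨e, he, rfl⟩ := mem_block_iff.1 hy
  have conv : ∀ a : ℤ, 2 * |a| ≤ ℓ ↔ -((ℓ / 2 : ℕ) : ℤ) ≤ a ∧ a ≤ ((ℓ / 2 : ℕ) : ℤ) := by
    intro a; rw [← abs_le]; omega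
  have key : ∀ (g : ℤ → V), (∀ m : ℤ, 2 * |m| ≤ ℓ → ‖g (m + 1) - g m‖ ≤ b) → ∀ i j : ℤ,
      2 * |i| ≤ ℓ → 2 * |j| ≤ ℓ → ‖g i - g j‖ ≤ ℓ * b := by
    intro g hg i j hi hj
    wlog hij : i ≤ j generalizing i j with H
    · rw [norm_sub_rev]
      exact H j i hj hi (by omega)
    rw [norm_sub_rev]
    rw [conv] at hi hj
    refine (int_norm_sub_le g hij fun m h1 h2 => hg m ((conv m).2 (by omega))).trans ?_
    refine mul_le_mul_of_nonneg_right ?_ hb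
    have : j - i ≤ ℓ := by omega
    exact_mod_cast this
  have h1 := key (fun i => f (toTorus N ((ℓ : ℤ) • v + (i, d.2)))) (fun m hm => by
    have := h _ (mem_block_iff.2 ⟨(m, d.2), ⟨hm, hd.2⟩, rfl⟩) 0
    rw [deriv1_apply, ← toTorus_add, add_assoc] at this
    simpa [dir] using this) d.1 e.1 hd.1 he.1
  have h2 := key (fun i => f (toTorus N ((ℓ : ℤ) • v + (e.1, i)))) (fun m hm => by
    have := h _ (mem_block_iff.2 ⟨(e.1, m), ⟨he.1, hm⟩, rfl⟩) 1
    rw [deriv1_apply, ← toTorus_add, add_assoc] at this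
    simpa [dir] using this) d.2 e.2 hd.2 he.2
  have h3 := norm_sub_le_norm_sub_add_norm_sub (f (toTorus N ((ℓ : ℤ) • v + d)))
    (f (toTorus N ((ℓ : ℤ) • v + (e.1, d.2)))) (f (toTorus N ((ℓ : ℤ) • v + e)))
  simp only [Prod.mk.eta] at h1 h2
  linarith

/-- For a diagonal step the corner of the path may lie outside both blocks. Hence the second leg is
traversed backwards from x + u, so that only derivatives at the two end points are used. -/
lemma norm_sub_le_of_unitVector (f : Torus N → V) {b : ℝ} {x : Torus N} {u : ℤ × ℤ}
    (hu : u ∈ t.unitVectors) (hx : ∀ μ, ‖deriv1 μ f x‖ ≤ b)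
    (hy : ∀ μ, ‖deriv1 μ f (x + toTorus N u)‖ ≤ b) :
    ‖f (x + toTorus N u) - f x‖ ≤ 2 * b := by
  have hb : 0 ≤ b := (norm_nonneg _).trans (hx 0)
  have key : ∀ (y : Torus N) (p : ℤ × ℤ), (∀ μ, ‖deriv1 μ f y‖ ≤ b) → (p = 0 ∨ ∃ μ, p = dir μ) →
      ‖f (y + toTorus N p) - f y‖ ≤ b := by
    rintro y p hy (rfl | ⟨μ, rfl⟩)
    · simpa [toTorus_zero] using hb
    · exact hy μ
  obtain ⟨h1, h2⟩ := abs_le_one_of_mem_unitVectors hu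
  rw [abs_le] at h1 h2
  have h3 := key x (u.1, 0) hx (by
    rcases (show u.1 = 0 ∨ u.1 = 1 ∨ u.1 = -1 by omega) with h | h | h
    · exact Or.inl (by simp [h])
    · exact Or.inr ⟨0, by simp [h, dir]⟩
    · exact Or.inr ⟨2, by simp [h, dir]⟩)
  have h4 := key (x + toTorus N u) (0, -u.2) hy (by
    rcases (show u.2 = 0 ∨ u.2 = 1 ∨ u.2 = -1 by omega) with h | h | h
    · exact Or.inl (by simp [h])
    · exact Or.inr ⟨3, by simp [h, dir]⟩
    · exact Or.inr ⟨1, by simp [h, dir]⟩)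
  rw [add_assoc, ← toTorus_add, show u + (0, -u.2) = (u.1, 0) by ext <;> simp] at h4
  have h5 := norm_sub_le_norm_sub_add_norm_sub (f (x + toTorus N u))
    (f (x + toTorus N (u.1, 0))) (f x)
  rw [norm_sub_rev (f (x + toTorus N u)) (f (x + toTorus N (u.1, 0)))] at h5
  linarith

/-- The oscillation between a block and its small set neighbourhood. -/
lemma norm_sub_le_of_mem_nbhd (hodd : Odd ℓ) (hN : ℓ ∣ N) {B : Finset (Torus N)}
    (hB : B ∈ blocks N ℓ) (f : Torus N → V) {b : ℝ} (hb : 0 ≤ b)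
    (h : ∀ x ∈ nbhd t ℓ B, ∀ μ, ‖deriv1 μ f x‖ ≤ b) {x y : Torus N} (hx : x ∈ nbhd t ℓ B)
    (hy : y ∈ B) : ‖f x - f y‖ ≤ 14 * ℓ * b := by
  obtain ⟨Y, hY, ⟨w, hwY, hwB⟩, hxY⟩ := mem_nbhd.1 hx
  have hBY : B ∈ blocksIn ℓ Y := mem_blocksIn.2 ⟨hB,
    polymer_block_subset hodd hN hY.1.1 hB hwY hwB⟩
  obtain ⟨D, hD, hxD⟩ := exists_blocksIn hodd hN hY.1.1 hxY
  have hYn : ∀ E ∈ blocksIn ℓ Y, ∀ x ∈ E, ∀ μ, ‖deriv1 μ f x‖ ≤ b := fun E hE x hx =>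
    h x (mem_nbhd.2 ⟨Y, hY, ⟨w, hwY, hwB⟩, (mem_blocksIn.1 hE).2 hx⟩)
  have hosc : ∀ E ∈ blocksIn ℓ Y, ∀ x ∈ E, ∀ y ∈ E, ‖f x - f y‖ ≤ 2 * ℓ * b := by
    intro E hE x hx y hy
    have h1 := hYn E hE
    obtain ⟨v, rfl⟩ := mem_blocks.1 (mem_blocksIn.1 hE).1
    exact norm_sub_le_of_mem_block f hb h1 hx hy
  have hℓ : (1 : ℝ) ≤ ℓ := by exact_mod_cast hodd.pos
  -- Each block adds an oscillation 2ℓb and each step between blocks adds 2b ≤ 2ℓb. After three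
  -- steps the coefficient is 4 · 3 + 2 = 14.
  have := hY.chain hBY hD (fun n E => ∀ x ∈ E, ‖f x - f y‖ ≤ (4 * n + 2) * ℓ * b)
    (fun x hx => by simpa using hosc B hBY x hx y hy)
    (by
      intro n E hE F hF hEF hn x hx
      obtain ⟨p, hp, q, hq, u, hu, rfl⟩ := hEF
      have h1 := hn p hp
      have h2 := norm_sub_le_of_unitVector f hu (hYn E hE p hp) (hYn F hF _ hq)
      have h3 := hosc F hF x hx _ hq
      have h4 := norm_sub_le_norm_sub_add_norm_sub (f x) (f (p + toTorus N u)) (f y)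
      have h5 := norm_sub_le_norm_sub_add_norm_sub (f (p + toTorus N u)) (f p) (f y)
      push_cast
      have : b ≤ ℓ * b := le_mul_of_one_le_left hb hℓ
      nlinarith)
    (by
      intro n m E hnm hn x hx
      refine (hn x hx).trans ?_
      have : (n : ℝ) ≤ m := by exact_mod_cast hnm
      gcongr)
  have := this x hxD
  norm_num at this
  exact this

end Oscillation

/-! ### The slack between the one-step exponent and the coarse energy. -/

section Slack

variable {N : ℕ} [NeZero N] {ℓ γ : ℕ} {t : Touch} {X : Finset (Torus N)}

/-- X has at most 4ℓ² sites and a coarse block has γ²ℓ² ≥ 9ℓ², so more than half of the block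
remains uncovered. -/
lemma card_sdiff_ge (hodd : Odd ℓ) (hγ : Odd γ) (hγ3 : 3 ≤ γ) (hN : γ * ℓ ∣ N)
    (hX : IsPolymer ℓ X) (hcard : (blocksIn ℓ X).card ≤ 4) {B' : Finset (Torus N)}
    (hB' : B' ∈ blocks N (γ * ℓ)) :
    ((γ * ℓ : ℕ) : ℝ) ^ 2 / 2 ≤ ((B' \ X).card : ℝ) := by
  have h1 := card_block (odd_coarse hodd hγ) hN hB'
  have h2 : X.card ≤ 4 * ℓ ^ 2 := by
    rw [← biUnion_blocksIn hodd (dvd_of_mul_left_dvd hN) hX]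
    refine Finset.card_biUnion_le.trans ((Finset.sum_le_card_nsmul _ _ (ℓ ^ 2) fun B hB => ?_).trans
      ?_)
    · exact (card_block hodd (dvd_of_mul_left_dvd hN) (mem_blocksIn.1 hB).1).le
    · exact Nat.mul_le_mul_right _ hcard
  have h3 := Finset.le_card_sdiff X B'
  have h4 : γ ^ 2 * ℓ ^ 2 ≤ (B' \ X).card + 4 * ℓ ^ 2 := by
    rw [h1, mul_pow] at h3
    omega
  have h5 : (γ : ℝ) ^ 2 * (ℓ : ℝ) ^ 2 ≤ (B' \ X).card + 4 * (ℓ : ℝ) ^ 2 := by exact_mod_cast h4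
  have h6 : (9 : ℝ) ≤ (γ : ℝ) ^ 2 := by
    have : (3 : ℝ) ≤ γ := by exact_mod_cast hγ3
    nlinarith
  push_cast
  nlinarith [mul_le_mul_of_nonneg_right h6 (sq_nonneg (ℓ : ℝ))]

lemma sq_supNorm_two_le (hodd : Odd ℓ) (hN : ℓ ∣ N) {X' Y : Finset (Torus N)}
    (hX' : IsPolymer ℓ X') (hY : Y ⊆ nbhd t ℓ X') (φ : Torus N → ℂ) :
    supNorm 2 ℓ φ Y ^ 2 ≤ sqW t 2 ℓ φ X' := by
  have : supNorm 2 ℓ φ Y ≤ √(sqW t 2 ℓ φ X') := by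
    refine supNorm_two_le hodd.pos _ (Real.sqrt_nonneg _) fun x hx μ ν => ?_
    obtain ⟨B, hB, hxB⟩ := exists_block_of_mem_nbhd hodd hN hX' (hY hx)
    refine (deriv2_le_supNorm φ hxB μ ν).trans (Real.le_sqrt_of_sq_le ?_)
    exact Finset.single_le_sum (f := fun B => supNorm 2 ℓ φ (nbhd t ℓ B) ^ 2)
      (fun _ _ => by positivity) hB
  calc supNorm 2 ℓ φ Y ^ 2 ≤ √(sqW t 2 ℓ φ X') ^ 2 :=
        pow_le_pow_left₀ (supNorm_nonneg _ _ _) this 2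
    _ = _ := Real.sq_sqrt (sqW_nonneg _ _)

/-- The gradient at a site near a coarse block B is compared with the gradients at the sites of B \
X and averaged over them. The oscillation is at most 14 times the second-derivative norm, which
gives 2 · 14² = 392, and the lower bound on the size of B \ X doubles both constants. -/
lemma sq_supNorm_one_le (hodd : Odd ℓ) (hγ : Odd γ) (hγ3 : 3 ≤ γ) (hN : γ * ℓ ∣ N)
    (hX : IsPolymer ℓ X) (hcard : (blocksIn ℓ X).card ≤ 4) {Y : Finset (Torus N)}
    (hY : Y ⊆ nbhd t (γ * ℓ) (polymerClosure (γ * ℓ) X)) (φ : Torus N → ℂ) :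
    supNorm 1 (γ * ℓ) φ Y ^ 2 ≤ 4 * ∑ x ∈ polymerClosure (γ * ℓ) X \ X, gradSum φ x
      + 784 * sqW t 2 (γ * ℓ) φ (polymerClosure (γ * ℓ) X) := by
  have hodd' := odd_coarse hodd hγ
  set X' := polymerClosure (γ * ℓ) X with hX'
  set A := 4 * ∑ x ∈ X' \ X, gradSum φ x + 784 * sqW t 2 (γ * ℓ) φ X' with hA
  have hA0 : 0 ≤ A := by
    have := sqW_nonneg (t := t) (ℓ := γ * ℓ) (X := X') 2 φ
    have : 0 ≤ ∑ x ∈ X' \ X, gradSum φ x := Finset.sum_nonneg fun x _ => gradSum_nonneg φ x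
    positivity
  have hℓ : (0 : ℝ) < (γ * ℓ : ℕ) := by exact_mod_cast hodd'.pos
  have : supNorm 1 (γ * ℓ) φ Y ≤ √A := by
    refine supNorm_one_le hodd'.pos _ (Real.sqrt_nonneg _) fun x hx ν => ?_
    obtain ⟨B, hB, hxB⟩ := exists_block_of_mem_nbhd hodd' hN (isPolymer_polymerClosure _ X) (hY hx)
    refine Real.le_sqrt_of_sq_le ?_
    set S := supNorm 2 (γ * ℓ) φ (nbhd t (γ * ℓ) B) with hS
    have hS0 : 0 ≤ S := supNorm_nonneg _ _ _
    have hSW : S ^ 2 ≤ sqW t 2 (γ * ℓ) φ X' :=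
      Finset.single_le_sum (f := fun B => supNorm 2 (γ * ℓ) φ (nbhd t (γ * ℓ) B) ^ 2)
        (fun _ _ => by positivity) hB
    set n : ℝ := ((γ * ℓ : ℕ) : ℝ) with hn
    have hpt : ∀ y ∈ B \ X, ‖deriv1 ν φ x‖ ^ 2 ≤ 2 * gradSum φ y + 392 * (S / n) ^ 2 := by
      intro y hy
      have h1 := norm_sub_le_of_mem_nbhd hodd' hN (mem_blocksIn.1 hB).1 (deriv1 ν φ)
        (b := S / n ^ 2) (by positivity) (fun w hw μ => by
          rw [le_div_iff₀ (by positivity), mul_comm]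
          exact deriv2_le_supNorm φ hw μ ν) hxB (Finset.mem_sdiff.1 hy).1
      rw [← hn, show 14 * n * (S / n ^ 2) = 14 * (S / n) by field_simp] at h1
      have h2 := norm_sub_norm_le (deriv1 ν φ x) (deriv1 ν φ y)
      have h3 : ‖deriv1 ν φ y‖ ^ 2 ≤ gradSum φ y :=
        Finset.single_le_sum (f := fun μ => ‖deriv1 μ φ y‖ ^ 2) (fun _ _ => by positivity)
          (Finset.mem_univ ν)
      have h4 : 0 ≤ S / n := by positivity
      nlinarith [norm_nonneg (deriv1 ν φ x), norm_nonneg (deriv1 ν φ y),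
        sq_nonneg (‖deriv1 ν φ y‖ - 14 * (S / n))]
    have h5 := Finset.sum_le_sum hpt
    rw [Finset.sum_const, Finset.sum_add_distrib, ← Finset.mul_sum, Finset.sum_const, nsmul_eq_mul,
      nsmul_eq_mul] at h5
    have h6 := card_sdiff_ge hodd hγ hγ3 hN hX hcard (mem_blocksIn.1 hB).1
    have h7 : ((B \ X).card : ℝ) ≤ n ^ 2 := by
      rw [hn, ← Nat.cast_pow, ← card_block hodd' hN (mem_blocksIn.1 hB).1]
      exact_mod_cast Finset.card_le_card Finset.sdiff_subset
    have h8 : ∑ y ∈ B \ X, gradSum φ y ≤ ∑ y ∈ X' \ X, gradSum φ y :=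
      Finset.sum_le_sum_of_subset_of_nonneg
        (Finset.sdiff_subset_sdiff (mem_blocksIn.1 hB).2 le_rfl) fun y _ _ => gradSum_nonneg φ y
    have h9 : ((B \ X).card : ℝ) * (392 * (S / n) ^ 2) ≤ 392 * S ^ 2 := by
      refine (mul_le_mul_of_nonneg_right h7 (by positivity)).trans (le_of_eq ?_)
      field_simp
    have h10 := mul_le_mul_of_nonneg_right h6 (sq_nonneg ‖deriv1 ν φ x‖)
    rw [mul_pow]
    nlinarith
  calc supNorm 1 (γ * ℓ) φ Y ^ 2 ≤ √A ^ 2 := pow_le_pow_left₀ (supNorm_nonneg _ _ _) this 2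
    _ = _ := Real.sq_sqrt hA0

/-- Identifies the reserve that `energy_step` leaves untouched: a quarter of c₁ on the added region
and half of the second-derivative term. -/
lemma energy_sub_stepEnergy (hodd : Odd ℓ) (hγ : Odd γ) (c₁ c₃ : ℝ) (φ : Torus N → ℂ) :
    energy t c₁ c₃ (γ * ℓ) φ (polymerClosure (γ * ℓ) X) = stepEnergy t c₁ c₃ γ ℓ φ X
      + c₁ / 4 * ∑ x ∈ polymerClosure (γ * ℓ) X \ X, gradSum φ x
      + c₁ / 2 * sqW t 2 (γ * ℓ) φ (polymerClosure (γ * ℓ) X) := by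
  unfold energy stepEnergy
  rw [← Finset.sum_sdiff (subset_polymerClosure (odd_coarse hodd hγ) X)]
  push_cast
  ring

lemma stepEnergy_le_energy (hodd : Odd ℓ) (hγ : Odd γ) {c₁ : ℝ} (hc₁ : 0 ≤ c₁) (c₃ : ℝ)
    (φ : Torus N → ℂ) :
    stepEnergy t c₁ c₃ γ ℓ φ X ≤ energy t c₁ c₃ (γ * ℓ) φ (polymerClosure (γ * ℓ) X) := by
  rw [energy_sub_stepEnergy hodd hγ]
  have := sqW_nonneg (t := t) (ℓ := γ * ℓ) (X := polymerClosure (γ * ℓ) X) 2 φ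
  have : 0 ≤ ∑ x ∈ polymerClosure (γ * ℓ) X \ X, gradSum φ x :=
    Finset.sum_nonneg fun x _ => gradSum_nonneg φ x
  have : 0 ≤ c₁ / 4 * ∑ x ∈ polymerClosure (γ * ℓ) X \ X, gradSum φ x := by positivity
  have : 0 ≤ c₁ / 2 * sqW t 2 (γ * ℓ) φ (polymerClosure (γ * ℓ) X) := by positivity
  linarith

/-- For few blocks, the difference of the exponents controls the derivatives of the field. -/
lemma stepEnergy_add_le (hodd : Odd ℓ) (hγ : Odd γ) (hγ3 : 3 ≤ γ) (hN : γ * ℓ ∣ N)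
    (hX : IsPolymer ℓ X) (hcard : (blocksIn ℓ X).card ≤ 4) {Y : Finset (Torus N)}
    (hY : Y ⊆ nbhd t (γ * ℓ) (polymerClosure (γ * ℓ) X)) {c₁ : ℝ} (hc₁ : 0 ≤ c₁) (c₃ : ℝ)
    (φ : Torus N → ℂ) :
    stepEnergy t c₁ c₃ γ ℓ φ X
      + c₁ / 3136 * max (supNorm 1 (γ * ℓ) φ Y) (supNorm 2 (γ * ℓ) φ Y) ^ 2 ≤
      energy t c₁ c₃ (γ * ℓ) φ (polymerClosure (γ * ℓ) X) := by
  rw [energy_sub_stepEnergy hodd hγ]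
  have h1 := sq_supNorm_one_le hodd hγ hγ3 hN hX hcard hY φ
  have h2 := sq_supNorm_two_le (odd_coarse hodd hγ) hN (isPolymer_polymerClosure _ X) hY φ
  have h3 := sqW_nonneg (t := t) (ℓ := γ * ℓ) (X := polymerClosure (γ * ℓ) X) 2 φ
  have h4 : 0 ≤ ∑ x ∈ polymerClosure (γ * ℓ) X \ X, gradSum φ x :=
    Finset.sum_nonneg fun x _ => gradSum_nonneg φ x
  have h5 : max (supNorm 1 (γ * ℓ) φ Y) (supNorm 2 (γ * ℓ) φ Y) ^ 2 ≤
      784 * (∑ x ∈ polymerClosure (γ * ℓ) X \ X, gradSum φ x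
        + sqW t 2 (γ * ℓ) φ (polymerClosure (γ * ℓ) X)) := by
    rcases max_cases (supNorm 1 (γ * ℓ) φ Y) (supNorm 2 (γ * ℓ) φ Y) with ⟨h, -⟩ | ⟨h, -⟩ <;>
      rw [h] <;> linarith
  -- 3136 = 4 · 784, so the cost is c₁ / 4 for each of the two sums, within the reserve.
  have h6 := mul_le_mul_of_nonneg_left h5 (show 0 ≤ c₁ / 3136 by positivity)
  nlinarith [mul_nonneg hc₁ h3]

/-- All terms are quadratic seminorms of φ. This makes the bound for sup over t in [0, 1] as good as
the one for t = 1. -/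
lemma stepEnergy_smul_le {c₁ c₃ : ℝ} (hc₁ : 0 ≤ c₁) (hc₃ : 0 ≤ c₃) (hℓ : 0 < γ * ℓ)
    (φ : Torus N → ℂ) {s : ℝ} (h0 : 0 ≤ s) (h1 : s ≤ 1) :
    stepEnergy t c₁ c₃ γ ℓ (fun x => (s : ℂ) * φ x) X ≤ stepEnergy t c₁ c₃ γ ℓ φ X := by
  have hd : ∀ (μ : Fin 4) (f : Torus N → ℂ),
      deriv1 μ (fun x => (s : ℂ) * f x) = fun x => (s : ℂ) * deriv1 μ f x := by
    intro μ f; ext x; simp only [deriv1_apply]; ring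
  have hns : ‖(s : ℂ)‖ = s := by rw [Complex.norm_real, Real.norm_of_nonneg h0]
  have hg : ∀ x, gradSum (fun x => (s : ℂ) * φ x) x ≤ gradSum φ x := by
    intro x
    refine Finset.sum_le_sum fun μ _ => ?_
    rw [hd, norm_mul, hns]
    exact pow_le_pow_left₀ (by positivity) (mul_le_of_le_one_left (norm_nonneg _) h1) 2
  have hw : sqW t 2 (γ * ℓ) (fun x => (s : ℂ) * φ x) (polymerClosure (γ * ℓ) X) ≤
      sqW t 2 (γ * ℓ) φ (polymerClosure (γ * ℓ) X) := by
    refine Finset.sum_le_sum fun B _ => pow_le_pow_left₀ (supNorm_nonneg _ _ _) ?_ 2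
    refine supNorm_two_le hℓ _ (supNorm_nonneg _ _ _) fun x hx μ ν => ?_
    rw [hd, hd, norm_mul, hns]
    refine le_trans ?_ (deriv2_le_supNorm φ hx μ ν)
    exact mul_le_mul_of_nonneg_left (mul_le_of_le_one_left (norm_nonneg _) h1) (by positivity)
  unfold stepEnergy
  gcongr <;> exact hg _

end Slack

/-! ### Pointwise bounds on the fluctuation field by averages over blocks -/

section Sobolev

variable {N : ℕ} [NeZero N] {ℓ : ℕ} {t : Touch}

lemma int_abs_sub_le_sum (g : ℤ → ℝ) {i j : ℤ} (hij : i ≤ j) :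
    |g j - g i| ≤ ∑ m ∈ Finset.Ico i j, |g (m + 1) - g m| := by
  induction j, hij using Int.leInduction with
  | base => simp
  | succ j hij ih =>
    have e : Finset.Ico i (j + 1) = insert j (Finset.Ico i j) := by
      ext m; simp only [Finset.mem_Ico, Finset.mem_insert]; omega
    rw [e, Finset.sum_insert (by simp)]
    have := abs_sub_le (g (j + 1)) (g j) (g i)
    linarith

/-- The one-dimensional Sobolev inequality: average g(i)² ≤ 2 g(j)² + 2 (g(i) - g(j))² over j, and
bound the increments by the Cauchy-Schwarz inequality. The last summand looks one site beyond the
interval, which is harmless for a field on the torus. -/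
lemma sq_le_interval (hodd : Odd ℓ) (g : ℤ → ℝ) {i : ℤ} (hi : 2 * |i| ≤ ℓ) :
    g i ^ 2 ≤ ∑ j ∈ Finset.Icc (-((ℓ / 2 : ℕ) : ℤ)) ((ℓ / 2 : ℕ) : ℤ),
      (2 / ℓ * g j ^ 2 + 2 * ℓ * (g (j + 1) - g j) ^ 2) := by
  set I := Finset.Icc (-((ℓ / 2 : ℕ) : ℤ)) ((ℓ / 2 : ℕ) : ℤ) with hI
  have hcard : (I.card : ℝ) = ℓ := by
    obtain ⟨k, rfl⟩ := hodd
    rw [hI, Int.card_Icc]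
    congr 1
    omega
  have hℓ : (0 : ℝ) < ℓ := by exact_mod_cast hodd.pos
  have hiI : i ∈ I := by rw [hI, Finset.mem_Icc, ← abs_le]; omega
  have hsub : ∀ a ∈ I, ∀ b ∈ I, a ≤ b → |g b - g a| ≤ ∑ m ∈ I, |g (m + 1) - g m| := by
    intro a ha b hb hab
    refine (int_abs_sub_le_sum g hab).trans ?_
    refine Finset.sum_le_sum_of_subset_of_nonneg (fun m hm => ?_) fun _ _ _ => abs_nonneg _
    rw [Finset.mem_Ico] at hm
    rw [hI, Finset.mem_Icc] at *
    omega
  have hosc : ∀ j ∈ I, (g i - g j) ^ 2 ≤ ℓ * ∑ m ∈ I, (g (m + 1) - g m) ^ 2 := by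
    intro j hj
    have h1 : |g i - g j| ≤ ∑ m ∈ I, |g (m + 1) - g m| := by
      rcases le_total i j with h | h
      · rw [abs_sub_comm]; exact hsub i hiI j hj h
      · exact hsub j hj i hiI h
    rw [← sq_abs]
    refine (pow_le_pow_left₀ (abs_nonneg _) h1 2).trans ?_
    refine (sq_sum_le_card_mul_sum_sq).trans (le_of_eq ?_)
    rw [hcard]
    simp only [sq_abs]
  have h2 : ∀ j ∈ I, g i ^ 2 ≤ 2 * g j ^ 2 + 2 * (ℓ * ∑ m ∈ I, (g (m + 1) - g m) ^ 2) := by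
    intro j hj
    have := hosc j hj
    nlinarith [sq_nonneg (2 * g j - g i)]
  have h3 := Finset.sum_le_sum h2
  rw [Finset.sum_const, Finset.sum_add_distrib, ← Finset.mul_sum, Finset.sum_const, nsmul_eq_mul,
    nsmul_eq_mul, hcard] at h3
  rw [Finset.sum_add_distrib, ← Finset.mul_sum, ← Finset.mul_sum]
  refine le_of_mul_le_mul_left (h3.trans (le_of_eq ?_)) hℓ
  field_simp

/-- A discrete Sobolev inequality. -/
lemma sq_le_sum_block (hodd : Odd ℓ) (f : Torus N → ℝ) {v : ℤ × ℤ} {x : Torus N}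
    (hx : x ∈ block N ℓ v) :
    f x ^ 2 ≤ 4 / (ℓ : ℝ) ^ 2 * ∑ d ∈ offsets ℓ,
      (f (toTorus N ((ℓ : ℤ) • v + d)) ^ 2
        + (ℓ * deriv1 1 f (toTorus N ((ℓ : ℤ) • v + d))) ^ 2
        + (ℓ * deriv1 0 f (toTorus N ((ℓ : ℤ) • v + d))) ^ 2
        + ((ℓ : ℝ) ^ 2 * deriv1 1 (deriv1 0 f) (toTorus N ((ℓ : ℤ) • v + d))) ^ 2) := by
  obtain ⟨d, hd, rfl⟩ := mem_block_iff.1 hx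
  have hℓ : (0 : ℝ) < ℓ := by exact_mod_cast hodd.pos
  have e0 : ∀ (g : Torus N → ℝ) (i j : ℤ), g (toTorus N ((ℓ : ℤ) • v + (i + 1, j))) -
      g (toTorus N ((ℓ : ℤ) • v + (i, j))) = deriv1 0 g (toTorus N ((ℓ : ℤ) • v + (i, j))) := by
    intro g i j
    rw [deriv1_apply, ← toTorus_add, add_assoc]
    simp [dir]
  have e1 : ∀ (g : Torus N → ℝ) (i j : ℤ), g (toTorus N ((ℓ : ℤ) • v + (i, j + 1))) -
      g (toTorus N ((ℓ : ℤ) • v + (i, j))) = deriv1 1 g (toTorus N ((ℓ : ℤ) • v + (i, j))) := by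
    intro g i j
    rw [deriv1_apply, ← toTorus_add, add_assoc]
    simp [dir]
  have h1 := sq_le_interval hodd (fun i => f (toTorus N ((ℓ : ℤ) • v + (i, d.2)))) hd.1
  simp only [Prod.mk.eta, e0] at h1
  refine h1.trans ?_
  rw [offsets, Finset.sum_product, Finset.mul_sum]
  refine Finset.sum_le_sum fun i _ => ?_
  have h2 := sq_le_interval hodd (fun j => f (toTorus N ((ℓ : ℤ) • v + (i, j)))) hd.2
  have h3 := sq_le_interval hodd (fun j => deriv1 0 f (toTorus N ((ℓ : ℤ) • v + (i, j)))) hd.2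
  simp only [e1] at h2 h3
  have h4 := add_le_add (mul_le_mul_of_nonneg_left h2 (show (0 : ℝ) ≤ 2 / ℓ by positivity))
    (mul_le_mul_of_nonneg_left h3 (show (0 : ℝ) ≤ 2 * ℓ by positivity))
  refine h4.trans (le_of_eq ?_)
  rw [Finset.mul_sum, Finset.mul_sum, ← Finset.sum_add_distrib, Finset.mul_sum]
  refine Finset.sum_congr rfl fun j _ => ?_
  field_simp
  ring

/-- Words of length at most four in the lattice directions. -/
abbrev Word : Type := Σ n : Fin 5, (Fin n → Fin 4)

/-- The iterated lattice derivative along a list of directions. -/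
def derivs {V : Type*} [Sub V] (l : List (Fin 4)) (f : Torus N → V) : Torus N → V :=
  l.foldr deriv1 f

/-- The list of directions of a word. -/
def Word.toList (a : Word) : List (Fin 4) := List.ofFn a.2

lemma Word.length_toList (a : Word) : a.toList.length = a.1 := by
  simp [Word.toList]

lemma exists_word (l : List (Fin 4)) (h : l.length ≤ 4) : ∃ a : Word, a.toList = l :=
  ⟨⟨⟨l.length, by omega⟩, l.get⟩, List.ofFn_get l⟩

/-- The scaled derivatives of a field, at the offset `d` in the block with index `v`. -/
noncomputable def scaledDeriv (ℓ : ℕ) (a : Word) (v d : ℤ × ℤ) (ζ : Torus N → ℝ) : ℝ :=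
  (ℓ : ℝ) ^ (a.1 : ℕ) * derivs a.toList ζ (toTorus N ((ℓ : ℤ) • v + d))

/-- The average over a block of the squares of all scaled derivatives up to order four. -/
noncomputable def blockAverage (ℓ : ℕ) (v : ℤ × ℤ) (ζ : Torus N → ℝ) : ℝ :=
  ((ℓ : ℝ) ^ 2)⁻¹ * ∑ d ∈ offsets ℓ, ∑ a : Word, scaledDeriv ℓ a v d ζ ^ 2

lemma blockAverage_nonneg (v : ℤ × ℤ) (ζ : Torus N → ℝ) : 0 ≤ blockAverage ℓ v ζ := by
  unfold blockAverage
  positivity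

/-- The Sobolev inequality in two dimensions costs one extra derivative in each coordinate. This is
why words of length four are needed to control second derivatives. -/
lemma sq_derivs_le_blockAverage (hodd : Odd ℓ) (ζ : Torus N → ℝ) {l : List (Fin 4)}
    (hl : l.length ≤ 2) {v : ℤ × ℤ} {x : Torus N} (hx : x ∈ block N ℓ v) :
    ((ℓ : ℝ) ^ l.length * derivs l ζ x) ^ 2 ≤ 4 * blockAverage ℓ v ζ := by
  have h := sq_le_sum_block hodd (derivs l ζ) hx
  rw [mul_pow]
  refine (mul_le_mul_of_nonneg_left h (by positivity)).trans ?_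
  rw [blockAverage, div_eq_mul_inv, mul_assoc, ← mul_assoc _ 4, mul_comm _ (4 : ℝ), mul_assoc 4]
  refine mul_le_mul_of_nonneg_left ?_ (by norm_num)
  rw [mul_left_comm, Finset.mul_sum]
  refine mul_le_mul_of_nonneg_left (Finset.sum_le_sum fun d _ => ?_) (by positivity)
  obtain ⟨a0, h0⟩ := exists_word l (by omega)
  obtain ⟨a1, h1⟩ := exists_word (1 :: l) (by simp; omega)
  obtain ⟨a2, h2⟩ := exists_word (0 :: l) (by simp; omega)
  obtain ⟨a3, h3⟩ := exists_word (1 :: 0 :: l) (by simp; omega)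
  have hsub : ∑ a ∈ {a0, a1, a2, a3}, scaledDeriv ℓ a v d ζ ^ 2 ≤
      ∑ a : Word, scaledDeriv ℓ a v d ζ ^ 2 :=
    Finset.sum_le_sum_of_subset_of_nonneg (Finset.subset_univ _) fun _ _ _ => by positivity
  -- The four words have to be distinct for the four squares to be separate terms of the sum over
  -- all words.
  have n01 : a0 ≠ a1 := by rintro rfl; simpa using congrArg List.length (h0.symm.trans h1)
  have n02 : a0 ≠ a2 := by rintro rfl; simpa using congrArg List.length (h0.symm.trans h2)
  have n03 : a0 ≠ a3 := by
    rintro rfl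
    have := congrArg List.length (h0.symm.trans h3)
    simp only [List.length_cons] at this
    omega
  have n12 : a1 ≠ a2 := by rintro rfl; simpa using h1.symm.trans h2
  have n13 : a1 ≠ a3 := by rintro rfl; simpa using congrArg List.length (h1.symm.trans h3)
  have n23 : a2 ≠ a3 := by rintro rfl; simpa using congrArg List.length (h2.symm.trans h3)
  rw [Finset.sum_insert (by simp [n01, n02, n03]), Finset.sum_insert (by simp [n12, n13]),
    Finset.sum_pair n23] at hsub
  refine le_trans (le_of_eq ?_) hsub
  have l0 : (a0.1 : ℕ) = l.length := by rw [← a0.length_toList, h0]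
  have l1 : (a1.1 : ℕ) = l.length + 1 := by rw [← a1.length_toList, h1]; rfl
  have l2 : (a2.1 : ℕ) = l.length + 1 := by rw [← a2.length_toList, h2]; rfl
  have l3 : (a3.1 : ℕ) = l.length + 2 := by rw [← a3.length_toList, h3]; rfl
  simp only [scaledDeriv, h0, h1, h2, h3, l0, l1, l2, l3]
  simp only [derivs, List.foldr_cons]
  ring

/-- The shifts from a block to the blocks of its small set neighbourhood. -/
noncomputable def shifts : Finset (ℤ × ℤ) := Finset.Icc (-3 : ℤ) 3 ×ˢ Finset.Icc (-3 : ℤ) 3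

/-- An index of a block. -/
noncomputable def blockIndex (ℓ : ℕ) (B : Finset (Torus N)) : ℤ × ℤ :=
  open scoped Classical in if h : ∃ v, B = block N ℓ v then h.choose else 0

lemma block_blockIndex {B : Finset (Torus N)} (hB : B ∈ blocks N ℓ) :
    block N ℓ (blockIndex ℓ B) = B := by
  have h := mem_blocks.1 hB
  rw [blockIndex, dif_pos h]
  exact h.choose_spec.symm

/-- The square of a bound for the field and its derivatives near a block. -/
noncomputable def blockSq (ℓ : ℕ) (ζ : Torus N → ℝ) (B : Finset (Torus N)) : ℝ :=
  4 * ∑ s ∈ shifts, blockAverage ℓ (blockIndex ℓ B + s) ζ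

lemma blockSq_nonneg (ζ : Torus N → ℝ) (B : Finset (Torus N)) : 0 ≤ blockSq ℓ ζ B := by
  have := fun s => blockAverage_nonneg (ℓ := ℓ) (blockIndex ℓ B + s) ζ
  unfold blockSq
  exact mul_nonneg (by norm_num) (Finset.sum_nonneg fun s _ => this s)

/-- `blockSq` sums over all 49 blocks that can meet the small set neighbourhood, so the Sobolev
bound of whichever block contains the site is one of its terms. -/
lemma fieldBound_blockSq (hodd : Odd ℓ) (hN : ℓ ∣ N) (t : Touch) (ζ : Torus N → ℝ)
    (X : Finset (Torus N)) : FieldBound t ℓ ζ X fun B => √(blockSq ℓ ζ B) := by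
  have key : ∀ B ∈ blocksIn ℓ X, ∀ x ∈ nbhd t ℓ B, ∀ l : List (Fin 4), l.length ≤ 2 →
      (ℓ : ℝ) ^ l.length * |derivs l ζ x| ≤ √(blockSq ℓ ζ B) := by
    intro B hB x hx l hl
    refine Real.le_sqrt_of_sq_le ?_
    rw [← block_blockIndex (mem_blocksIn.1 hB).1] at hx
    obtain ⟨s, hs, hxs⟩ := exists_shift_of_mem_nbhd hodd hN hx
    have h := sq_derivs_le_blockAverage hodd ζ hl hxs
    rw [mul_pow, sq_abs, ← mul_pow]
    refine h.trans (mul_le_mul_of_nonneg_left ?_ (by norm_num))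
    exact Finset.single_le_sum (f := fun s => blockAverage ℓ (blockIndex ℓ B + s) ζ)
      (fun s _ => blockAverage_nonneg _ _) hs
  exact {
    nonneg := fun B => Real.sqrt_nonneg _
    zero := fun B hB x hx => by simpa [derivs] using key B hB x hx [] (by simp)
    one := fun B hB x hx μ => by simpa [derivs] using key B hB x hx [μ] (by simp)
    two := fun B hB x hx μ ν => by simpa [derivs] using key B hB x hx [μ, ν] (by simp) }

/-- The index set for the functionals that bound the field near a block. -/
noncomputable def probes (ℓ : ℕ) : Finset ((ℤ × ℤ) × (ℤ × ℤ) × Word) :=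
  shifts ×ˢ offsets ℓ ×ˢ Finset.univ

lemma card_probes (hodd : Odd ℓ) : ((probes ℓ).card : ℝ) = 16709 * (ℓ : ℝ) ^ 2 := by
  -- 341 = 1 + 4 + 16 + 64 + 256, and 49 shifts give 49 · 341 = 16709.
  have : Fintype.card Word = 341 := by
    simp [Word, Fin.sum_univ_succ]
  rw [probes, Finset.card_product, Finset.card_product, Finset.card_univ, this,
    card_offsets hodd, shifts, Finset.card_product, Int.card_Icc]
  push_cast
  ring

/-- The sum is written as an average with equal weights over the probes, ready for Jensen's
inequality. The factor is 66836 = 4 · 16709. -/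
lemma sum_blockSq (hodd : Odd ℓ) (ζ : Torus N → ℝ) (X : Finset (Torus N)) :
    ∑ B ∈ blocksIn ℓ X, blockSq ℓ ζ B = ∑ p ∈ probes ℓ, ((probes ℓ).card : ℝ)⁻¹ *
      (66836 * ∑ B ∈ blocksIn ℓ X, scaledDeriv ℓ p.2.2 (blockIndex ℓ B + p.1) p.2.1 ζ ^ 2) := by
  have hℓ : (ℓ : ℝ) ≠ 0 := by exact_mod_cast hodd.pos.ne'
  simp only [Finset.mul_sum]
  rw [Finset.sum_comm]
  refine Finset.sum_congr rfl fun B _ => ?_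
  rw [probes, Finset.sum_product, blockSq, Finset.mul_sum]
  refine Finset.sum_congr rfl fun s _ => ?_
  rw [Finset.sum_product, blockAverage, ← mul_assoc, Finset.mul_sum]
  refine Finset.sum_congr rfl fun d _ => ?_
  rw [Finset.mul_sum]
  refine Finset.sum_congr rfl fun a _ => ?_
  rw [← probes, card_probes hodd]
  field_simp
  ring

end Sobolev

/-! ### Gaussian integrals -/

section Gaussian

lemma lintegral_exp_mul_gaussianReal (a : ℝ) :
    ∫⁻ x, ENNReal.ofReal (Real.exp (a * x)) ∂(gaussianReal 0 1) =
      ENNReal.ofReal (Real.exp (a ^ 2 / 2)) := by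
  rw [← ofReal_integral_eq_lintegral_ofReal (integrable_exp_mul_gaussianReal a)
    (ae_of_all _ fun x => (Real.exp_pos _).le)]
  have := congrFun (mgf_id_gaussianReal (μ := 0) (v := 1)) a
  simp only [mgf, id] at this
  rw [this]
  simp

lemma exp_neg_two_mul_le {ρ : ℝ} (h0 : 0 ≤ ρ) (h1 : ρ ≤ 1 / 2) :
    1 / (1 - ρ) ≤ Real.exp ρ ^ 2 := by
  rw [← Real.exp_nat_mul, div_le_iff₀ (by linarith)]
  have := Real.add_one_le_exp ((2 : ℕ) * ρ)
  push_cast at *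
  nlinarith

/-- The integral equals (1 - ρ)^(-1/2), and `exp_neg_two_mul_le` bounds its square by exp (2ρ) for ρ
≤ 1/2. -/
lemma lintegral_exp_sq_gaussianReal_le {ρ : ℝ} (h0 : 0 ≤ ρ) (h1 : ρ ≤ 1 / 2) :
    ∫⁻ x, ENNReal.ofReal (Real.exp (ρ / 2 * x ^ 2)) ∂(gaussianReal 0 1) ≤
      ENNReal.ofReal (Real.exp ρ) := by
  rw [gaussianReal_of_var_ne_zero _ one_ne_zero,
    lintegral_withDensity_eq_lintegral_mul _ (measurable_gaussianPDF 0 1) (by fun_prop)]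
  have e : ∀ x : ℝ, (gaussianPDF 0 1 * fun x => ENNReal.ofReal (Real.exp (ρ / 2 * x ^ 2))) x =
      ENNReal.ofReal ((√(2 * Real.pi))⁻¹ * Real.exp (-((1 - ρ) / 2) * x ^ 2)) := by
    intro x
    rw [Pi.mul_apply, gaussianPDF, ← ENNReal.ofReal_mul (gaussianPDFReal_nonneg 0 1 x),
      gaussianPDFReal]
    simp only [NNReal.coe_one, mul_one, sub_zero]
    rw [mul_assoc, ← Real.exp_add]
    congr 3
    ring
  simp only [e]
  have hint : Integrable (fun x : ℝ => (√(2 * Real.pi))⁻¹ * Real.exp (-((1 - ρ) / 2) * x ^ 2)) :=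
    (integrable_exp_neg_mul_sq (by linarith)).const_mul _
  rw [← ofReal_integral_eq_lintegral_ofReal hint (ae_of_all _ fun x => by positivity),
    integral_const_mul, integral_gaussian]
  refine ENNReal.ofReal_le_ofReal ?_
  rw [← Real.sqrt_inv, ← Real.sqrt_mul (by positivity)]
  refine Real.sqrt_le_iff.2 ⟨(Real.exp_pos _).le, ?_⟩
  refine le_trans (le_of_eq ?_) (exp_neg_two_mul_le h0 h1)
  have : 1 - ρ ≠ 0 := by linarith
  have := Real.pi_ne_zero
  field_simp

variable {I : Type*} [Fintype I]

lemma lintegral_pi_prod (f : I → ℝ → ℝ) (hf : ∀ i, Measurable (f i)) (h0 : ∀ i x, 0 ≤ f i x) :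
    ∫⁻ x, ENNReal.ofReal (∏ i, f i (x i)) ∂(Measure.pi fun _ : I => gaussianReal 0 1) =
      ∏ i, ∫⁻ x, ENNReal.ofReal (f i x) ∂(gaussianReal 0 1) := by
  have hind : iIndepFun (fun i (x : I → ℝ) => ENNReal.ofReal (f i (x i)))
      (Measure.pi fun _ : I => gaussianReal 0 1) :=
    iIndepFun_pi (X := fun i x => ENNReal.ofReal (f i x)) fun i => by fun_prop
  have h1 : ∀ x : I → ℝ, ENNReal.ofReal (∏ i, f i (x i)) =
      ∏ i, ENNReal.ofReal (f i (x i)) := fun x =>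
    ENNReal.ofReal_prod_of_nonneg fun i _ => h0 i _
  simp only [h1]
  have := lintegral_prod_eq_prod_lintegral_of_indepFun Finset.univ _ hind
    (fun i => by have := hf i; fun_prop)
  rw [this]
  refine Finset.prod_congr rfl fun i _ => ?_
  have hm := measurePreserving_eval (fun _ : I => gaussianReal 0 1) i
  exact hm.lintegral_comp (f := fun x => ENNReal.ofReal (f i x)) (by have := hf i; fun_prop)

variable {ι : Type*} [Fintype ι] [DecidableEq ι]

/-- The exponential moments of linear functionals of a centred Gaussian field. -/
lemma lintegral_exp_multivariateGaussian (S : Matrix ι ι ℝ)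
    (L : StrongDual ℝ (EuclideanSpace ℝ ι)) :
    ∫⁻ x, ENNReal.ofReal (Real.exp (L x)) ∂(multivariateGaussian 0 S) =
      ENNReal.ofReal (Real.exp (Var[L; multivariateGaussian 0 S] / 2)) := by
  have hmap := IsGaussian.map_eq_gaussianReal (μ := multivariateGaussian 0 S) L
  have hzero : ∫ x, L x ∂(multivariateGaussian 0 S) = 0 := by
    have := L.integral_comp_comm (μ := multivariateGaussian 0 S) (φ := id) IsGaussian.integrable_id
    simp only [id] at this
    rw [this]
    have h2 := integral_id_multivariateGaussian (μ := (0 : EuclideanSpace ℝ ι)) (S := S)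
    rw [h2, map_zero]
  rw [hzero] at hmap
  have h1 : ∫⁻ x, ENNReal.ofReal (Real.exp (L x)) ∂(multivariateGaussian 0 S) =
      ∫⁻ y, ENNReal.ofReal (Real.exp y) ∂(gaussianReal 0 (Var[L; multivariateGaussian 0 S].toNNReal)) := by
    rw [← hmap, lintegral_map (by fun_prop) (by fun_prop)]
  have hint := integrable_exp_mul_gaussianReal (μ := 0)
    (v := Var[L; multivariateGaussian 0 S].toNNReal) 1
  simp only [one_mul] at hint
  rw [h1, ← ofReal_integral_eq_lintegral_ofReal hint (ae_of_all _ fun x => (Real.exp_pos _).le)]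
  have := congrFun (mgf_id_gaussianReal (μ := 0)
    (v := Var[L; multivariateGaussian 0 S].toNNReal)) 1
  simp only [mgf, id, one_mul] at this
  rw [this, Real.coe_toNNReal _ (variance_nonneg _ _)]
  simp

/-- If the rows of the covariance matrix of a Gaussian vector are small, then the square of its
norm has a bounded exponential moment. -/
lemma lintegral_exp_sum_sq_le (S : Matrix ι ι ℝ) (f : I → StrongDual ℝ (EuclideanSpace ℝ ι))
    {ρ : ℝ} (h0 : 0 ≤ ρ) (h1 : ρ ≤ 1 / 2)
    (h : ∀ i, ∑ j, |cov[f i, f j; multivariateGaussian 0 S]| ≤ ρ) :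
    ∫⁻ x, ENNReal.ofReal (Real.exp (∑ i, f i x ^ 2 / 2)) ∂(multivariateGaussian 0 S) ≤
      ENNReal.ofReal (Real.exp (ρ * Fintype.card I)) := by
  set μ := multivariateGaussian (0 : EuclideanSpace ℝ ι) S with hμ
  set ν := Measure.pi fun _ : I => gaussianReal 0 1 with hν
  -- Linearization of the square: exp (y² / 2) is the mean of exp (y g) for a standard Gaussian g.
  -- After exchanging the integrals, the field enters only through a linear functional.
  have e1 : ∀ x : EuclideanSpace ℝ ι, ENNReal.ofReal (Real.exp (∑ i, f i x ^ 2 / 2)) =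
      ∫⁻ g, ENNReal.ofReal (Real.exp (∑ i, f i x * g i)) ∂ν := by
    intro x
    have h2 := lintegral_pi_prod (fun i g => Real.exp (f i x * g)) (fun i => by fun_prop)
      (fun i g => (Real.exp_pos _).le)
    simp only [← Real.exp_sum, lintegral_exp_mul_gaussianReal] at h2
    rw [h2, Real.exp_sum, ENNReal.ofReal_prod_of_nonneg fun i _ => (Real.exp_pos _).le]
  have e2 : ∀ g : I → ℝ, ∫⁻ x, ENNReal.ofReal (Real.exp (∑ i, f i x * g i)) ∂μ ≤
      ENNReal.ofReal (∏ i, Real.exp (ρ / 2 * g i ^ 2)) := by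
    intro g
    have h3 : ∀ x, ∑ i, f i x * g i = (∑ i, g i • f i : StrongDual ℝ (EuclideanSpace ℝ ι)) x := by
      intro x
      simp [mul_comm]
    simp only [h3]
    rw [hμ, lintegral_exp_multivariateGaussian, ← hμ]
    refine ENNReal.ofReal_le_ofReal ?_
    rw [← Real.exp_sum]
    refine Real.exp_le_exp.2 ?_
    have hcoe : (⇑(∑ i, g i • f i : StrongDual ℝ (EuclideanSpace ℝ ι)) : EuclideanSpace ℝ ι → ℝ) =
        fun x => ∑ i, g i * f i x := by
      ext x; simp
    have hL : ∀ i, MemLp (fun x => g i * f i x) 2 μ := fun i =>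
      (IsGaussian.memLp_dual μ (f i) 2 (by norm_num)).const_mul _
    rw [hcoe, variance_fun_sum hL]
    simp only [covariance_const_mul_left]
    simp only [covariance_const_mul_right]
    -- Schur's test: splitting each product symmetrically bounds the covariance form by its largest
    -- absolute row sum.
    have h4 : ∀ i j, g i * (g j * cov[f i, f j; μ]) ≤
        |cov[f i, f j; μ]| * (g i ^ 2 / 2) + |cov[f j, f i; μ]| * (g j ^ 2 / 2) := by
      intro i j
      rw [covariance_comm (f j) (f i)]
      have h5 : g i * g j * cov[f i, f j; μ] ≤ |g i * g j| * |cov[f i, f j; μ]| := by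
        rw [← abs_mul]; exact le_abs_self _
      have h6 : |g i * g j| ≤ g i ^ 2 / 2 + g j ^ 2 / 2 := by
        rw [abs_mul]
        nlinarith [sq_nonneg (|g i| - |g j|), sq_abs (g i), sq_abs (g j)]
      have h7 := mul_le_mul_of_nonneg_right h6 (abs_nonneg (cov[f i, f j; μ]))
      nlinarith
    have h8 : ∑ i, ∑ j, g i * (g j * cov[f i, f j; μ]) ≤ ∑ i, ρ * g i ^ 2 := by
      refine (Finset.sum_le_sum fun i _ => Finset.sum_le_sum fun j _ => h4 i j).trans ?_
      simp only [Finset.sum_add_distrib]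
      rw [Finset.sum_comm (f := fun i j => |cov[f j, f i; μ]| * (g j ^ 2 / 2))]
      simp only [← Finset.sum_mul]
      rw [← Finset.sum_add_distrib]
      refine Finset.sum_le_sum fun i _ => ?_
      have := mul_le_mul_of_nonneg_right (h i) (show 0 ≤ g i ^ 2 / 2 by positivity)
      linarith
    rw [show ∑ i, ρ / 2 * g i ^ 2 = (∑ i, ρ * g i ^ 2) / 2 by
      rw [Finset.sum_div]; exact Finset.sum_congr rfl fun i _ => by ring]
    linarith
  simp only [e1]
  rw [lintegral_lintegral_swap]
  · refine (lintegral_mono e2).trans ?_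
    rw [lintegral_pi_prod (fun i g => Real.exp (ρ / 2 * g ^ 2)) (fun i => by fun_prop)
      (fun i g => (Real.exp_pos _).le)]
    refine (Finset.prod_le_prod' fun i _ => lintegral_exp_sq_gaussianReal_le h0 h1).trans ?_
    rw [Finset.prod_const, Finset.card_univ, ← ENNReal.ofReal_pow (Real.exp_pos _).le,
      ← Real.exp_nat_mul, mul_comm]
  · refine Measurable.aemeasurable ?_
    simp only [Function.uncurry_def]
    fun_prop

/-- The sum of independent Gaussian fields. -/
lemma multivariateGaussian_conv {S T : Matrix ι ι ℝ} (hS : S.PosSemidef) (hT : T.PosSemidef) :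
    multivariateGaussian 0 S ∗ multivariateGaussian 0 T =
      multivariateGaussian (0 : EuclideanSpace ℝ ι) (S + T) := by
  refine Measure.ext_of_charFun (funext fun x => ?_)
  rw [charFun_conv, charFun_multivariateGaussian hS, charFun_multivariateGaussian hT,
    charFun_multivariateGaussian (hS.add hT), ← Complex.exp_add, Matrix.add_mulVec,
    dotProduct_add]
  congr 1
  simp
  ring

end Gaussian

/-! ### The covariance matrix on the periodic lattice -/

section Periodization

lemma valMinAbs_intCast_eq {N : ℕ} [NeZero N] {w : ℤ} (hw : 2 * |w| < N) :
    (w : ZMod N).valMinAbs = w := by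
  rw [ZMod.valMinAbs_spec]
  refine ⟨rfl, ?_⟩
  have := abs_lt.1 (show |2 * w| < N by rw [abs_mul]; simpa using hw)
  constructor <;> omega

/-- The representatives of x - y are N k + x.val - y.val, and exactly one is centred. For odd N no
representative has absolute value N/2, so all the others are strictly outside the range. -/
lemma exists_wrap {N : ℕ} [NeZero N] (hodd : Odd N) (x y : ZMod N) :
    ∃ k₀ ∈ Finset.Icc (-1 : ℤ) 1, (x - y).valMinAbs = N * k₀ + x.val - y.val ∧
      ∀ k : ℤ, k ≠ k₀ → (N : ℤ) < 2 * |N * k + x.val - y.val| := by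
  have h1 := ZMod.valMinAbs_mem_Ioc (x - y)
  have hx : (x.val : ℤ) < N := by exact_mod_cast ZMod.val_lt x
  have hy : (y.val : ℤ) < N := by exact_mod_cast ZMod.val_lt y
  have hx0 : (0 : ℤ) ≤ x.val := by positivity
  have hy0 : (0 : ℤ) ≤ y.val := by positivity
  have h2 : (((x - y).valMinAbs : ℤ) : ZMod N) = ((x.val - y.val : ℤ) : ZMod N) := by
    rw [ZMod.coe_valMinAbs]; push_cast; simp
  rw [ZMod.intCast_eq_intCast_iff_dvd_sub] at h2
  obtain ⟨q, hq⟩ := h2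
  obtain ⟨m, hm⟩ := hodd
  rw [Set.mem_Ioc] at h1
  have hN : (N : ℤ) = 2 * m + 1 := by exact_mod_cast hm
  have hN0 : (0 : ℤ) < N := by omega
  have hqb : -1 ≤ -q ∧ -q ≤ 1 := by
    constructor <;> nlinarith
  refine ⟨-q, Finset.mem_Icc.2 hqb, by linarith, fun k hk => ?_⟩
  have h3 : (N : ℤ) * k + x.val - y.val = (x - y).valMinAbs + N * (k + q) := by linarith
  rw [h3]
  have h4 : k + q ≠ 0 := fun h => hk (by omega)
  rcases lt_or_gt_of_ne h4 with h | h
  · have : (N : ℤ) * (k + q) ≤ -N := by nlinarith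
    rw [abs_of_neg (by omega)]
    omega
  · have : (N : ℤ) ≤ N * (k + q) := by nlinarith
    rw [abs_of_pos (by omega)]
    omega

variable {N : ℕ} [NeZero N]

/-- The lattice vector with coordinates in `[0, N)` that represents a site. -/
def cornerRep (x : Torus N) : ℤ × ℤ := (x.1.val, x.2.val)

lemma torusCov_eq_sum (hodd : Odd N) {Γ : ℤ × ℤ → ℝ}
    (hΓ : ∀ x, (N : ℤ) < 2 * max |x.1| |x.2| → Γ x = 0) (x y : Torus N) :
    torusCov N Γ x y = ∑ k ∈ Finset.Icc (-1 : ℤ) 1 ×ˢ Finset.Icc (-1 : ℤ) 1,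
      Γ ((N : ℤ) • k + cornerRep x - cornerRep y) := by
  obtain ⟨k₁, h1, e1, u1⟩ := exists_wrap hodd x.1 y.1
  obtain ⟨k₂, h2, e2, u2⟩ := exists_wrap hodd x.2 y.2
  rw [Finset.sum_eq_single (k₁, k₂)]
  · rw [torusCov, Matrix.of_apply, e1, e2]
    rfl
  · rintro ⟨a, b⟩ _ hne
    refine hΓ _ ?_
    simp only [cornerRep, Prod.fst_sub, Prod.fst_add, Prod.smul_fst, smul_eq_mul, Prod.snd_sub,
      Prod.snd_add, Prod.smul_snd]
    by_cases ha : a = k₁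
    · have hb : b ≠ k₂ := fun h => hne (by rw [ha, h])
      have := u2 b hb
      have := le_max_right |(N : ℤ) * a + x.1.val - y.1.val| |(N : ℤ) * b + x.2.val - y.2.val|
      omega
    · have := u1 a ha
      have := le_max_left |(N : ℤ) * a + x.1.val - y.1.val| |(N : ℤ) * b + x.2.val - y.2.val|
      omega
  · intro h
    exact absurd (Finset.mem_product.2 ⟨h1, h2⟩) h

lemma cornerRep_far {Γ : ℤ × ℤ → ℝ} (hΓ : ∀ x, (N : ℤ) < 2 * max |x.1| |x.2| → Γ x = 0)
    {k : ℤ × ℤ} (hk : k ∉ Finset.Icc (-1 : ℤ) 1 ×ˢ Finset.Icc (-1 : ℤ) 1) (x y : Torus N) :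
    Γ ((N : ℤ) • k + cornerRep x - cornerRep y) = 0 := by
  have key : ∀ (a : ℤ) (p q : ZMod N), a ∉ Finset.Icc (-1 : ℤ) 1 →
      (N : ℤ) < 2 * |N * a + p.val - q.val| := by
    intro a p q ha
    have hp : (p.val : ℤ) < N := by exact_mod_cast ZMod.val_lt p
    have hq : (q.val : ℤ) < N := by exact_mod_cast ZMod.val_lt q
    have hp0 : (0 : ℤ) ≤ p.val := by positivity
    have hq0 : (0 : ℤ) ≤ q.val := by positivity
    rw [Finset.mem_Icc, not_and_or] at ha
    rcases ha with h | h
    · have : (N : ℤ) * a ≤ N * (-2) := mul_le_mul_of_nonneg_left (by omega) (by positivity)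
      rw [abs_of_neg (by omega)]
      omega
    · have : (N : ℤ) * 2 ≤ N * a := mul_le_mul_of_nonneg_left (by omega) (by positivity)
      rw [abs_of_pos (by omega)]
      omega
  refine hΓ _ ?_
  simp only [cornerRep, Prod.fst_sub, Prod.fst_add, Prod.smul_fst, smul_eq_mul, Prod.snd_sub,
    Prod.snd_add, Prod.smul_snd]
  rw [Finset.mem_product, not_and_or] at hk
  rcases hk with h | h
  · have := key k.1 x.1 y.1 h
    have := le_max_left |(N : ℤ) * k.1 + x.1.val - y.1.val| |(N : ℤ) * k.2 + x.2.val - y.2.val|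
    omega
  · have := key k.2 x.2 y.2 h
    have := le_max_right |(N : ℤ) * k.1 + x.1.val - y.1.val| |(N : ℤ) * k.2 + x.2.val - y.2.val|
    omega

/-- A function of range one whose Toeplitz forms on boxes are nonnegative has a nonnegative sum. -/
lemma sum_nonneg_of_toeplitz (g : ℤ × ℤ → ℝ)
    (hg : ∀ k ∉ Finset.Icc (-1 : ℤ) 1 ×ˢ Finset.Icc (-1 : ℤ) 1, g k = 0)
    (hpos : ∀ n : ℕ, 0 ≤ ∑ i ∈ Finset.Ico (0 : ℤ) n ×ˢ Finset.Ico (0 : ℤ) n,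
      ∑ j ∈ Finset.Ico (0 : ℤ) n ×ˢ Finset.Ico (0 : ℤ) n, g (i - j)) :
    0 ≤ ∑ k ∈ Finset.Icc (-1 : ℤ) 1 ×ˢ Finset.Icc (-1 : ℤ) 1, g k := by
  set K := Finset.Icc (-1 : ℤ) 1 ×ˢ Finset.Icc (-1 : ℤ) 1 with hK
  have hbound : ∀ n : ℕ, 2 ≤ n →
      0 ≤ (n : ℝ) * ∑ k ∈ K, g k + 4 * ∑ k ∈ K, |g k| := by
    intro n hn
    set Q := Finset.Ico (0 : ℤ) n ×ˢ Finset.Ico (0 : ℤ) n with hQ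
    have h1 : ∑ i ∈ Q, ∑ j ∈ Q, g (i - j) = ∑ k ∈ K, ((Q.filter fun i => i - k ∈ Q).card : ℝ) * g k := by
      have h2 : ∀ i ∈ Q, ∑ j ∈ Q, g (i - j) = ∑ k ∈ K, if i - k ∈ Q then g k else 0 := by
        intro i _
        rw [← Finset.sum_filter]
        symm
        refine Finset.sum_bij_ne_zero (fun k _ _ => i - k) ?_ ?_ ?_ ?_
        · intro k hk _; exact (Finset.mem_filter.1 hk).2
        · intro k _ _ k' _ _ h; simpa using h
        · intro j hj hne
          refine ⟨i - j, Finset.mem_filter.2 ⟨?_, by simpa using hj⟩, hne, by simp⟩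
          by_contra hk
          exact hne (hg _ hk)
        · intro k _ _; simp
      rw [Finset.sum_congr rfl h2, Finset.sum_comm]
      refine Finset.sum_congr rfl fun k _ => ?_
      rw [← Finset.sum_filter, Finset.sum_const, nsmul_eq_mul]
    -- For |k| ≤ 1 the number of pairs with difference k lies between (n-2)² and n². The error is of
    -- order n, which is negligible against n².
    have h3 : ∀ k ∈ K, ((Q.filter fun i => i - k ∈ Q).card : ℝ) * g k ≤
        (n : ℝ) ^ 2 * g k + 4 * n * |g k| := by
      intro k hk
      have hup : (Q.filter fun i => i - k ∈ Q).card ≤ n ^ 2 := by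
        refine (Finset.card_filter_le _ _).trans ?_
        rw [hQ, Finset.card_product, Int.card_Ico]
        simp [sq]
      have hlow : (n - 2) ^ 2 ≤ (Q.filter fun i => i - k ∈ Q).card := by
        have : (Finset.Ico (1 : ℤ) (n - 1) ×ˢ Finset.Ico (1 : ℤ) (n - 1)).card = (n - 2) ^ 2 := by
          rw [Finset.card_product, Int.card_Ico, sq]
          congr 1 <;> omega
        rw [← this]
        refine Finset.card_le_card fun i hi => ?_
        simp only [hK, Finset.mem_product, Finset.mem_Icc] at hk
        simp only [Finset.mem_product, Finset.mem_Ico] at hi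
        simp only [hQ, Finset.mem_filter, Finset.mem_product, Finset.mem_Ico, Prod.fst_sub,
          Prod.snd_sub]
        omega
      have hup' : ((Q.filter fun i => i - k ∈ Q).card : ℝ) ≤ (n : ℝ) ^ 2 := by exact_mod_cast hup
      have hlow' : ((n : ℝ) - 2) ^ 2 ≤ ((Q.filter fun i => i - k ∈ Q).card : ℝ) := by
        have h4 : (((n - 2) ^ 2 : ℕ) : ℝ) ≤ ((Q.filter fun i => i - k ∈ Q).card : ℝ) := by
          exact_mod_cast hlow
        rwa [Nat.cast_pow, Nat.cast_sub hn] at h4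
      rcases le_or_gt 0 (g k) with h | h
      · rw [abs_of_nonneg h]
        nlinarith [mul_le_mul_of_nonneg_right hup' h, mul_nonneg (Nat.cast_nonneg (α := ℝ) n) h]
      · rw [abs_of_neg h]
        nlinarith [mul_le_mul_of_nonpos_right hlow' h.le]
    have h5 := (hpos n).trans (h1.le.trans (Finset.sum_le_sum h3))
    rw [Finset.sum_add_distrib, ← Finset.mul_sum, ← Finset.mul_sum] at h5
    have hn0 : (0 : ℝ) < n := by exact_mod_cast (show 0 < n by omega)
    refine le_of_mul_le_mul_left ?_ hn0
    nlinarith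
  by_contra hneg
  push Not at hneg
  obtain ⟨n, hn⟩ := exists_nat_gt ((4 * ∑ k ∈ K, |g k|) / (-∑ k ∈ K, g k))
  rw [div_lt_iff₀ (by linarith)] at hn
  have h6 := hbound (n + 2) (by omega)
  push_cast at h6
  nlinarith

/-- The periodization of a covariance of finite range is a covariance. -/
lemma torusCov_posSemidef (hodd : Odd N) {Γ : ℤ × ℤ → ℝ}
    (hpsd : (Matrix.of fun x y : ℤ × ℤ => Γ (x - y)).PosSemidef)
    (hΓ : ∀ x, (N : ℤ) < 2 * max |x.1| |x.2| → Γ x = 0) : (torusCov N Γ).PosSemidef := by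
  have hsymm : ∀ z, Γ (-z) = Γ z := by
    intro z
    have := hpsd.1.apply z 0
    simpa using this
  refine Matrix.PosSemidef.of_dotProduct_mulVec_nonneg ?_ fun v => ?_
  · ext x y
    rw [Matrix.conjTranspose_apply, torusCov_eq_sum hodd hΓ, torusCov_eq_sum hodd hΓ, star_trivial]
    refine Finset.sum_bij' (fun k _ => -k) (fun k _ => -k) ?_ ?_ ?_ ?_ ?_
    · intro k hk
      simp only [Finset.mem_product, Finset.mem_Icc, Prod.fst_neg, Prod.snd_neg] at hk ⊢
      omega
    · intro k hk
      simp only [Finset.mem_product, Finset.mem_Icc, Prod.fst_neg, Prod.snd_neg] at hk ⊢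
      omega
    · simp
    · simp
    · intro k _
      rw [← hsymm]
      congr 1
      rw [smul_neg]
      abel
  -- The form on n × n copies of the torus, with v repeated in every copy, is a Toeplitz form in the
  -- positions of the copies. It is nonnegative as a form of the covariance on ℤ².
  · have h := sum_nonneg_of_toeplitz (fun k => ∑ x : Torus N, ∑ y : Torus N,
      v x * v y * Γ ((N : ℤ) • k + cornerRep x - cornerRep y)) (fun k hk => by
        simp only [cornerRep_far hΓ hk, mul_zero, Finset.sum_const_zero]) (fun n => by
        have h1 := (hpsd.submatrix (fun p : (Finset.Ico (0 : ℤ) n ×ˢ Finset.Ico (0 : ℤ) n : Finset (ℤ × ℤ)) ×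
          Torus N => (N : ℤ) • p.1.1 + cornerRep p.2)).dotProduct_mulVec_nonneg (fun p => v p.2)
        refine h1.trans (le_of_eq ?_)
        simp only [dotProduct, Matrix.mulVec, Matrix.submatrix_apply, Matrix.of_apply,
          Pi.star_apply, star_trivial]
        rw [Fintype.sum_prod_type, ← Finset.sum_coe_sort (Finset.Ico (0 : ℤ) n ×ˢ Finset.Ico (0 : ℤ) n)]
        refine Finset.sum_congr rfl fun i _ => ?_
        rw [← Finset.sum_coe_sort (Finset.Ico (0 : ℤ) n ×ˢ Finset.Ico (0 : ℤ) n)]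
        refine Eq.trans ?_ Finset.sum_comm
        refine Finset.sum_congr rfl fun x _ => ?_
        rw [Finset.mul_sum, Fintype.sum_prod_type]
        refine Finset.sum_congr rfl fun j _ => Finset.sum_congr rfl fun y _ => ?_
        rw [smul_sub, show (N : ℤ) • i.1 + cornerRep x - ((N : ℤ) • j.1 + cornerRep y) =
          (N : ℤ) • i.1 - (N : ℤ) • j.1 + cornerRep x - cornerRep y by abel]
        ring)
    refine h.trans (le_of_eq ?_)
    simp only [dotProduct, Matrix.mulVec, Pi.star_apply, star_trivial, Finset.mul_sum,
      torusCov_eq_sum hodd hΓ]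
    rw [Finset.sum_comm]
    refine Finset.sum_congr rfl fun x _ => ?_
    rw [Finset.sum_comm]
    refine Finset.sum_congr rfl fun y _ => ?_
    rw [Finset.sum_mul, Finset.mul_sum]
    exact Finset.sum_congr rfl fun k _ => by ring

end Periodization

/-! ### Exponential moments of the fluctuation field on one scale -/

section Covariance

variable {N : ℕ} [NeZero N]

/-- The value of the field at a site. -/
noncomputable def siteEval (x : Torus N) : StrongDual ℝ (EuclideanSpace ℝ (Torus N)) :=
  EuclideanSpace.proj x

/-- Derivatives are taken of the map x ↦ evaluation at x with values in the dual space, so that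
derivatives of the field become linear functionals. -/
lemma derivs_siteEval_apply (l : List (Fin 4)) (x : Torus N) (ζ : EuclideanSpace ℝ (Torus N)) :
    derivs l siteEval x ζ = derivs l (fun y => ζ y) x := by
  induction l generalizing x with
  | nil => rfl
  | cons μ l ih =>
    change deriv1 μ (derivs l siteEval) x ζ = deriv1 μ (derivs l _) x
    rw [deriv1_apply, deriv1_apply, sub_apply, ih, ih]

/-- The opposite directions. -/
def reflect (l : List (Fin 4)) : List (Fin 4) := l.map (· + 2)

/-- Moving y by a vector moves x - y by its opposite, so derivatives in the second argument are
derivatives in reflected directions. -/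
lemma derivs_sub_right (l : List (Fin 4)) (c : Torus N → ℝ) (x y : Torus N) :
    derivs l (fun z => c (x - z)) y = derivs (reflect l) c (x - y) := by
  induction l generalizing y with
  | nil => rfl
  | cons ν l ih =>
    change deriv1 ν (derivs l _) y = deriv1 (ν + 2) (derivs (reflect l) c) (x - y)
    rw [deriv1_apply, deriv1_apply, ih, ih, dir_add_two, toTorus_neg]
    congr 2
    abel

lemma derivs_sub_left (l : List (Fin 4)) (c : Torus N → ℝ) (x y : Torus N) :
    derivs l (fun z => c (z - y)) x = derivs l c (x - y) := by
  induction l generalizing x with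
  | nil => rfl
  | cons ν l ih =>
    change deriv1 ν (derivs l _) x = deriv1 ν (derivs l c) (x - y)
    rw [deriv1_apply, deriv1_apply, ih, ih]
    congr 2
    abel

/-- Each derivative enlarges the support by at most one site. This carries the finite range of the
covariance over to the derivatives of the field. -/
lemma exists_of_derivs_ne_zero (l : List (Fin 4)) (c : Torus N → ℝ) (z : Torus N)
    (h : derivs l c z ≠ 0) : ∃ w : ℤ × ℤ, |w.1| ≤ l.length ∧ |w.2| ≤ l.length ∧
      c (z + toTorus N w) ≠ 0 := by
  induction l generalizing z with
  | nil => exact ⟨0, by simp, by simp, by simpa [derivs, toTorus_zero] using h⟩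
  | cons ν l ih =>
    change deriv1 ν (derivs l c) z ≠ 0 at h
    rw [deriv1_apply] at h
    obtain ⟨hd1, hd2⟩ := abs_le_one_of_mem_unitVectors (dir_mem_unitVectors .maximum ν)
    by_cases h0 : derivs l c z = 0
    · have h1 : derivs l c (z + toTorus N (dir ν)) ≠ 0 := by
        intro h1; rw [h0, h1] at h; simp at h
      obtain ⟨w, h2, h3, h4⟩ := ih _ h1
      refine ⟨dir ν + w, ?_, ?_, by rwa [toTorus_add, ← add_assoc]⟩
      · have := abs_add_le (dir ν).1 w.1
        simp only [Prod.fst_add, List.length_cons]; push_cast; omega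
      · have := abs_add_le (dir ν).2 w.2
        simp only [Prod.snd_add, List.length_cons]; push_cast; omega
    · obtain ⟨w, h2, h3, h4⟩ := ih _ h0
      refine ⟨w, ?_, ?_, h4⟩ <;> simp only [List.length_cons] <;> push_cast <;> omega

lemma abs_derivs_le (l : List (Fin 4)) {c : Torus N → ℝ} {K : ℝ} (hc : ∀ z, |c z| ≤ K)
    (z : Torus N) : |derivs l c z| ≤ 2 ^ l.length * K := by
  induction l generalizing z with
  | nil => simpa [derivs] using hc z
  | cons ν l ih =>
    change |deriv1 ν (derivs l c) z| ≤ _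
    rw [deriv1_apply, List.length_cons, pow_succ]
    have h1 := ih (z + toTorus N (dir ν))
    have h2 := ih z
    have h3 := abs_sub (derivs l c (z + toTorus N (dir ν))) (derivs l c z)
    linarith

/-- Derivatives at small distances do not see the periodic boundary conditions. -/
lemma derivs_eq_of_eq (l : List (Fin 4)) {c : Torus N → ℝ} {Γ : ℤ × ℤ → ℝ} {m n : ℕ}
    (hc : ∀ w : ℤ × ℤ, |w.1| ≤ n → |w.2| ≤ n → c (toTorus N w) = Γ w) (hm : m + l.length ≤ n)
    {w : ℤ × ℤ} (h1 : |w.1| ≤ m) (h2 : |w.2| ≤ m) :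
    derivs l c (toTorus N w) = (l.map dir).foldr diff Γ w := by
  induction l generalizing m w with
  | nil =>
    refine hc w (h1.trans ?_) (h2.trans ?_) <;> simp at hm <;> exact_mod_cast hm
  | cons ν l ih =>
    rw [List.length_cons] at hm
    change deriv1 ν (derivs l c) (toTorus N w) = diff (dir ν) ((l.map dir).foldr diff Γ) w
    obtain ⟨hd1, hd2⟩ := abs_le_one_of_mem_unitVectors (dir_mem_unitVectors .maximum ν)
    rw [deriv1_apply, diff, ← toTorus_add, ih (m := m) (by omega) h1 h2,
      ih (m := m + 1) (by omega) ?_ ?_]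
    · have := abs_add_le w.1 (dir ν).1
      simp only [Prod.fst_add]; push_cast; omega
    · have := abs_add_le w.2 (dir ν).2
      simp only [Prod.snd_add]; push_cast; omega

variable (μ : Measure (EuclideanSpace ℝ (Torus N))) [IsGaussian μ]

lemma cov_derivs_left (l : List (Fin 4)) (F : Torus N → StrongDual ℝ (EuclideanSpace ℝ (Torus N)))
    (G : StrongDual ℝ (EuclideanSpace ℝ (Torus N))) (x : Torus N) :
    cov[⇑(derivs l F x), G; μ] = derivs l (fun y => cov[F y, G; μ]) x := by
  induction l generalizing x with
  | nil => rfl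
  | cons ν l ih =>
    change cov[⇑(deriv1 ν (derivs l F) x), G; μ] = deriv1 ν (derivs l _) x
    rw [deriv1_apply, deriv1_apply, ← ih, ← ih, FunLike.coe_sub]
    exact covariance_sub_left (IsGaussian.memLp_dual μ _ 2 (by norm_num))
      (IsGaussian.memLp_dual μ _ 2 (by norm_num)) (IsGaussian.memLp_dual μ _ 2 (by norm_num))

lemma cov_derivs (l : List (Fin 4)) {c : Torus N → ℝ}
    (hc : ∀ x y, cov[siteEval x, siteEval y; μ] = c (x - y)) (x y : Torus N) :
    cov[⇑(derivs l siteEval x), ⇑(derivs l siteEval y); μ] = derivs (l ++ reflect l) c (x - y) := by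
  rw [cov_derivs_left]
  have h : ∀ z, cov[siteEval z, ⇑(derivs l siteEval y); μ] = derivs (reflect l) c (z - y) := by
    intro z
    rw [covariance_comm, cov_derivs_left]
    simp only [covariance_comm _ (siteEval z), hc]
    exact derivs_sub_right l c z y
  simp only [h]
  rw [derivs_sub_left]
  simp only [derivs, List.foldr_append]

/-- The variances of F + G and F - G are nonnegative, so |cov(F, G)| is at most the mean of the two
variances. -/
lemma abs_cov_le (F G : StrongDual ℝ (EuclideanSpace ℝ (Torus N))) {V : ℝ}
    (hF : cov[F, F; μ] ≤ V) (hG : cov[G, G; μ] ≤ V) : |cov[F, G; μ]| ≤ V := by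
  have mF := IsGaussian.memLp_dual μ F 2 (by norm_num)
  have mG := IsGaussian.memLp_dual μ G 2 (by norm_num)
  have h1 := variance_nonneg (F - G : StrongDual ℝ (EuclideanSpace ℝ (Torus N))) μ
  have h2 := variance_nonneg (F + G : StrongDual ℝ (EuclideanSpace ℝ (Torus N))) μ
  rw [← covariance_self (by fun_prop), FunLike.coe_sub, covariance_sub_sub mF mG mF mG] at h1
  rw [← covariance_self (by fun_prop), FunLike.coe_add,
    covariance_add_left mF mG (mF.add mG), covariance_add_right mF mF mG,
    covariance_add_right mG mF mG] at h2
  rw [covariance_comm G F] at h1 h2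
  rw [abs_le]
  constructor <;> linarith

end Covariance

/-! ### Exponential moments of the block averages on one scale. -/

section Moments

variable {γ : ℕ} {Cov : ℕ → ℤ × ℤ → ℝ}

/-- The constant in the bounds of the variances of the scaled derivatives. -/
lemma exists_variance_bound (hFRD : IsFiniteRangeDecomposition γ Cov) (hγ : 0 < γ) :
    ∃ V : ℝ, 0 ≤ V ∧ ∀ (N : ℕ) [NeZero N] (h : ℕ), γ ^ (h + 1) ∣ N → ∀ l : List (Fin 4),
      l.length ≤ 4 → ((γ ^ h : ℕ) : ℝ) ^ (2 * l.length) *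
        |derivs (l ++ reflect l) (fun z : Torus N => Cov h (z.1.valMinAbs, z.2.valMinAbs)) 0| ≤
        V := by
  choose K hK using hFRD.derivBound
  have hK0 : ∀ n, 0 ≤ K n := by
    intro n
    have h := (abs_nonneg _).trans (hK n 0 0 fun _ => 0)
    simpa using h
  -- A covariance of two derivatives of order at most four has order at most 8, hence `range 9`. The
  -- second summand covers the tori with N < 17, where such a derivative may wrap around. There γ^h
  -- ≤ 17 as well, so a crude bound suffices.
  refine ⟨∑ k ∈ Finset.range 9, K k + 17 ^ 8 * (2 ^ 8 * K 0), ?_, ?_⟩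
  · have := Finset.sum_nonneg fun k (_ : k ∈ Finset.range 9) => hK0 k
    have := hK0 0
    positivity
  intro N _ h hN l hl
  set c : Torus N → ℝ := fun z => Cov h (z.1.valMinAbs, z.2.valMinAbs) with hc
  have hlen : (l ++ reflect l).length = 2 * l.length := by
    simp [reflect]; ring
  have hγh : (0 : ℝ) < ((γ ^ h : ℕ) : ℝ) := by positivity
  have hsum : ∀ k, k ≤ 8 → K k ≤ ∑ k ∈ Finset.range 9, K k := fun k hk =>
    Finset.single_le_sum (f := K) (fun k _ => hK0 k) (Finset.mem_range.2 (by omega))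
  by_cases hbig : 17 ≤ N
  · have e := derivs_eq_of_eq (l ++ reflect l) (c := c) (Γ := Cov h) (m := 0) (n := 8) (by
      intro w h1 h2
      simp only [hc, toTorus]
      rw [valMinAbs_intCast_eq (by push_cast at h1; omega),
        valMinAbs_intCast_eq (by push_cast at h2; omega)]) (by omega) (w := 0) (by simp) (by simp)
    rw [toTorus_zero] at e
    rw [e]
    have h2 := hK (l ++ reflect l).length h 0 (l ++ reflect l).get
    rw [diffs, show List.ofFn (fun i => dir ((l ++ reflect l).get i)) = (l ++ reflect l).map dir by
      simp [← List.ofFn_getElem_eq_map]] at h2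
    rw [hlen, le_div_iff₀ (by positivity)] at h2
    have h3 : ((γ ^ h : ℕ) : ℝ) ^ (2 * l.length) = (γ : ℝ) ^ (h * (2 * l.length)) := by
      push_cast; rw [← pow_mul]
    rw [h3, mul_comm]
    have := hsum (2 * l.length) (by omega)
    have := hK0 0
    have : (0 : ℝ) ≤ 17 ^ 8 * (2 ^ 8 * K 0) := by positivity
    linarith
  · have h0 : ∀ z, |c z| ≤ K 0 := by
      intro z
      have := hK 0 h (z.1.valMinAbs, z.2.valMinAbs) Fin.elim0
      simpa [diffs] using this
    have h1 := abs_derivs_le (l ++ reflect l) h0 0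
    rw [hlen] at h1
    have h2 : γ ^ h ≤ 17 := by
      have := Nat.le_of_dvd (NeZero.pos N) ((pow_dvd_pow γ (Nat.le_succ h)).trans hN)
      omega
    have h3 : ((γ ^ h : ℕ) : ℝ) ^ (2 * l.length) ≤ 17 ^ 8 := by
      calc ((γ ^ h : ℕ) : ℝ) ^ (2 * l.length) ≤ 17 ^ (2 * l.length) := by
            gcongr; exact_mod_cast h2
        _ ≤ 17 ^ 8 := by gcongr <;> [norm_num; omega]
    have h4 : (2 : ℝ) ^ (2 * l.length) * K 0 ≤ 2 ^ 8 * K 0 :=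
      mul_le_mul_of_nonneg_right (by gcongr <;> [norm_num; omega]) (hK0 0)
    have h5 := mul_le_mul h3 (h1.trans h4) (abs_nonneg _) (by positivity)
    have := Finset.sum_nonneg fun k (_ : k ∈ Finset.range 9) => hK0 k
    linarith

lemma torusCov_posSemidef_of_frd (hFRD : IsFiniteRangeDecomposition γ Cov) {N : ℕ} [NeZero N]
    (hodd : Odd N) {h : ℕ} (hN : γ ^ (h + 1) ∣ N) : (torusCov N (Cov h)).PosSemidef := by
  refine torusCov_posSemidef hodd (hFRD.posSemidef h) fun x hx => hFRD.finiteRange h x ?_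
  have : ((γ ^ (h + 1) : ℕ) : ℤ) ≤ N := by exact_mod_cast Nat.le_of_dvd (NeZero.pos N) hN
  push_cast at this
  linarith

/-- At most `(2 γ + 17) ^ 2` blocks are correlated with a given block. -/
lemma card_correlated_le {N : ℕ} [NeZero N] {ℓ : ℕ} (hℓ : 0 < ℓ) (hN : ℓ ∣ N)
    (X : Finset (Torus N)) (B : Finset (Torus N)) (P : Finset (Torus N) → Prop) [DecidablePred P]
    (hP : ∀ D ∈ blocksIn ℓ X, P D → ∃ d : ℤ × ℤ, |d.1| ≤ (γ + 8) * ℓ ∧ |d.2| ≤ (γ + 8) * ℓ ∧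
      toTorus N ((ℓ : ℤ) • blockIndex ℓ B) - toTorus N ((ℓ : ℤ) • blockIndex ℓ D) = toTorus N d) :
    ((blocksIn ℓ X).filter P).card ≤ (2 * γ + 17) ^ 2 := by
  classical
  set E := Finset.Icc (-((γ : ℤ) + 8)) (γ + 8) ×ˢ Finset.Icc (-((γ : ℤ) + 8)) (γ + 8) with hE
  have hcard : E.card = (2 * γ + 17) ^ 2 := by
    rw [hE, Finset.card_product, Int.card_Icc, sq]
    congr 1 <;> omega
  rw [← hcard]
  refine (Finset.card_le_card (t := E.image fun e => block N ℓ (blockIndex ℓ B - e))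
    fun D hD => ?_).trans Finset.card_image_le
  obtain ⟨hD1, hD2⟩ := Finset.mem_filter.1 hD
  obtain ⟨d, h1, h2, h3⟩ := hP D hD1 hD2
  have hdvd : ∀ a b c : ℤ, ((ℓ * a : ℤ) : ZMod N) - ((ℓ * b : ℤ) : ZMod N) = (c : ZMod N) →
      (ℓ : ℤ) ∣ c := by
    intro a b c h
    rw [← Int.cast_sub, ZMod.intCast_eq_intCast_iff_dvd_sub] at h
    have h4 := (Int.natCast_dvd_natCast.2 hN).trans h
    have h5 : (ℓ : ℤ) ∣ ℓ * a - ℓ * b := ⟨a - b, by ring⟩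
    have := dvd_add h4 h5
    rwa [sub_add_cancel] at this
  have h3' := h3
  simp only [toTorus, Prod.mk_sub_mk, Prod.mk.injEq, Prod.smul_fst, Prod.smul_snd, smul_eq_mul]
    at h3'
  obtain ⟨e₁, he₁⟩ := hdvd _ _ _ h3'.1
  obtain ⟨e₂, he₂⟩ := hdvd _ _ _ h3'.2
  have hb : ∀ e : ℤ, |(ℓ : ℤ) * e| ≤ (γ + 8) * ℓ → e ∈ Finset.Icc (-((γ : ℤ) + 8)) (γ + 8) := by
    intro e he
    have hℓ' : (0 : ℤ) < ℓ := by exact_mod_cast hℓ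
    rw [abs_mul, abs_of_pos hℓ', mul_comm] at he
    rw [Finset.mem_Icc, ← abs_le]
    exact le_of_mul_le_mul_right he hℓ'
  refine Finset.mem_image.2 ⟨(e₁, e₂), Finset.mem_product.2
    ⟨hb _ (he₁ ▸ h1), hb _ (he₂ ▸ h2)⟩, ?_⟩
  rw [← block_blockIndex (mem_blocksIn.1 hD1).1]
  refine block_congr ?_
  rw [smul_sub, toTorus_sub, show (ℓ : ℤ) • ((e₁, e₂) : ℤ × ℤ) = d by ext <;> simp [he₁, he₂], ← h3]
  simp

/-- Each family of functionals with one functional for each block has a bounded exponential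
moment. -/
lemma lintegral_exp_probe_le (hFRD : IsFiniteRangeDecomposition γ Cov) (hγ : 0 < γ) :
    ∃ V : ℝ, 0 < V ∧ ∀ (N : ℕ) [NeZero N] (h : ℕ), Odd N → γ ^ (h + 1) ∣ N →
      ∀ (X : Finset (Torus N)) (p : (ℤ × ℤ) × (ℤ × ℤ) × Word) (θ : ℝ), 0 ≤ θ → θ * V ≤ 1 / 2 →
      ∫⁻ ζ, ENNReal.ofReal (Real.exp (θ * ∑ B ∈ blocksIn (γ ^ h) X,
          scaledDeriv (γ ^ h) p.2.2 (blockIndex (γ ^ h) B + p.1) p.2.1 (fun x => ζ x) ^ 2))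
        ∂(gaussianField N (Cov h)) ≤
      ENNReal.ofReal (Real.exp (θ * V * (blocksIn (γ ^ h) X).card)) := by
  classical
  obtain ⟨V, hV0, hV⟩ := exists_variance_bound hFRD hγ
  -- The factor 2 comes from writing θ F² as (√(2θ) F)² / 2, and (2γ + 17)² counts the correlated
  -- blocks. V + 1 replaces V to make the constant positive.
  refine ⟨2 * (2 * γ + 17) ^ 2 * (V + 1), by positivity, ?_⟩
  rintro N _ h hodd hN X ⟨s, d, a⟩ θ hθ hθV
  set ℓ := γ ^ h with hℓ
  have hℓ0 : 0 < ℓ := by positivity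
  have hℓN : ℓ ∣ N := (pow_dvd_pow γ (Nat.le_succ h)).trans hN
  have hpsd := torusCov_posSemidef_of_frd hFRD hodd hN
  set μ := gaussianField N (Cov h) with hμ
  have : IsGaussian μ := by rw [hμ, gaussianField]; infer_instance
  set c : Torus N → ℝ := fun z => Cov h (z.1.valMinAbs, z.2.valMinAbs) with hc
  have hcov : ∀ x y, cov[siteEval x, siteEval y; μ] = c (x - y) := by
    intro x y
    exact covariance_eval_multivariateGaussian hpsd x y
  set site : Finset (Torus N) → Torus N := fun B =>
    toTorus N ((ℓ : ℤ) • (blockIndex ℓ B + s) + d) with hsite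
  have ha : a.toList.length ≤ 4 := by
    rw [a.length_toList]; have := a.1.2; omega
  set F : Finset (Torus N) → StrongDual ℝ (EuclideanSpace ℝ (Torus N)) := fun B =>
    ((ℓ : ℝ) ^ (a.1 : ℕ)) • derivs a.toList siteEval (site B) with hF
  have hFapply : ∀ B (ζ : EuclideanSpace ℝ (Torus N)), F B ζ =
      scaledDeriv ℓ a (blockIndex ℓ B + s) d (fun x => ζ x) := by
    intro B ζ
    simp only [hF, scaledDeriv, FunLike.coe_smul, Pi.smul_apply, smul_eq_mul]
    rw [derivs_siteEval_apply]
  have hFcov : ∀ B D, cov[F B, F D; μ] = (ℓ : ℝ) ^ (2 * a.toList.length) *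
      derivs (a.toList ++ reflect a.toList) c (site B - site D) := by
    intro B D
    rw [← cov_derivs μ a.toList hcov]
    simp only [hF, FunLike.coe_smul]
    rw [covariance_smul_left, covariance_smul_right, a.length_toList]
    ring
  have hFvar : ∀ B, cov[F B, F B; μ] ≤ V := by
    intro B
    rw [hFcov, sub_self]
    exact (mul_le_mul_of_nonneg_left (le_abs_self _) (by positivity)).trans (hV N h hN _ ha)
  -- Correlated sites are within γℓ/2 of each other, up to the at most 8 sites that the derivatives
  -- add. The shift and the offset are the same for all blocks, so they cancel in the difference.
  have hFzero : ∀ B, ∀ D ∈ blocksIn ℓ X, cov[F B, F D; μ] ≠ 0 →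
      ∃ d : ℤ × ℤ, |d.1| ≤ (γ + 8) * ℓ ∧ |d.2| ≤ (γ + 8) * ℓ ∧
      toTorus N ((ℓ : ℤ) • blockIndex ℓ B) - toTorus N ((ℓ : ℤ) • blockIndex ℓ D) =
        toTorus N d := by
    intro B D _ hne
    rw [hFcov] at hne
    obtain ⟨w, h1, h2, h3⟩ := exists_of_derivs_ne_zero _ _ _ (right_ne_zero_of_mul hne)
    set z := site B - site D + toTorus N w with hz
    have h4 : ¬ (γ : ℤ) ^ (h + 1) < 2 * max |z.1.valMinAbs| |z.2.valMinAbs| := fun h5 =>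
      h3 (hFRD.finiteRange h _ h5)
    rw [not_lt] at h4
    have h5 : z = toTorus N (z.1.valMinAbs, z.2.valMinAbs) := by simp [toTorus]
    have h6 : (γ : ℤ) ^ (h + 1) = γ * ℓ := by rw [hℓ]; push_cast; ring
    have hw : ∀ u v : ℤ, |u| ≤ (a.toList ++ reflect a.toList).length → 2 * |v| ≤ γ * ℓ →
        |v - u| ≤ (γ + 8) * ℓ := by
      intro u v hu hv
      have h7 : (a.toList ++ reflect a.toList).length ≤ 8 := by
        simp [reflect]; omega
      have h8 : (1 : ℤ) ≤ ℓ := by exact_mod_cast hℓ0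
      have h9 := abs_sub v u
      have h10 : |u| ≤ 8 := by omega
      have h11 := abs_nonneg v
      nlinarith
    have h7 := le_max_left |z.1.valMinAbs| |z.2.valMinAbs|
    have h8 := le_max_right |z.1.valMinAbs| |z.2.valMinAbs|
    refine ⟨(z.1.valMinAbs, z.2.valMinAbs) - w, hw _ _ h1 ?_, hw _ _ h2 ?_, ?_⟩
    · simp only []; omega
    · simp only []; omega
    rw [toTorus_sub, ← h5, hz, hsite]
    simp only [smul_add, toTorus_add]
    abel
  set f : {B // B ∈ blocksIn ℓ X} → StrongDual ℝ (EuclideanSpace ℝ (Torus N)) :=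
    fun B => √(2 * θ) • F B with hf
  have hθ2 : √(2 * θ) * √(2 * θ) = 2 * θ := Real.mul_self_sqrt (by positivity)
  have hrow : ∀ B, ∑ D, |cov[f B, f D; μ]| ≤ θ * (2 * (2 * γ + 17) ^ 2 * (V + 1)) := by
    intro B
    have h1 : ∀ D, |cov[f B, f D; μ]| = 2 * θ * |cov[F B, F D; μ]| := by
      intro D
      simp only [hf, FunLike.coe_smul]
      rw [covariance_smul_left, covariance_smul_right, ← mul_assoc, hθ2, abs_mul,
        abs_of_nonneg (by positivity : 0 ≤ 2 * θ)]
    simp only [h1]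
    rw [← Finset.mul_sum, Finset.sum_coe_sort (blocksIn ℓ X) fun D => |cov[F B, F D; μ]|]
    have h2 : ∑ D ∈ blocksIn ℓ X, |cov[F B, F D; μ]| ≤ ((2 * γ + 17) ^ 2 : ℕ) * V := by
      have h3 : ∑ D ∈ blocksIn ℓ X, |cov[F B, F D; μ]| =
          ∑ D ∈ (blocksIn ℓ X).filter (fun D => cov[F B, F D; μ] ≠ 0), |cov[F B, F D; μ]| := by
        rw [Finset.sum_filter]
        refine Finset.sum_congr rfl fun D _ => ?_
        split_ifs with h4
        · rfl
        · rw [not_not.1 h4, abs_zero]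
      rw [h3]
      refine (Finset.sum_le_card_nsmul _ _ V fun D _ =>
        abs_cov_le μ _ _ (hFvar B) (hFvar D)).trans ?_
      rw [nsmul_eq_mul]
      refine mul_le_mul_of_nonneg_right ?_ hV0
      exact_mod_cast card_correlated_le hℓ0 hℓN X B _ (hFzero B)
    have h3 := mul_le_mul_of_nonneg_left h2 (show 0 ≤ 2 * θ by positivity)
    push_cast at h3
    have h4 : (0 : ℝ) ≤ θ * (2 * (2 * γ + 17) ^ 2) := by positivity
    nlinarith
  have := lintegral_exp_sum_sq_le (torusCov N (Cov h)) f (by positivity) hθV hrow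
  rw [Fintype.card_coe] at this
  refine le_trans (le_of_eq ?_) this
  refine lintegral_congr fun ζ => ?_
  congr 2
  rw [Finset.mul_sum, ← Finset.sum_coe_sort (blocksIn ℓ X)]
  refine Finset.sum_congr rfl fun B _ => ?_
  simp only [hf, FunLike.coe_smul, Pi.smul_apply, smul_eq_mul]
  rw [hFapply, mul_pow, sq (√(2 * θ)), hθ2]
  ring

/-- The exponential moment of the bounds of the fluctuation field on one scale. -/
lemma lintegral_exp_blockSq_le (hFRD : IsFiniteRangeDecomposition γ Cov) (hγ : Odd γ) :
    ∃ V : ℝ, 0 < V ∧ ∀ (N : ℕ) [NeZero N] (h : ℕ), Odd N → γ ^ (h + 1) ∣ N →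
      ∀ (X : Finset (Torus N)) (θ : ℝ), 0 ≤ θ → θ * V ≤ 1 / 2 →
      ∫⁻ ζ, ENNReal.ofReal (Real.exp (θ * ∑ B ∈ blocksIn (γ ^ h) X,
          blockSq (γ ^ h) (fun x => ζ x) B)) ∂(gaussianField N (Cov h)) ≤
      ENNReal.ofReal (Real.exp (θ * V * (blocksIn (γ ^ h) X).card)) := by
  obtain ⟨V, hV0, hV⟩ := lintegral_exp_probe_le hFRD hγ.pos
  refine ⟨66836 * V, by positivity, ?_⟩
  intro N _ h hodd hN X θ hθ hθV
  set ℓ := γ ^ h with hℓ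
  have hℓodd : Odd ℓ := hγ.pow
  set n : ℝ := ((probes ℓ).card : ℝ) with hn
  have hn0 : 0 < n := by
    rw [hn, card_probes hℓodd]
    have : (0 : ℝ) < ℓ := by exact_mod_cast hℓodd.pos
    positivity
  have hone : ∑ _p ∈ probes ℓ, n⁻¹ = 1 := by
    rw [Finset.sum_const, nsmul_eq_mul, ← hn, mul_inv_cancel₀ hn0.ne']
  set Q : (ℤ × ℤ) × (ℤ × ℤ) × Word → EuclideanSpace ℝ (Torus N) → ℝ := fun p ζ =>
    ∑ B ∈ blocksIn ℓ X, scaledDeriv ℓ p.2.2 (blockIndex ℓ B + p.1) p.2.1 (fun x => ζ x) ^ 2 with hQ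
  have hcont : ∀ (l : List (Fin 4)) (x : Torus N),
      Continuous fun ζ : EuclideanSpace ℝ (Torus N) => derivs l (fun y => ζ y) x := by
    intro l x
    simp only [← derivs_siteEval_apply]
    exact ContinuousLinearMap.continuous _
  have hQm : ∀ p, Measurable (Q p) := by
    intro p
    refine Continuous.measurable ?_
    refine continuous_finsetSum _ fun B _ => ?_
    exact ((hcont _ _).const_mul _).pow 2
  -- Convexity of exp replaces the exponential of an average over probes by the average of the
  -- exponentials, so that each probe can be treated alone.
  have hjensen : ∀ ζ : EuclideanSpace ℝ (Torus N), ENNReal.ofReal (Real.exp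
      (θ * ∑ B ∈ blocksIn ℓ X, blockSq ℓ (fun x => ζ x) B)) ≤
      ∑ p ∈ probes ℓ, ENNReal.ofReal n⁻¹ * ENNReal.ofReal (Real.exp (θ * 66836 * Q p ζ)) := by
    intro ζ
    have h1 : θ * ∑ B ∈ blocksIn ℓ X, blockSq ℓ (fun x => ζ x) B =
        ∑ p ∈ probes ℓ, n⁻¹ • (θ * 66836 * Q p ζ) := by
      rw [sum_blockSq hℓodd, Finset.mul_sum]
      refine Finset.sum_congr rfl fun p _ => ?_
      rw [smul_eq_mul]
      ring
    rw [h1]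
    have h2 := convexOn_exp.map_sum_le (t := probes ℓ) (w := fun _ => n⁻¹)
      (p := fun p => θ * 66836 * Q p ζ) (fun _ _ => by positivity) hone (fun _ _ => Set.mem_univ _)
    refine (ENNReal.ofReal_le_ofReal h2).trans (le_of_eq ?_)
    rw [ENNReal.ofReal_sum_of_nonneg fun p _ => by positivity]
    refine Finset.sum_congr rfl fun p _ => ?_
    rw [smul_eq_mul, ENNReal.ofReal_mul (by positivity)]
  refine (lintegral_mono hjensen).trans ?_
  rw [lintegral_finsetSum _ fun p _ => by have := hQm p; fun_prop]
  have hp : ∀ p ∈ probes ℓ, ∫⁻ ζ, ENNReal.ofReal n⁻¹ *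
      ENNReal.ofReal (Real.exp (θ * 66836 * Q p ζ)) ∂(gaussianField N (Cov h)) ≤
      ENNReal.ofReal n⁻¹ *
        ENNReal.ofReal (Real.exp (θ * (66836 * V) * (blocksIn ℓ X).card)) := by
    intro p _
    rw [lintegral_const_mul _ (by have := hQm p; fun_prop)]
    gcongr
    have := hV N h hodd hN X p (θ * 66836) (by positivity) (by linarith)
    rwa [show θ * (66836 * V) = θ * 66836 * V by ring]
  refine (Finset.sum_le_sum hp).trans (le_of_eq ?_)
  rw [← Finset.sum_mul, ← ENNReal.ofReal_sum_of_nonneg fun p _ => by positivity, hone]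
  simp

end Moments

/-! ### Integration over a range of scales -/

section Continuity

variable {N : ℕ} [NeZero N]

lemma continuous_deriv1 (μ : Fin 4) : Continuous (deriv1 μ : (Torus N → ℂ) → Torus N → ℂ) := by
  refine continuous_pi fun x => ?_
  simp only [deriv1_apply]
  fun_prop

lemma continuous_gradSum (x : Torus N) : Continuous fun φ : Torus N → ℂ => gradSum φ x := by
  refine continuous_finsetSum _ fun μ _ => ?_
  exact (((continuous_apply x).comp (continuous_deriv1 μ)).norm).pow 2

lemma continuous_supNorm_two (ℓ : ℕ) (X : Finset (Torus N)) :
    Continuous fun φ : Torus N → ℂ => supNorm 2 ℓ φ X := by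
  unfold supNorm
  refine continuous_const.mul (NNReal.continuous_coe.comp ?_)
  refine Continuous.finset_sup_apply fun x _ => Continuous.finset_sup_apply fun μ _ => ?_
  simp only [grad_two]
  exact ((continuous_apply x).comp ((continuous_deriv1 _).comp (continuous_deriv1 _))).nnnorm

lemma continuous_energy (t : Touch) (c₁ c₃ : ℝ) (ℓ : ℕ) (X : Finset (Torus N)) :
    Continuous fun φ : Torus N → ℂ => energy t c₁ c₃ ℓ φ X := by
  unfold energy sqW
  refine ((continuous_const.mul ?_).add (continuous_const.mul ?_)).add (continuous_const.mul ?_)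
  · exact continuous_finsetSum _ fun x _ => continuous_gradSum x
  · exact continuous_finsetSum _ fun x _ => continuous_gradSum x
  · exact continuous_finsetSum _ fun B _ => (continuous_supNorm_two ℓ _).pow 2

lemma continuous_shiftField (φ : Torus N → ℂ) :
    Continuous fun p : ℝ × EuclideanSpace ℝ (Torus N) => shiftField p.1 φ p.2 := by
  unfold shiftField
  refine continuous_pi fun x => ?_
  have : Continuous fun p : ℝ × EuclideanSpace ℝ (Torus N) => p.2 x :=
    (EuclideanSpace.proj (𝕜 := ℝ) x).continuous.comp continuous_snd
  fun_prop

end Continuity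

/-! ### The regulator relative to a prescribed exponent, uniformly in the background. -/

section Excess

instance isGaussian_gaussianField (N : ℕ) [NeZero N] (Γ : ℤ × ℤ → ℝ) :
    IsGaussian (gaussianField N Γ) := by
  unfold gaussianField; infer_instance

variable {N : ℕ} [NeZero N]

/-- The largest ratio of the field regulator of `X` to `exp (κ Ψ)`, as a function of the
fluctuation field. -/
noncomputable def excess (t : Touch) (c₁ c₃ κ : ℝ) (ℓ : ℕ) (X : Finset (Torus N))
    (Ψ : (Torus N → ℂ) → ℝ) (ζ : EuclideanSpace ℝ (Torus N)) : ENNReal :=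
  ⨆ φ : Torus N → ℂ, ENNReal.ofReal (Real.exp (κ * (energy t c₁ c₃ ℓ (shiftField 1 φ ζ) X - Ψ φ)))

/-- The supremum is over uncountably many fields, so measurability comes from lower semicontinuity.
-/
lemma measurable_excess (t : Touch) (c₁ c₃ κ : ℝ) (ℓ : ℕ) (X : Finset (Torus N))
    (Ψ : (Torus N → ℂ) → ℝ) : Measurable (excess t c₁ c₃ κ ℓ X Ψ) := by
  refine LowerSemicontinuous.measurable ?_
  refine lowerSemicontinuous_iSup fun φ => Continuous.lowerSemicontinuous ?_
  refine ENNReal.continuous_ofReal.comp (Real.continuous_exp.comp ?_)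
  refine continuous_const.mul (Continuous.sub ?_ continuous_const)
  exact (continuous_energy t c₁ c₃ ℓ X).comp
    ((continuous_shiftField φ).comp (Continuous.prodMk_right (1 : ℝ)))

lemma shiftField_one_add (φ : Torus N → ℂ) (ζ η : EuclideanSpace ℝ (Torus N)) :
    shiftField 1 φ (ζ + η) = fun x => shiftField 1 φ η x + ((ζ x : ℝ) : ℂ) := by
  ext x
  simp only [shiftField, PiLp.add_apply]
  push_cast
  ring

/-- The cost of a fluctuation field in one step. -/
noncomputable def stepCost (c₁ c₃ : ℝ) : ℝ := 8 * c₁ + 72 * c₁ ^ 2 / c₃ + 16 * c₃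

lemma stepCost_pos {c₁ c₃ : ℝ} (hc₁ : 0 < c₁) (hc₃ : 0 < c₃) : 0 < stepCost c₁ c₃ := by
  unfold stepCost; positivity

variable {γ ℓ : ℕ} {X : Finset (Torus N)} {t : Touch}

lemma energy_shift_le (hodd : Odd ℓ) (hγ : Odd γ) (hγ3 : 3 ≤ γ) (hN : γ * ℓ ∣ N)
    (hX : IsPolymer ℓ X) {c₁ c₃ : ℝ} (hc₁ : 0 < c₁) (hc₃ : 0 < c₃) (hc : 200 * c₃ ≤ c₁)
    (φ : Torus N → ℂ) (ζ : Torus N → ℝ) :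
    energy t c₁ c₃ ℓ (fun x => φ x + (ζ x : ℂ)) X ≤ stepEnergy t c₁ c₃ γ ℓ φ X
      + stepCost c₁ c₃ * ∑ B ∈ blocksIn ℓ X, blockSq ℓ ζ B := by
  have h := energy_step hodd hγ hγ3 hN hX hc₁ hc₃ hc φ
    (fieldBound_blockSq hodd (dvd_of_mul_left_dvd hN) t ζ X)
  have e : ∀ B, √(blockSq ℓ ζ B) ^ 2 = blockSq ℓ ζ B := fun B => Real.sq_sqrt (blockSq_nonneg ζ B)
  simpa only [e, stepCost] using h

/-- The base of the recursion: on the last scale the one-step inequality holds with `stepEnergy`,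
which keeps the slack for part b). -/
lemma excess_stepEnergy_le (hodd : Odd ℓ) (hγ : Odd γ) (hγ3 : 3 ≤ γ) (hN : γ * ℓ ∣ N)
    (hX : IsPolymer ℓ X) {c₁ c₃ κ : ℝ} (hc₁ : 0 < c₁) (hc₃ : 0 < c₃) (hc : 200 * c₃ ≤ c₁)
    (hκ : 0 ≤ κ) (ζ : EuclideanSpace ℝ (Torus N)) :
    excess t c₁ c₃ κ ℓ X (fun φ => stepEnergy t c₁ c₃ γ ℓ φ X) ζ ≤
      ENNReal.ofReal (Real.exp (κ * stepCost c₁ c₃ *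
        ∑ B ∈ blocksIn ℓ X, blockSq ℓ (fun x => ζ x) B)) := by
  refine iSup_le fun φ => ENNReal.ofReal_le_ofReal (Real.exp_le_exp.2 ?_)
  rw [mul_assoc]
  refine mul_le_mul_of_nonneg_left ?_ hκ
  have h := energy_shift_le (t := t) hodd hγ hγ3 hN hX hc₁ hc₃ hc φ (fun x => ζ x)
  have e : shiftField 1 φ ζ = fun x => φ x + ((ζ x : ℝ) : ℂ) := by
    ext x; simp [shiftField]
  rw [e]
  linarith

/-- The recursion: φ + η is the background for the layer ζ, and the one-step inequality replaces X
on the scale ℓ by its closure on the scale γℓ. Here the slack is given up. -/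
lemma excess_add_le (hodd : Odd ℓ) (hγ : Odd γ) (hγ3 : 3 ≤ γ) (hN : γ * ℓ ∣ N)
    (hX : IsPolymer ℓ X) {c₁ c₃ κ : ℝ} (hc₁ : 0 < c₁) (hc₃ : 0 < c₃) (hc : 200 * c₃ ≤ c₁)
    (hκ : 0 ≤ κ) (Ψ : (Torus N → ℂ) → ℝ) (ζ η : EuclideanSpace ℝ (Torus N)) :
    excess t c₁ c₃ κ ℓ X Ψ (ζ + η) ≤
      ENNReal.ofReal (Real.exp (κ * stepCost c₁ c₃ *
        ∑ B ∈ blocksIn ℓ X, blockSq ℓ (fun x => ζ x) B)) *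
      excess t c₁ c₃ κ (γ * ℓ) (polymerClosure (γ * ℓ) X) Ψ η := by
  refine iSup_le fun φ => ?_
  refine le_trans ?_ (mul_le_mul_right (le_iSup _ φ) _)
  rw [← ENNReal.ofReal_mul (by positivity), ← Real.exp_add]
  refine ENNReal.ofReal_le_ofReal (Real.exp_le_exp.2 ?_)
  have h := energy_shift_le (t := t) hodd hγ hγ3 hN hX hc₁ hc₃ hc (shiftField 1 φ η) (fun x => ζ x)
  have h' := stepEnergy_le_energy (t := t) (X := X) hodd hγ hc₁.le c₃ (shiftField 1 φ η)
  rw [shiftField_one_add, mul_assoc, ← mul_add]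
  refine mul_le_mul_of_nonneg_left ?_ hκ
  linarith

end Excess

/-! ### Induction over the layers of the fluctuation field. -/

section Scales

variable {γ : ℕ} {Cov : ℕ → ℤ × ℤ → ℝ}

lemma torusCov_sum (N : ℕ) (s : Finset ℕ) (Cov : ℕ → ℤ × ℤ → ℝ) :
    torusCov N (fun x => ∑ h ∈ s, Cov h x) = ∑ h ∈ s, torusCov N (Cov h) := by
  ext x y
  simp [torusCov, Matrix.sum_apply]

lemma torusCov_sum_posSemidef (hFRD : IsFiniteRangeDecomposition γ Cov) {N : ℕ} [NeZero N]
    (hodd : Odd N) (s : Finset ℕ) (hN : ∀ h ∈ s, γ ^ (h + 1) ∣ N) :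
    (torusCov N (fun x => ∑ h ∈ s, Cov h x)).PosSemidef := by
  rw [torusCov_sum]
  exact Matrix.posSemidef_sum s fun h hh => torusCov_posSemidef_of_frd hFRD hodd (hN h hh)

/-- The exponential moment of the field regulator, uniformly in the field on the large scale. -/
lemma lintegral_excess_le (hFRD : IsFiniteRangeDecomposition γ Cov) (hγ : Odd γ) (hγ3 : 3 ≤ γ)
    {c₁ c₃ : ℝ} (hc₁ : 0 < c₁) (hc₃ : 0 < c₃) (hc : 200 * c₃ ≤ c₁) :
    ∃ A : ℝ, 0 < A ∧ ∀ (N : ℕ) [NeZero N] (t : Touch) (κ : ℝ), Odd N → 0 ≤ κ → κ * A ≤ 1 / 2 →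
      ∀ n h : ℕ, γ ^ (h + n + 1) ∣ N → ∀ X : Finset (Torus N), IsPolymer (γ ^ h) X →
      ∫⁻ ζ, excess t c₁ c₃ κ (γ ^ h) X
          (fun φ => stepEnergy t c₁ c₃ γ (γ ^ (h + n)) φ (polymerClosure (γ ^ (h + n)) X)) ζ
        ∂(gaussianField N fun x => ∑ k ∈ Finset.Ico h (h + n + 1), Cov k x) ≤
      ENNReal.ofReal (Real.exp (κ * A * (n + 1) * (blocksIn (γ ^ h) X).card)) := by
  obtain ⟨V, hV0, hV⟩ := lintegral_exp_blockSq_le hFRD hγ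
  have hs := stepCost_pos hc₁ hc₃
  refine ⟨stepCost c₁ c₃ * V, by positivity, ?_⟩
  intro N _ t κ hodd hκ hκV n
  have hstep : ∀ (h : ℕ) (X : Finset (Torus N)), γ ^ (h + 1) ∣ N →
      ∫⁻ ζ, ENNReal.ofReal (Real.exp (κ * stepCost c₁ c₃ *
        ∑ B ∈ blocksIn (γ ^ h) X, blockSq (γ ^ h) (fun x => ζ x) B)) ∂(gaussianField N (Cov h)) ≤
      ENNReal.ofReal (Real.exp (κ * (stepCost c₁ c₃ * V) * (blocksIn (γ ^ h) X).card)) := by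
    intro h X hN
    have := hV N h hodd hN X (κ * stepCost c₁ c₃) (by positivity) (by linarith)
    rwa [mul_assoc κ] at this
  induction n with
  | zero =>
    intro h hN X hX
    have hN' : γ * γ ^ h ∣ N := by rw [← pow_succ']; exact hN
    have hcl : polymerClosure (γ ^ (h + 0)) X = X :=
      (polymerClosure_subset hγ.pow (dvd_of_mul_left_dvd hN') hX subset_rfl).antisymm
        (subset_polymerClosure hγ.pow X)
    have hΓ : (fun x => ∑ k ∈ Finset.Ico h (h + 0 + 1), Cov k x) = Cov h := by
      ext x; simp
    rw [hcl, hΓ]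
    refine (lintegral_mono fun ζ =>
      excess_stepEnergy_le (t := t) hγ.pow hγ hγ3 hN' hX hc₁ hc₃ hc hκ ζ).trans ?_
    simpa using hstep h X hN
  | succ n ih =>
    intro h hN X hX
    have hNh : γ ^ (h + 1) ∣ N := (pow_dvd_pow γ (by omega)).trans hN
    have hN' : γ * γ ^ h ∣ N := by rw [← pow_succ']; exact hNh
    have hN'' : γ ^ (h + (n + 1)) ∣ N := (pow_dvd_pow γ (by omega)).trans hN
    -- The finest layer is split off as an independent field; it is the one handled by
    -- `excess_add_le`.
    have hΓ : gaussianField N (fun x => ∑ k ∈ Finset.Ico h (h + (n + 1) + 1), Cov k x) =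
        gaussianField N (Cov h) ∗
          gaussianField N (fun x => ∑ k ∈ Finset.Ico (h + 1) (h + 1 + n + 1), Cov k x) := by
      rw [gaussianField, gaussianField, gaussianField, multivariateGaussian_conv
        (torusCov_posSemidef_of_frd hFRD hodd hNh)
        (torusCov_sum_posSemidef hFRD hodd _ fun k hk =>
          (pow_dvd_pow γ (by have := Finset.mem_Ico.1 hk; omega)).trans hN)]
      congr 1
      rw [torusCov_sum, torusCov_sum, Finset.sum_eq_sum_Ico_succ_bot (by omega)]
      congr 3
      omega
    set Ψ : (Torus N → ℂ) → ℝ := fun φ => stepEnergy t c₁ c₃ γ (γ ^ (h + (n + 1))) φ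
      (polymerClosure (γ ^ (h + (n + 1))) X) with hΨ
    set X' := polymerClosure (γ * γ ^ h) X with hX'
    have hcl : polymerClosure (γ ^ (h + (n + 1))) X = polymerClosure (γ ^ (h + 1 + n)) X' := by
      have e : γ ^ (h + (n + 1)) = γ ^ n * (γ * γ ^ h) := by ring
      rw [hX', show γ ^ (h + 1 + n) = γ ^ n * (γ * γ ^ h) by ring, closure_closure
        (odd_coarse hγ.pow hγ) hγ.pow (e ▸ hN''), e]
    have hrec : ∫⁻ η, excess t c₁ c₃ κ (γ * γ ^ h) X' Ψ η
        ∂(gaussianField N fun x => ∑ k ∈ Finset.Ico (h + 1) (h + 1 + n + 1), Cov k x) ≤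
        ENNReal.ofReal (Real.exp (κ * (stepCost c₁ c₃ * V) * (n + 1) *
          (blocksIn (γ ^ h) X).card)) := by
      have := ih (h + 1) (by rwa [show h + 1 + n + 1 = h + (n + 1) + 1 by omega]) X'
        (by rw [pow_succ']; exact isPolymer_polymerClosure _ _)
      rw [show γ ^ (h + 1) = γ * γ ^ h by rw [pow_succ']] at this
      rw [hΨ, hcl, show γ ^ (h + (n + 1)) = γ ^ (h + 1 + n) by ring]
      -- The closure has no more blocks than X, so every layer costs at most the same factor.
      refine this.trans (ENNReal.ofReal_le_ofReal (Real.exp_le_exp.2 ?_))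
      refine mul_le_mul_of_nonneg_left ?_ (by positivity)
      exact_mod_cast card_blocksIn_closure_le hγ.pow hγ hN' hX
    rw [hΓ, Measure.lintegral_conv (measurable_excess _ _ _ _ _ _ _)]
    calc _ ≤ ∫⁻ ζ, ENNReal.ofReal (Real.exp (κ * stepCost c₁ c₃ *
            ∑ B ∈ blocksIn (γ ^ h) X, blockSq (γ ^ h) (fun x => ζ x) B)) *
          ENNReal.ofReal (Real.exp (κ * (stepCost c₁ c₃ * V) * (n + 1) *
            (blocksIn (γ ^ h) X).card)) ∂(gaussianField N (Cov h)) := by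
          refine lintegral_mono fun ζ => ?_
          refine (lintegral_mono fun η => excess_add_le (t := t) hγ.pow hγ hγ3 hN' hX hc₁ hc₃ hc
            hκ Ψ ζ η).trans ?_
          rw [lintegral_const_mul _ (measurable_excess _ _ _ _ _ _ _)]
          gcongr
      _ ≤ ENNReal.ofReal (Real.exp (κ * (stepCost c₁ c₃ * V) * (blocksIn (γ ^ h) X).card)) *
          ENNReal.ofReal (Real.exp (κ * (stepCost c₁ c₃ * V) * (n + 1) *
            (blocksIn (γ ^ h) X).card)) := by
          rw [lintegral_mul_const' _ _ ENNReal.ofReal_ne_top]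
          gcongr
          exact hstep h X hNh
      _ = _ := by
          rw [← ENNReal.ofReal_mul (by positivity), ← Real.exp_add]
          congr 2
          push_cast
          ring

end Scales

/-! ### The bounds of the expectation of the field regulator -/

lemma integrable_and_integral_le {Ω : Type*} [MeasurableSpace Ω] {μ : Measure Ω} {F : Ω → ℝ}
    {D : Ω → ENNReal} (hF : Measurable F) (hF0 : ∀ ω, 0 ≤ F ω) {a b : ℝ} (ha : 0 ≤ a) (hb : 0 ≤ b)
    (h : ∀ ω, ENNReal.ofReal (F ω) ≤ D ω * ENNReal.ofReal b)
    (hD : ∫⁻ ω, D ω ∂μ ≤ ENNReal.ofReal a) : Integrable F μ ∧ ∫ ω, F ω ∂μ ≤ a * b := by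
  have h1 : ∫⁻ ω, ENNReal.ofReal (F ω) ∂μ ≤ ENNReal.ofReal (a * b) := by
    refine (lintegral_mono h).trans ?_
    rw [lintegral_mul_const' _ _ ENNReal.ofReal_ne_top, ENNReal.ofReal_mul ha]
    gcongr
  refine ⟨⟨hF.aestronglyMeasurable, ?_⟩, ?_⟩
  · rw [hasFiniteIntegral_iff_ofReal (Filter.Eventually.of_forall hF0)]
    exact h1.trans_lt ENNReal.ofReal_lt_top
  · rw [integral_eq_lintegral_of_nonneg_ae (Filter.Eventually.of_forall hF0)
      hF.aestronglyMeasurable]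
    exact ENNReal.toReal_le_of_le_ofReal (by positivity) h1

lemma ofReal_ciSup_le {ι : Type*} [Nonempty ι] {f : ι → ℝ} {b : ENNReal}
    (h : ∀ i, ENNReal.ofReal (f i) ≤ b) : ENNReal.ofReal (⨆ i, f i) ≤ b := by
  by_cases hb : b = ⊤
  · simp [hb]
  · refine ENNReal.ofReal_le_of_le_toReal (ciSup_le fun i => ?_)
    exact (ENNReal.ofReal_le_iff_le_toReal hb).1 (h i)

section

variable {N : ℕ} [NeZero N]

lemma continuous_regulator {ℓ : ℕ} (hℓ : 0 < ℓ) (t : Touch) (c₁ c₃ κ : ℝ) (φ : Torus N → ℂ)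
    (X : Finset (Torus N)) : Continuous fun p : ℝ × EuclideanSpace ℝ (Torus N) =>
      regulator t c₁ c₃ κ ℓ (shiftField p.1 φ p.2) X := by
  simp only [regulator_eq hℓ]
  exact Real.continuous_exp.comp (continuous_const.mul
    ((continuous_energy t c₁ c₃ ℓ X).comp (continuous_shiftField φ)))

lemma measurable_iSup_regulator {ℓ : ℕ} (hℓ : 0 < ℓ) (t : Touch) (c₁ c₃ κ : ℝ) (φ : Torus N → ℂ)
    (X : Finset (Torus N)) : Measurable fun ζ : EuclideanSpace ℝ (Torus N) =>
      ⨆ s : Set.Icc (0 : ℝ) 1, regulator t c₁ c₃ κ ℓ (shiftField (s : ℝ) φ ζ) X := by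
  have h := continuous_regulator hℓ t c₁ c₃ κ φ X
  -- An unbounded real supremum would default to 0. Compactness of [0, 1] excludes this.
  have hbdd : ∀ ζ : EuclideanSpace ℝ (Torus N), BddAbove (Set.range fun s : Set.Icc (0 : ℝ) 1 =>
      regulator t c₁ c₃ κ ℓ (shiftField (s : ℝ) φ ζ) X) := by
    intro ζ
    have h1 : Continuous fun s : Set.Icc (0 : ℝ) 1 => ((s : ℝ), ζ) :=
      continuous_subtype_val.prodMk continuous_const
    exact (isCompact_range (h.comp h1)).bddAbove
  have hlsc : ∀ s : Set.Icc (0 : ℝ) 1, LowerSemicontinuous fun ζ : EuclideanSpace ℝ (Torus N) =>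
      regulator t c₁ c₃ κ ℓ (shiftField (s : ℝ) φ ζ) X := fun s =>
    (h.comp (Continuous.prodMk_right (s : ℝ))).lowerSemicontinuous
  exact (lowerSemicontinuous_ciSup hbdd hlsc).measurable

lemma ofReal_regulator_le {ℓ : ℕ} (hℓ : 0 < ℓ) (t : Touch) (c₁ c₃ κ : ℝ) (φ : Torus N → ℂ)
    (X : Finset (Torus N)) (Ψ : (Torus N → ℂ) → ℝ) (ζ : EuclideanSpace ℝ (Torus N)) :
    ENNReal.ofReal (regulator t c₁ c₃ κ ℓ (shiftField 1 φ ζ) X) ≤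
      excess t c₁ c₃ κ ℓ X Ψ ζ * ENNReal.ofReal (Real.exp (κ * Ψ φ)) := by
  refine le_trans (le_of_eq ?_) (mul_le_mul_left (le_iSup _ φ) _)
  rw [← ENNReal.ofReal_mul (by positivity), ← Real.exp_add, regulator_eq hℓ]
  congr 2
  ring

end

section

variable {γ : ℕ} {Cov : ℕ → ℤ × ℤ → ℝ}

/-- The expectation of the field regulator, for a field on the large scale that is multiplied by a
number in `[0, 1]`. -/
lemma integral_regulator_le (hFRD : IsFiniteRangeDecomposition γ Cov) (hγ : Odd γ) (hγ3 : 3 ≤ γ)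
    {c₁ c₃ : ℝ} (hc₁ : 0 < c₁) (hc₃ : 0 < c₃) (hc : 200 * c₃ ≤ c₁) :
    ∃ A : ℝ, 0 < A ∧ ∀ (N : ℕ) [NeZero N] (t : Touch) (κ : ℝ), Odd N → 0 ≤ κ → κ * A ≤ 1 / 2 →
      ∀ n h : ℕ, γ ^ (h + n + 1) ∣ N → ∀ X : Finset (Torus N), IsPolymer (γ ^ h) X →
      ∀ φ : Torus N → ℂ,
      (Integrable (fun ζ => regulator t c₁ c₃ κ (γ ^ h) (shiftField 1 φ ζ) X)
          (gaussianField N fun x => ∑ k ∈ Finset.Ico h (h + n + 1), Cov k x) ∧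
        ∫ ζ, regulator t c₁ c₃ κ (γ ^ h) (shiftField 1 φ ζ) X
          ∂(gaussianField N fun x => ∑ k ∈ Finset.Ico h (h + n + 1), Cov k x) ≤
        Real.exp (κ * A * (n + 1) * (blocksIn (γ ^ h) X).card) * Real.exp (κ *
          stepEnergy t c₁ c₃ γ (γ ^ (h + n)) φ (polymerClosure (γ ^ (h + n)) X))) ∧
      (Integrable (fun ζ => ⨆ s : Set.Icc (0 : ℝ) 1,
            regulator t c₁ c₃ κ (γ ^ h) (shiftField (s : ℝ) φ ζ) X)
          (gaussianField N fun x => ∑ k ∈ Finset.Ico h (h + n + 1), Cov k x) ∧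
        ∫ ζ, (⨆ s : Set.Icc (0 : ℝ) 1,
            regulator t c₁ c₃ κ (γ ^ h) (shiftField (s : ℝ) φ ζ) X)
          ∂(gaussianField N fun x => ∑ k ∈ Finset.Ico h (h + n + 1), Cov k x) ≤
        Real.exp (κ * A * (n + 1) * (blocksIn (γ ^ h) X).card) * Real.exp (κ *
          stepEnergy t c₁ c₃ γ (γ ^ (h + n)) φ (polymerClosure (γ ^ (h + n)) X))) := by
  obtain ⟨A, hA0, hA⟩ := lintegral_excess_le hFRD hγ hγ3 hc₁ hc₃ hc
  refine ⟨A, hA0, ?_⟩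
  intro N _ t κ hodd hκ hκA n h hN X hX φ
  have hD := hA N t κ hodd hκ hκA n h hN X hX
  have hpos : ∀ ψ : Torus N → ℂ, 0 ≤ regulator t c₁ c₃ κ (γ ^ h) ψ X := fun ψ =>
    (Real.exp_pos _).le
  have hγh : 0 < γ ^ h := pow_pos hγ.pos h
  constructor
  · refine integrable_and_integral_le ?_ (fun ζ => hpos _) (Real.exp_pos _).le (Real.exp_pos _).le
      (fun ζ => ofReal_regulator_le hγh t c₁ c₃ κ φ X _ ζ) hD
    exact ((continuous_regulator hγh t c₁ c₃ κ φ X).comp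
      (Continuous.prodMk_right (1 : ℝ))).measurable
  · refine integrable_and_integral_le (measurable_iSup_regulator hγh t c₁ c₃ κ φ X)
      (fun ζ => Real.iSup_nonneg fun s => hpos _) (Real.exp_pos _).le (Real.exp_pos _).le
      (fun ζ => ofReal_ciSup_le fun s => ?_) hD
    -- The field s φ is itself a background field, and `excess` is a supremum over all of them, so
    -- one random bound serves every s.
    have h1 : shiftField (s : ℝ) φ ζ = shiftField 1 (fun x => ((s : ℝ) : ℂ) * φ x) ζ := by
      ext x; simp [shiftField]
    rw [h1]
    refine (ofReal_regulator_le hγh t c₁ c₃ κ _ X (fun φ => stepEnergy t c₁ c₃ γ (γ ^ (h + n)) φ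
      (polymerClosure (γ ^ (h + n)) X)) ζ).trans ?_
    gcongr
    exact stepEnergy_smul_le hc₁.le hc₃.le (Nat.mul_pos hγ.pos (pow_pos hγ.pos _)) φ s.2.1 s.2.2

end

/-- A power of a norm of the field is controlled by the field regulator. -/
lemma one_add_pow_three_le {a κ κ₁ y : ℝ} (ha : 0 < a) (hκ : 0 < κ) (hκ₁ : κ ≤ κ₁) (hy : 0 ≤ y) :
    (1 + y) ^ 3 ≤ (1 + 4 * (√κ₁ ^ 3 + 1 + 2 / a ^ 2)) / κ ^ (3 / 2 : ℝ) *
      Real.exp (κ * (a * y ^ 2)) := by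
  have h1 : κ ^ (3 / 2 : ℝ) = √κ ^ 3 := by
    rw [Real.sqrt_eq_rpow, ← Real.rpow_natCast, ← Real.rpow_mul hκ.le]
    norm_num
  have hs : 0 < √κ := Real.sqrt_pos.2 hκ
  have hs2 : √κ ^ 2 = κ := Real.sq_sqrt hκ.le
  have hss : √κ ≤ √κ₁ := Real.sqrt_le_sqrt hκ₁
  rw [h1, div_mul_eq_mul_div, le_div_iff₀ (by positivity), ← mul_pow]
  -- In terms of w the factor κ^(3/2) (1 + y)³ becomes (√κ + w)³. The cube of w is at most 1 + w⁴,
  -- and w⁴ is bounded by the quadratic term of exp (a w²).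
  set w := √κ * y with hw
  have hw0 : 0 ≤ w := by positivity
  have h2 : κ * (a * y ^ 2) = a * w ^ 2 := by rw [hw, mul_pow, hs2]; ring
  rw [h2, show (1 + y) * √κ = √κ + w by rw [hw]; ring]
  have h3 := Real.quadratic_le_exp_of_nonneg (show 0 ≤ a * w ^ 2 by positivity)
  have h4 : (√κ + w) ^ 3 ≤ 4 * (√κ ^ 3 + w ^ 3) := by
    nlinarith [mul_nonneg (add_nonneg hs.le hw0) (sq_nonneg (√κ - w))]
  have h5 : √κ ^ 3 ≤ √κ₁ ^ 3 := pow_le_pow_left₀ hs.le hss 3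
  have h6 : w ^ 3 ≤ 1 + w ^ 4 := by
    rcases le_total w 1 with h | h
    · have := pow_le_one₀ hw0 h (n := 3)
      have : 0 ≤ w ^ 4 := by positivity
      linarith
    · have := pow_le_pow_right₀ h (show 3 ≤ 4 by norm_num)
      linarith
  have h7 : w ^ 4 ≤ 2 / a ^ 2 * Real.exp (a * w ^ 2) := by
    rw [div_mul_eq_mul_div, le_div_iff₀ (by positivity)]
    have : 0 ≤ a * w ^ 2 := by positivity
    nlinarith
  have h8 : 1 ≤ Real.exp (a * w ^ 2) := Real.one_le_exp (by positivity)
  have h9 : 0 ≤ √κ₁ ^ 3 := by positivity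
  nlinarith

section

variable {γ : ℕ} {N : ℕ} [NeZero N] {t : Touch} {X : Finset (Torus N)}

lemma exp_stepEnergy_le (hγ : Odd γ) {n h : ℕ} (hN : γ ^ (h + n + 1) ∣ N)
    {c₁ c₃ κ : ℝ} (hc₁ : 0 ≤ c₁) (hκ : 0 ≤ κ) (φ : Torus N → ℂ) :
    Real.exp (κ * stepEnergy t c₁ c₃ γ (γ ^ (h + n)) φ (polymerClosure (γ ^ (h + n)) X)) ≤
      regulator t c₁ c₃ κ (γ ^ (h + n + 1)) φ (polymerClosure (γ ^ (h + n + 1)) X) := by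
  have e : γ ^ (h + n + 1) = γ * γ ^ (h + n) := pow_succ' _ _
  rw [regulator_eq (pow_pos hγ.pos _), e, ← closure_closure hγ.pow hγ (e ▸ hN)]
  exact Real.exp_le_exp.2 (mul_le_mul_of_nonneg_left (stepEnergy_le_energy hγ.pow hγ hc₁ c₃ φ) hκ)

/-- Only the slack of the last step pays for the cube. It applies because the closure of a small
polymer on the scale γ^(h+n) still has at most four blocks. -/
lemma supNorm_mul_exp_stepEnergy_le (hγ : Odd γ) (hγ3 : 3 ≤ γ) {n h : ℕ}
    (hN : γ ^ (h + n + 1) ∣ N) (hX : IsSmallPolymer t (γ ^ h) X) {c₁ c₃ κ κ₁ : ℝ} (hc₁ : 0 < c₁)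
    (hκ : 0 < κ) (hκ₁ : κ ≤ κ₁) (φ : Torus N → ℂ) :
    (1 + max (supNorm 1 (γ ^ (h + n + 1)) φ (nbhd t (γ ^ h) X))
        (supNorm 2 (γ ^ (h + n + 1)) φ (nbhd t (γ ^ h) X))) ^ 3 *
      Real.exp (κ * stepEnergy t c₁ c₃ γ (γ ^ (h + n)) φ (polymerClosure (γ ^ (h + n)) X)) ≤
      (1 + 4 * (√κ₁ ^ 3 + 1 + 2 / (c₁ / 3136) ^ 2)) / κ ^ (3 / 2 : ℝ) *
        regulator t c₁ c₃ κ (γ ^ (h + n + 1)) φ (polymerClosure (γ ^ (h + n + 1)) X) := by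
  have e : γ ^ (h + n + 1) = γ * γ ^ (h + n) := pow_succ' _ _
  have e2 : γ ^ (h + n) = γ ^ n * γ ^ h := by rw [pow_add, mul_comm]
  have hNn : γ ^ n * γ ^ h ∣ N := e2 ▸ dvd_of_mul_left_dvd (e ▸ hN)
  have hcl := closure_closure (N := N) hγ.pow hγ (e ▸ hN) X
  have hcard : (blocksIn (γ ^ (h + n)) (polymerClosure (γ ^ (h + n)) X)).card ≤ 4 := by
    rw [e2]
    exact (card_blocksIn_closure_le hγ.pow hγ.pow hNn hX.1.1).trans hX.2
  have hY : nbhd t (γ ^ h) X ⊆ nbhd t (γ * γ ^ (h + n))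
      (polymerClosure (γ * γ ^ (h + n)) (polymerClosure (γ ^ (h + n)) X)) := by
    rw [hcl]
    have e3 : γ * γ ^ (h + n) = γ ^ (n + 1) * γ ^ h := by ring
    refine Finset.Subset.trans ?_ (nbhd_mono (subset_polymerClosure (odd_coarse hγ.pow hγ) X))
    rw [e3]
    exact nbhd_subset_coarse hγ.pow hγ.pow (e3 ▸ e ▸ hN) X
  have h1 := stepEnergy_add_le (t := t) hγ.pow hγ hγ3 (e ▸ hN) (isPolymer_polymerClosure _ _) hcard
    hY hc₁.le c₃ φ
  rw [hcl] at h1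
  rw [regulator_eq (pow_pos hγ.pos _), e]
  set y := max (supNorm 1 (γ * γ ^ (h + n)) φ (nbhd t (γ ^ h) X))
    (supNorm 2 (γ * γ ^ (h + n)) φ (nbhd t (γ ^ h) X)) with hy
  have hy0 : 0 ≤ y := (supNorm_nonneg _ _ _).trans (le_max_left _ _)
  refine (mul_le_mul_of_nonneg_right (one_add_pow_three_le (by positivity : 0 < c₁ / 3136) hκ hκ₁
    hy0) (Real.exp_pos _).le).trans ?_
  rw [mul_assoc, ← Real.exp_add]
  refine mul_le_mul_of_nonneg_left (Real.exp_le_exp.2 ?_) (by positivity)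
  rw [← mul_add]
  refine mul_le_mul_of_nonneg_left ?_ hκ.le
  linarith

end

/-! ### Polynomial approximations of the resolvent -/

section Polynomials

open Polynomial

/-- The Dirichlet kernel `1 + 2 ∑_{j ≤ k} cos j θ`, as a polynomial in `cos θ`. -/
noncomputable def dirichlet (k : ℕ) : ℝ[X] :=
  1 + ∑ j ∈ Finset.range k, 2 * Chebyshev.T ℝ ((j : ℤ) + 1)

/-- The Fejér kernel `(1 - cos n θ) / (1 - cos θ)`, as a polynomial in `cos θ`. -/
noncomputable def fejer (n : ℕ) : ℝ[X] := ∑ k ∈ Finset.range n, dirichlet k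

/-- The polynomial `(n ^ 2 - fejer n) / (1 - X)`. -/
noncomputable def defect (n : ℕ) : ℝ[X] :=
  ∑ k ∈ Finset.range n, ∑ j ∈ Finset.range k, 2 * fejer (j + 1)

lemma one_sub_X_mul_dirichlet (k : ℕ) :
    (1 - X) * dirichlet k = Chebyshev.T ℝ k - Chebyshev.T ℝ ((k : ℤ) + 1) := by
  induction k with
  | zero => simp [dirichlet]
  | succ k ih =>
    have h1 : dirichlet (k + 1) = dirichlet k + 2 * Chebyshev.T ℝ ((k : ℤ) + 1) := by
      rw [dirichlet, Finset.sum_range_succ, ← add_assoc, dirichlet]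
    have h2 := Chebyshev.T_add_two ℝ (k : ℤ)
    rw [h1, mul_add, ih]
    push_cast
    rw [show (k : ℤ) + 1 + 1 = k + 2 by ring, h2]
    ring

lemma one_sub_X_mul_fejer (n : ℕ) : (1 - X) * fejer n = 1 - Chebyshev.T ℝ n := by
  induction n with
  | zero => simp [fejer]
  | succ n ih =>
    rw [fejer, Finset.sum_range_succ, mul_add, ← fejer, ih, one_sub_X_mul_dirichlet]
    push_cast
    ring

/-- By the Fejér identity, (1 - X) · 2 `fejer (j + 1)` is 2 - 2 T_{j+1}. Summing over j < k gives 2k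
+ 1 minus the Dirichlet kernel, and summing over k < n gives n² minus the Fejér kernel. -/
lemma one_sub_X_mul_defect (n : ℕ) : (1 - X) * defect n = (n : ℝ[X]) ^ 2 - fejer n := by
  have h1 : ∀ k : ℕ, (1 - X) * ∑ j ∈ Finset.range k, 2 * fejer (j + 1) =
      2 * (k : ℝ[X]) + 1 - dirichlet k := by
    intro k
    induction k with
    | zero => simp [dirichlet]
    | succ k ih =>
      have h2 := one_sub_X_mul_fejer (k + 1)
      rw [Finset.sum_range_succ, mul_add, ih, dirichlet, dirichlet, Finset.sum_range_succ]
      push_cast at h2 ⊢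
      linear_combination 2 * h2
  induction n with
  | zero => simp [defect, fejer]
  | succ n ih =>
    rw [defect, Finset.sum_range_succ, mul_add, ← defect, ih, h1, fejer, fejer,
      Finset.sum_range_succ]
    push_cast
    ring

lemma natDegree_T_le (n : ℕ) : (Chebyshev.T ℝ n).natDegree ≤ n := by
  simp

lemma natDegree_fejer_le (n : ℕ) : (fejer n).natDegree ≤ n := by
  refine natDegree_sum_le_of_forall_le _ _ fun k hk => ?_
  refine (natDegree_add_le _ _).trans (max_le (by simp) ?_)
  refine natDegree_sum_le_of_forall_le _ _ fun j hj => ?_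
  have h1 := natDegree_T_le (j + 1)
  have h2 := Finset.mem_range.1 hk
  have h3 := Finset.mem_range.1 hj
  refine natDegree_mul_le.trans ?_
  rw [show (2 : ℝ[X]) = ((2 : ℕ) : ℝ[X]) by norm_num, natDegree_natCast]
  push_cast at h1
  omega

lemma natDegree_defect_le (n : ℕ) : (defect n).natDegree ≤ n := by
  refine natDegree_sum_le_of_forall_le _ _ fun k hk => ?_
  refine natDegree_sum_le_of_forall_le _ _ fun j hj => ?_
  have h1 := natDegree_fejer_le (j + 1)
  have h2 := Finset.mem_range.1 hk
  have h3 := Finset.mem_range.1 hj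
  refine natDegree_mul_le.trans ?_
  rw [show (2 : ℝ[X]) = ((2 : ℕ) : ℝ[X]) by norm_num, natDegree_natCast]
  omega

variable {u : ℝ}

lemma eval_fejer_mul (n : ℕ) (u : ℝ) :
    (1 - u) * (fejer n).eval u = 1 - (Chebyshev.T ℝ n).eval u := by
  have := congrArg (eval u) (one_sub_X_mul_fejer n)
  simpa using this

lemma eval_defect_mul (n : ℕ) (u : ℝ) :
    (1 - u) * (defect n).eval u = (n : ℝ) ^ 2 - (fejer n).eval u := by
  have := congrArg (eval u) (one_sub_X_mul_defect n)
  simpa using this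

lemma eval_fejer_le (hu : |u| ≤ 1) (n : ℕ) : (fejer n).eval u ≤ (n : ℝ) ^ 2 := by
  have h1 : ∀ k : ℕ, (dirichlet k).eval u ≤ 2 * k + 1 := by
    intro k
    rw [dirichlet, eval_add, eval_finsetSum, eval_one]
    have : ∑ j ∈ Finset.range k, (2 * Chebyshev.T ℝ ((j : ℤ) + 1)).eval u ≤
        ∑ j ∈ Finset.range k, (2 : ℝ) := by
      refine Finset.sum_le_sum fun j _ => ?_
      have := (abs_le.1 (Chebyshev.abs_eval_T_real_le_one ((j : ℤ) + 1) hu)).2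
      simp only [eval_mul, eval_ofNat]
      linarith
    simp at this ⊢
    linarith
  induction n with
  | zero => simp [fejer]
  | succ n ih =>
    rw [fejer, Finset.sum_range_succ, eval_add, ← fejer]
    have := h1 n
    push_cast
    linarith

lemma eval_fejer_nonneg (hu : |u| ≤ 1) (n : ℕ) : 0 ≤ (fejer n).eval u := by
  rcases eq_or_lt_of_le (abs_le.1 hu).2 with h | h
  · subst h
    have h1 : ∀ k : ℕ, 0 ≤ (dirichlet k).eval (1 : ℝ) := by
      intro k
      rw [dirichlet, eval_add, eval_finsetSum, eval_one]
      have : 0 ≤ ∑ j ∈ Finset.range k, (2 * Chebyshev.T ℝ ((j : ℤ) + 1)).eval (1 : ℝ) :=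
        Finset.sum_nonneg fun j _ => by simp
      linarith
    rw [fejer, eval_finsetSum]
    exact Finset.sum_nonneg fun k _ => h1 k
  · have h1 := eval_fejer_mul n u
    have h2 := (abs_le.1 (Chebyshev.abs_eval_T_real_le_one (n : ℤ) hu)).2
    exact nonneg_of_mul_nonneg_right (by linarith : 0 ≤ (1 - u) * (fejer n).eval u) (by linarith)

lemma eval_fejer_mul_le (hu : |u| ≤ 1) (n : ℕ) : (1 - u) * (fejer n).eval u ≤ 2 := by
  have h1 := eval_fejer_mul n u
  have h2 := (abs_le.1 (Chebyshev.abs_eval_T_real_le_one (n : ℤ) hu)).1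
  linarith

lemma eval_defect_nonneg (hu : |u| ≤ 1) (n : ℕ) : 0 ≤ (defect n).eval u := by
  rw [defect, eval_finsetSum]
  refine Finset.sum_nonneg fun k _ => ?_
  rw [eval_finsetSum]
  refine Finset.sum_nonneg fun j _ => ?_
  have := eval_fejer_nonneg hu (j + 1)
  simp only [eval_mul, eval_ofNat]
  linarith

lemma eval_defect_le (hu : |u| ≤ 1) (n : ℕ) : (defect n).eval u ≤ 2 * (n : ℝ) ^ 4 := by
  have h1 : ∀ k ∈ Finset.range n, ∀ j ∈ Finset.range k,
      (2 * fejer (j + 1)).eval u ≤ 2 * (n : ℝ) ^ 2 := by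
    intro k hk j hj
    have h2 := Finset.mem_range.1 hk
    have h3 := Finset.mem_range.1 hj
    have h4 := eval_fejer_le hu (j + 1)
    have h5 : (((j + 1 : ℕ) : ℝ)) ^ 2 ≤ (n : ℝ) ^ 2 := by
      gcongr; omega
    simp only [eval_mul, eval_ofNat]
    linarith
  have h2 : ∀ k ∈ Finset.range n, (∑ j ∈ Finset.range k, 2 * fejer (j + 1)).eval u ≤
      n * (2 * (n : ℝ) ^ 2) := by
    intro k hk
    rw [eval_finsetSum]
    refine (Finset.sum_le_card_nsmul _ _ _ (h1 k hk)).trans ?_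
    rw [Finset.card_range, nsmul_eq_mul]
    have : (k : ℝ) ≤ n := by exact_mod_cast (Finset.mem_range.1 hk).le
    gcongr
  rw [defect, eval_finsetSum]
  refine (Finset.sum_le_card_nsmul _ _ _ h2).trans ?_
  rw [Finset.card_range, nsmul_eq_mul]
  exact le_of_eq (by ring)

/-- A low pass filter on the scale `γ ^ h`. -/
noncomputable def lowPass (γ h : ℕ) : ℝ[X] :=
  ∏ k ∈ Finset.range h, C (((γ : ℝ) ^ (2 * k))⁻¹) * fejer (γ ^ k)

/-- The part of the resolvent on the scale `γ ^ h`. -/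
noncomputable def slice (γ h : ℕ) : ℝ[X] :=
  C ((4 * (γ : ℝ) ^ (2 * h))⁻¹) * (lowPass γ h * defect (γ ^ h))

variable {γ : ℕ}

lemma lowPass_zero : lowPass γ 0 = 1 := by simp [lowPass]

lemma eval_lowPass_succ (h : ℕ) (u : ℝ) : (lowPass γ (h + 1)).eval u =
    (lowPass γ h).eval u * (((γ : ℝ) ^ (2 * h))⁻¹ * (fejer (γ ^ h)).eval u) := by
  simp [lowPass, Finset.prod_range_succ]

lemma eval_slice (h : ℕ) (u : ℝ) : (slice γ h).eval u =
    (4 * (γ : ℝ) ^ (2 * h))⁻¹ * ((lowPass γ h).eval u * (defect (γ ^ h)).eval u) := by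
  simp [slice]

/-- The telescoping identity behind the decomposition: each slice is a difference of successive
filters, divided by the symbol of the Laplacian. -/
lemma slice_mul (hγ : 0 < γ) (h : ℕ) (u : ℝ) : 4 * (1 - u) * (slice γ h).eval u =
    (lowPass γ h).eval u - (lowPass γ (h + 1)).eval u := by
  have h1 := eval_defect_mul (γ ^ h) u
  have h2 : (0 : ℝ) < (γ : ℝ) ^ (2 * h) := by positivity
  rw [eval_slice, eval_lowPass_succ]
  push_cast at h1
  rw [← pow_mul, mul_comm h 2] at h1
  field_simp
  linear_combination (lowPass γ h).eval u * h1

/-- The degrees form a geometric series of ratio γ ≥ 3, whose sum is at most half of the next term.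
-/
lemma natDegree_lowPass_le (hγ3 : 3 ≤ γ) (h : ℕ) : 2 * (lowPass γ h).natDegree ≤ γ ^ h := by
  induction h with
  | zero => simp [lowPass]
  | succ h ih =>
    rw [lowPass, Finset.prod_range_succ, ← lowPass]
    have h1 := natDegree_mul_le (p := lowPass γ h)
      (q := C (((γ : ℝ) ^ (2 * h))⁻¹) * fejer (γ ^ h))
    have h2 := natDegree_C_mul_le (((γ : ℝ) ^ (2 * h))⁻¹) (fejer (γ ^ h))
    have h3 := natDegree_fejer_le (γ ^ h)
    have h4 : 3 * γ ^ h ≤ γ ^ (h + 1) := by rw [pow_succ']; gcongr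
    omega

lemma natDegree_slice_le (hγ3 : 3 ≤ γ) (h : ℕ) : 2 * (slice γ h).natDegree ≤ γ ^ (h + 1) := by
  have h1 := natDegree_C_mul_le ((4 * (γ : ℝ) ^ (2 * h))⁻¹) (lowPass γ h * defect (γ ^ h))
  have h2 := natDegree_mul_le (p := lowPass γ h) (q := defect (γ ^ h))
  have h3 := natDegree_lowPass_le hγ3 h
  have h5 := natDegree_defect_le (γ ^ h)
  have h4 : 3 * γ ^ h ≤ γ ^ (h + 1) := by rw [pow_succ']; gcongr
  rw [slice]
  omega

lemma lowPass_factor_mem (hγ : 0 < γ) (hu : |u| ≤ 1) (h : ℕ) :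
    0 ≤ ((γ : ℝ) ^ (2 * h))⁻¹ * (fejer (γ ^ h)).eval u ∧
      ((γ : ℝ) ^ (2 * h))⁻¹ * (fejer (γ ^ h)).eval u ≤ 1 := by
  have h2 : (0 : ℝ) < (γ : ℝ) ^ (2 * h) := by positivity
  have h3 := eval_fejer_le hu (γ ^ h)
  push_cast at h3
  rw [← pow_mul, mul_comm h 2] at h3
  refine ⟨mul_nonneg (by positivity) (eval_fejer_nonneg hu _), ?_⟩
  rw [inv_mul_le_iff₀ h2]
  linarith

lemma eval_lowPass_mem (hγ : 0 < γ) (hu : |u| ≤ 1) (h : ℕ) :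
    0 ≤ (lowPass γ h).eval u ∧ (lowPass γ h).eval u ≤ 1 := by
  induction h with
  | zero => simp [lowPass]
  | succ h ih =>
    have h1 := lowPass_factor_mem hγ hu h
    rw [eval_lowPass_succ]
    exact ⟨mul_nonneg ih.1 h1.1, mul_le_one₀ ih.2 h1.1 h1.2⟩

lemma eval_slice_nonneg (hγ : 0 < γ) (hu : |u| ≤ 1) (h : ℕ) : 0 ≤ (slice γ h).eval u := by
  rw [eval_slice]
  have := (eval_lowPass_mem hγ hu h).1
  have := eval_defect_nonneg hu (γ ^ h)
  positivity

lemma eval_slice_le (hγ : 0 < γ) (hu : |u| ≤ 1) (h : ℕ) :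
    (slice γ h).eval u ≤ (γ : ℝ) ^ (2 * h) * (lowPass γ h).eval u := by
  have h0 : (0 : ℝ) < (γ : ℝ) ^ (2 * h) := by positivity
  have h1 := (eval_lowPass_mem hγ hu h).1
  have h2 := eval_defect_le hu (γ ^ h)
  have h3 : ((γ ^ h : ℕ) : ℝ) ^ 4 = ((γ : ℝ) ^ (2 * h)) ^ 2 := by push_cast; ring
  rw [h3] at h2
  rw [eval_slice, inv_mul_le_iff₀ (by positivity)]
  have h4 := mul_le_mul_of_nonneg_left h2 h1
  have h5 : 0 ≤ (lowPass γ h).eval u * ((γ : ℝ) ^ (2 * h)) ^ 2 := by positivity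
  nlinarith

/-- The low pass filters decay faster than any power. -/
lemma exists_lowPass_decay (hγ : 0 < γ) (m : ℕ) : ∃ B : ℝ, 0 ≤ B ∧ ∀ (h : ℕ) (u : ℝ), |u| ≤ 1 →
    ((γ : ℝ) ^ (2 * h) * (4 * (1 - u))) ^ m * (lowPass γ h).eval u ≤ B := by
  induction m with
  | zero => exact ⟨1, by norm_num, fun h u hu => by simpa using (eval_lowPass_mem hγ hu h).2⟩
  | succ m ih =>
    obtain ⟨B, hB0, hB⟩ := ih
    refine ⟨8 ^ (m + 1) + (γ : ℝ) ^ (2 * (m + 1)) * (B * 8), by positivity, fun h u hu => ?_⟩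
    have hu1 : 0 ≤ 1 - u := by linarith [(abs_le.1 hu).2]
    have hpos : 0 ≤ (γ : ℝ) ^ (2 * (m + 1)) * (B * 8) := by positivity
    rcases h with _ | h
    · have h1 : 4 * (1 - u) ≤ 8 := by linarith [(abs_le.1 hu).1]
      have h2 := pow_le_pow_left₀ (by linarith : 0 ≤ 4 * (1 - u)) h1 (m + 1)
      simp only [lowPass_zero, mul_zero, pow_zero, one_mul, eval_one, mul_one]
      linarith
    · have h0 : (0 : ℝ) < (γ : ℝ) ^ (2 * h) := by positivity
      have h1 := hB h u hu
      -- The newest Fejér factor absorbs one power of 1 - u by itself. The other m powers are left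
      -- to the preceding filter and the induction hypothesis, and changing h to h + 1 costs a fixed
      -- power of γ.
      have h2 : ((γ : ℝ) ^ (2 * h) * (4 * (1 - u))) *
          (((γ : ℝ) ^ (2 * h))⁻¹ * (fejer (γ ^ h)).eval u) ≤ 8 := by
        have := eval_fejer_mul_le hu (γ ^ h)
        rw [show ((γ : ℝ) ^ (2 * h) * (4 * (1 - u))) *
          (((γ : ℝ) ^ (2 * h))⁻¹ * (fejer (γ ^ h)).eval u) =
          4 * ((1 - u) * (fejer (γ ^ h)).eval u) by field_simp]
        linarith
      have h3 := mul_le_mul h1 h2 (mul_nonneg (by positivity) (lowPass_factor_mem hγ hu h).1) hB0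
      have h4 := mul_le_mul_of_nonneg_left h3
        (show (0 : ℝ) ≤ (γ : ℝ) ^ (2 * (m + 1)) by positivity)
      rw [eval_lowPass_succ]
      have h5 : (0 : ℝ) ≤ 8 ^ (m + 1) := by positivity
      refine le_trans (le_of_eq ?_) (h4.trans (by linarith))
      rw [show (γ : ℝ) ^ (2 * (h + 1)) * (4 * (1 - u)) =
        (γ : ℝ) ^ 2 * ((γ : ℝ) ^ (2 * h) * (4 * (1 - u))) by ring, mul_pow, ← pow_mul]
      ring

lemma tendsto_lowPass (hγ : 2 ≤ γ) (hu : |u| ≤ 1) (hu1 : u < 1) :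
    Filter.Tendsto (fun h => (lowPass γ h).eval u) Filter.atTop (nhds 0) := by
  obtain ⟨B, hB0, hB⟩ := exists_lowPass_decay (show 0 < γ by omega) 1
  have hγ1 : (1 : ℝ) < γ := by exact_mod_cast (by omega : 1 < γ)
  have h0 : 0 < 4 * (1 - u) := by linarith
  have h1 : Filter.Tendsto (fun h : ℕ => B / (4 * (1 - u)) * (((γ : ℝ) ^ 2)⁻¹) ^ h) Filter.atTop
      (nhds 0) := by
    rw [← mul_zero (B / (4 * (1 - u)))]
    refine (tendsto_pow_atTop_nhds_zero_of_lt_one (by positivity) ?_).const_mul _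
    exact inv_lt_one_of_one_lt₀ (one_lt_pow₀ hγ1 (by norm_num))
  refine squeeze_zero (fun h => (eval_lowPass_mem (by omega) hu h).1) (fun h => ?_) h1
  have h2 := hB h u hu
  have h3 : (0 : ℝ) < (γ : ℝ) ^ (2 * h) := by positivity
  rw [inv_pow, ← pow_mul, ← div_eq_mul_inv, div_div, le_div_iff₀ (by positivity)]
  linarith

/-- `1 - cos n x` is at most `n ^ 2 (1 - cos x)`. -/
lemma one_sub_cos_nat_mul_le (n : ℕ) (x : ℝ) :
    1 - Real.cos (n * x) ≤ (n : ℝ) ^ 2 * (1 - Real.cos x) := by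
  have h1 := eval_fejer_mul n (Real.cos x)
  have h2 := eval_fejer_le (Real.abs_cos_le_one x) n
  rw [show (Chebyshev.T ℝ (n : ℤ)).eval (Real.cos x) = Real.cos (n * x) by
    simp] at h1
  rw [← h1, mul_comm]
  exact mul_le_mul_of_nonneg_right h2 (by linarith [Real.cos_le_one x])

end Polynomials

/-! ### Existence of finite range decompositions -/

section Fourier

open Polynomial

/-- The Brillouin zone. -/
def zone : Set (ℝ × ℝ) := Set.Icc (-Real.pi) Real.pi ×ˢ Set.Icc (-Real.pi) Real.pi

/-- The Fourier multiplier of the average over the nearest neighbours. -/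
noncomputable def symbol (p : ℝ × ℝ) : ℝ := (Real.cos p.1 + Real.cos p.2) / 2

/-- The phase `p · x`. -/
def phase (x : ℤ × ℤ) (p : ℝ × ℝ) : ℝ := p.1 * x.1 + p.2 * x.2

/-- The translation invariant kernel of a polynomial of the average over the nearest neighbours. -/
noncomputable def kernel (P : ℝ[X]) (x : ℤ × ℤ) : ℝ :=
  ((2 * Real.pi) ^ 2)⁻¹ * ∫ p in zone, Real.cos (phase x p) * P.eval (symbol p)

lemma abs_symbol_le (p : ℝ × ℝ) : |symbol p| ≤ 1 := by
  have h1 := abs_le.1 (Real.abs_cos_le_one p.1)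
  have h2 := abs_le.1 (Real.abs_cos_le_one p.2)
  rw [symbol, abs_le]
  constructor <;> linarith [h1.1, h1.2, h2.1, h2.2]

@[fun_prop]
lemma continuous_symbol : Continuous symbol := by unfold symbol; fun_prop

@[fun_prop]
lemma continuous_phase (x : ℤ × ℤ) : Continuous (phase x) := by unfold phase; fun_prop

@[fun_prop]
lemma continuous_eval_symbol (P : ℝ[X]) : Continuous fun p => P.eval (symbol p) :=
  P.continuous.comp continuous_symbol

lemma phase_add (x y : ℤ × ℤ) (p : ℝ × ℝ) : phase (x + y) p = phase x p + phase y p := by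
  simp only [phase, Prod.fst_add, Prod.snd_add]; push_cast; ring

lemma phase_sub (x y : ℤ × ℤ) (p : ℝ × ℝ) : phase (x - y) p = phase x p - phase y p := by
  simp only [phase, Prod.fst_sub, Prod.snd_sub]; push_cast; ring

lemma phase_zero (p : ℝ × ℝ) : phase 0 p = 0 := by simp [phase]

lemma isCompact_zone : IsCompact zone := isCompact_Icc.prod isCompact_Icc

lemma measurableSet_zone : MeasurableSet zone := measurableSet_Icc.prod measurableSet_Icc

lemma integrableOn_zone {f : ℝ × ℝ → ℝ} (hf : Continuous f) : IntegrableOn f zone :=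
  hf.continuousOn.integrableOn_compact isCompact_zone

lemma integral_zone_mul (f g : ℝ → ℝ) : ∫ p in zone, f p.1 * g p.2 =
    (∫ t in Set.Icc (-Real.pi) Real.pi, f t) * ∫ t in Set.Icc (-Real.pi) Real.pi, g t :=
  setIntegral_prod_mul f g _ _

lemma integral_sin_zone (n : ℤ) : ∫ t in Set.Icc (-Real.pi) Real.pi, Real.sin (t * n) = 0 := by
  rw [integral_Icc_eq_integral_Ioc, ← intervalIntegral.integral_of_le (by linarith [Real.pi_pos])]
  rcases eq_or_ne (n : ℝ) 0 with h | h
  · simp [h]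
  · rw [intervalIntegral.integral_comp_mul_right _ h, integral_sin]
    simp

lemma integral_cos_zone {n : ℤ} (hn : n ≠ 0) :
    ∫ t in Set.Icc (-Real.pi) Real.pi, Real.cos (t * n) = 0 := by
  have h : (n : ℝ) ≠ 0 := by exact_mod_cast hn
  rw [integral_Icc_eq_integral_Ioc, ← intervalIntegral.integral_of_le (by linarith [Real.pi_pos]),
    intervalIntegral.integral_comp_mul_right _ h, integral_cos]
  rw [neg_mul, Real.sin_neg, mul_comm, Real.sin_int_mul_pi]
  simp

/-- Multiplication by the symbol averages the kernel over nearest neighbours, so each power enlarges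
its range by one site. -/
lemma integral_cos_phase_mul_pow (k : ℕ) (x : ℤ × ℤ) (hx : (k : ℤ) < max |x.1| |x.2|) :
    ∫ p in zone, Real.cos (phase x p) * symbol p ^ k = 0 := by
  induction k generalizing x with
  | zero =>
    have h1 : ∀ p : ℝ × ℝ, Real.cos (phase x p) * symbol p ^ 0 =
        Real.cos (p.1 * x.1) * Real.cos (p.2 * x.2) -
          Real.sin (p.1 * x.1) * Real.sin (p.2 * x.2) := by
      intro p; rw [phase, Real.cos_add, pow_zero, mul_one]
    simp only [h1]
    rw [integral_sub (integrableOn_zone (by fun_prop)) (integrableOn_zone (by fun_prop)),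
      integral_zone_mul (fun t => Real.cos (t * x.1)) (fun t => Real.cos (t * x.2)),
      integral_zone_mul (fun t => Real.sin (t * x.1)) (fun t => Real.sin (t * x.2)),
      integral_sin_zone, zero_mul, sub_zero]
    rcases lt_max_iff.1 hx with h | h
    · rw [integral_cos_zone (abs_pos.1 (by simpa using h)), zero_mul]
    · rw [integral_cos_zone (n := x.2) (abs_pos.1 (by simpa using h)), mul_zero]
  | succ k ih =>
    have h1 : ∀ p : ℝ × ℝ, Real.cos (phase x p) * symbol p ^ (k + 1) =
        1 / 4 * ∑ μ : Fin 4, Real.cos (phase (x + dir μ) p) * symbol p ^ k := by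
      intro p
      have h2 : ∀ a b : ℝ, Real.cos (a + b) + Real.cos (a + -b) = 2 * Real.cos a * Real.cos b := by
        intro a b; rw [Real.cos_add, Real.cos_add, Real.cos_neg, Real.sin_neg]; ring
      have e0 : phase (dir 0) p = p.1 := by simp [phase, dir]
      have e1 : phase (dir 1) p = p.2 := by simp [phase, dir]
      have e2 : phase (dir 2) p = -p.1 := by simp [phase, dir]
      have e3 : phase (dir 3) p = -p.2 := by simp [phase, dir]
      have h3 := h2 (phase x p) p.1
      have h4 := h2 (phase x p) p.2
      simp only [Fin.sum_univ_four, phase_add, e0, e1, e2, e3]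
      rw [pow_succ]
      nth_rewrite 2 [symbol]
      linear_combination (-(1 / 4) * symbol p ^ k) * (h3 + h4)
    simp only [h1]
    rw [integral_const_mul, integral_finsetSum _ fun μ _ => integrableOn_zone (by fun_prop)]
    rw [Finset.sum_eq_zero fun μ _ => ih (x + dir μ) ?_, mul_zero]
    obtain ⟨hd1, hd2⟩ := abs_le_one_of_mem_unitVectors (dir_mem_unitVectors .maximum μ)
    push_cast at hx
    rw [lt_max_iff] at hx ⊢
    simp only [Prod.fst_add, Prod.snd_add]
    have a1 := abs_sub_abs_le_abs_sub x.1 (-(dir μ).1)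
    have a2 := abs_sub_abs_le_abs_sub x.2 (-(dir μ).2)
    rw [abs_neg, sub_neg_eq_add] at a1 a2
    omega

lemma kernel_eq_zero (P : ℝ[X]) {x : ℤ × ℤ} (hx : (P.natDegree : ℤ) < max |x.1| |x.2|) :
    kernel P x = 0 := by
  have h1 : ∀ p, Real.cos (phase x p) * P.eval (symbol p) =
      ∑ k ∈ Finset.range (P.natDegree + 1),
        P.coeff k * (Real.cos (phase x p) * symbol p ^ k) := by
    intro p
    rw [eval_eq_sum_range, Finset.mul_sum]
    exact Finset.sum_congr rfl fun k _ => by ring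
  rw [kernel]
  simp only [h1]
  rw [integral_finsetSum _ fun k _ => integrableOn_zone (by fun_prop),
    Finset.sum_eq_zero fun k hk => ?_, mul_zero]
  have := Finset.mem_range.1 hk
  rw [integral_const_mul, integral_cos_phase_mul_pow k x (by omega), mul_zero]

/-- The easy direction of Bochner's theorem: the quadratic form is the integral of |∑ a_x e^{ip·x}|²
against a nonnegative multiplier. -/
lemma kernel_posSemidef (P : ℝ[X]) (hP : ∀ u, |u| ≤ 1 → 0 ≤ P.eval u) :
    (Matrix.of fun x y : ℤ × ℤ => kernel P (x - y)).PosSemidef := by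
  refine ⟨?_, fun a => ?_⟩
  · ext x y
    simp only [Matrix.conjTranspose_apply, Matrix.of_apply, star_trivial, kernel, phase_sub]
    congr 2
    ext p
    rw [← Real.cos_neg, neg_sub]
  · have h1 : (a.sum fun x ax => a.sum fun y ay =>
        star ax * (Matrix.of fun x y : ℤ × ℤ => kernel P (x - y)) x y * ay) =
        ((2 * Real.pi) ^ 2)⁻¹ * ∫ p in zone, ((∑ x ∈ a.support, a x * Real.cos (phase x p)) ^ 2 +
          (∑ x ∈ a.support, a x * Real.sin (phase x p)) ^ 2) * P.eval (symbol p) := by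
      have h2 : ∀ p, ((∑ x ∈ a.support, a x * Real.cos (phase x p)) ^ 2 +
          (∑ x ∈ a.support, a x * Real.sin (phase x p)) ^ 2) * P.eval (symbol p) =
          ∑ x ∈ a.support, ∑ y ∈ a.support,
            a x * a y * (Real.cos (phase (x - y) p) * P.eval (symbol p)) := by
        intro p
        rw [sq, sq, Finset.sum_mul_sum, Finset.sum_mul_sum, ← Finset.sum_add_distrib,
          Finset.sum_mul]
        refine Finset.sum_congr rfl fun x _ => ?_
        rw [← Finset.sum_add_distrib, Finset.sum_mul]
        refine Finset.sum_congr rfl fun y _ => ?_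
        rw [phase_sub, Real.cos_sub]
        ring
      simp only [h2]
      rw [integral_finsetSum _ fun x _ => integrableOn_zone (by fun_prop), Finsupp.sum,
        Finset.mul_sum]
      refine Finset.sum_congr rfl fun x _ => ?_
      rw [integral_finsetSum _ fun y _ => integrableOn_zone (by fun_prop), Finsupp.sum,
        Finset.mul_sum]
      refine Finset.sum_congr rfl fun y _ => ?_
      rw [integral_const_mul, Matrix.of_apply, star_trivial, kernel]
      ring
    rw [h1]
    refine mul_nonneg (by positivity) (integral_nonneg fun p => ?_)
    exact mul_nonneg (by positivity) (hP _ (abs_symbol_le p))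

lemma diff_kernel (P : ℝ[X]) (l : List (ℤ × ℤ)) (x : ℤ × ℤ) :
    (Continuous fun p => l.foldr diff (fun y => Real.cos (phase y p)) x) ∧
    l.foldr diff (kernel P) x = ((2 * Real.pi) ^ 2)⁻¹ *
      ∫ p in zone, l.foldr diff (fun y => Real.cos (phase y p)) x * P.eval (symbol p) := by
  induction l generalizing x with
  | nil => exact ⟨by simp only [List.foldr_nil]; fun_prop, rfl⟩
  | cons v l ih =>
    simp only [List.foldr_cons, diff]
    have h1 := (ih (x + v)).1
    have h2 := (ih x).1
    refine ⟨h1.sub h2, ?_⟩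
    rw [(ih (x + v)).2, (ih x).2, ← mul_sub, ← integral_sub (integrableOn_zone (by fun_prop))
      (integrableOn_zone (by fun_prop))]
    simp only [sub_mul]

/-- In the basis of cosine and sine, a derivative in direction ν acts as a multiplier of the form
e^{iα} - 1. Its squared modulus 2 - 2 cos α is at most 4 (1 - symbol). -/
lemma diff_cos_phase (p : ℝ × ℝ) (l : List (Fin 4)) : ∃ a b : ℝ,
    a ^ 2 + b ^ 2 ≤ (4 * (1 - symbol p)) ^ l.length ∧
    (l.map dir).foldr diff (fun y => Real.cos (phase y p)) =
      fun y => a * Real.cos (phase y p) + b * Real.sin (phase y p) := by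
  induction l with
  | nil => exact ⟨1, 0, by simp, by simp⟩
  | cons ν l ih =>
    obtain ⟨a, b, hab, h⟩ := ih
    set α := phase (dir ν) p with hα
    refine ⟨a * (Real.cos α - 1) + b * Real.sin α, -(a * Real.sin α) + b * (Real.cos α - 1),
      ?_, ?_⟩
    · have h1 : 2 - 2 * Real.cos α ≤ 4 * (1 - symbol p) := by
        have c1 := Real.cos_le_one p.1
        have c2 := Real.cos_le_one p.2
        rw [hα, symbol]
        fin_cases ν <;> simp [phase, dir] <;> linarith
      have h2 : 0 ≤ 2 - 2 * Real.cos α := by linarith [Real.cos_le_one α]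
      have h3 := Real.sin_sq_add_cos_sq α
      rw [List.length_cons, pow_succ]
      have h4 := mul_le_mul hab h1 h2 ((by positivity : 0 ≤ a ^ 2 + b ^ 2).trans hab)
      refine le_trans (le_of_eq ?_) h4
      linear_combination (a ^ 2 + b ^ 2) * h3
    · rw [List.map_cons, List.foldr_cons, h]
      ext y
      simp only [diff, phase_add, Real.cos_add, Real.sin_add, ← hα]
      ring

lemma abs_diff_cos_phase_le (p : ℝ × ℝ) (l : List (Fin 4)) (x : ℤ × ℤ) :
    |(l.map dir).foldr diff (fun y => Real.cos (phase y p)) x| ≤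
      √(4 * (1 - symbol p)) ^ l.length := by
  obtain ⟨a, b, hab, h⟩ := diff_cos_phase p l
  have h0 : 0 ≤ 4 * (1 - symbol p) := by linarith [(abs_le.1 (abs_symbol_le p)).2]
  rw [h]
  refine abs_le_of_sq_le_sq ?_ (by positivity)
  rw [← pow_mul, mul_comm l.length, pow_mul, Real.sq_sqrt h0]
  refine le_trans ?_ hab
  have h3 := Real.sin_sq_add_cos_sq (phase x p)
  nlinarith [sq_nonneg (a * Real.sin (phase x p) - b * Real.cos (phase x p))]

/-- The quadratic lower bound for 1 - cos and (1 + s²)(1 + t²) ≤ (1 + s² + t²)² dominate the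
integrand by a product of two Cauchy densities, each with total integral a π / b = π² / 2,
independent of a. -/
lemma integral_zone_decay_le {a : ℝ} (ha : 0 < a) :
    ∫ p in zone, a ^ 2 / (1 + a ^ 2 * (4 * (1 - symbol p))) ^ 2 ≤ (Real.pi ^ 2 / 2) ^ 2 := by
  set b := 2 * a / Real.pi with hb
  have hπ := Real.pi_pos
  have hb0 : 0 < b := by positivity
  have h0 : ∀ p, 0 ≤ 1 - symbol p := fun p => by linarith [(abs_le.1 (abs_symbol_le p)).2]
  have h1 : ∀ p ∈ zone, a ^ 2 / (1 + a ^ 2 * (4 * (1 - symbol p))) ^ 2 ≤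
      (a * (1 + (b * p.1) ^ 2)⁻¹) * (a * (1 + (b * p.2) ^ 2)⁻¹) := by
    rintro ⟨s, t⟩ ⟨hs, ht⟩
    have c1 := Real.cos_le_one_sub_mul_cos_sq (abs_le.2 hs)
    have c2 := Real.cos_le_one_sub_mul_cos_sq (abs_le.2 ht)
    simp only at c1 c2
    have h2 : (b * s) ^ 2 + (b * t) ^ 2 ≤ a ^ 2 * (4 * (1 - symbol (s, t))) := by
      have : (b * s) ^ 2 + (b * t) ^ 2 =
          a ^ 2 * (2 * (2 / Real.pi ^ 2 * s ^ 2 + 2 / Real.pi ^ 2 * t ^ 2)) := by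
        rw [hb]; field_simp
      rw [this]
      refine mul_le_mul_of_nonneg_left ?_ (by positivity)
      simp only [symbol]
      linarith
    have h3 : (1 + (b * s) ^ 2) * (1 + (b * t) ^ 2) ≤
        (1 + a ^ 2 * (4 * (1 - symbol (s, t)))) ^ 2 := by
      have h4 : 0 ≤ (b * s) ^ 2 := sq_nonneg _
      have h5 : 0 ≤ (b * t) ^ 2 := sq_nonneg _
      have h6 : (1 + ((b * s) ^ 2 + (b * t) ^ 2)) ^ 2 ≤
          (1 + a ^ 2 * (4 * (1 - symbol (s, t)))) ^ 2 := by gcongr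
      nlinarith
    calc a ^ 2 / (1 + a ^ 2 * (4 * (1 - symbol (s, t)))) ^ 2
        ≤ a ^ 2 / ((1 + (b * s) ^ 2) * (1 + (b * t) ^ 2)) := by gcongr
      _ = _ := by field_simp
  have hden : ∀ p, (1 + a ^ 2 * (4 * (1 - symbol p))) ^ 2 ≠ 0 := by
    intro p
    have := h0 p
    positivity
  have hden' : ∀ t : ℝ, 1 + (b * t) ^ 2 ≠ 0 := fun t => by positivity
  refine (setIntegral_mono_on (integrableOn_zone (Continuous.div (by fun_prop) (by fun_prop) hden))
    (integrableOn_zone ?_) measurableSet_zone h1).trans ?_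
  · refine Continuous.mul (continuous_const.mul (Continuous.inv₀ (by fun_prop) fun p => hden' _))
      (continuous_const.mul (Continuous.inv₀ (by fun_prop) fun p => hden' _))
  · rw [integral_zone_mul (fun t => a * (1 + (b * t) ^ 2)⁻¹) (fun t => a * (1 + (b * t) ^ 2)⁻¹),
      ← sq]
    have hint : Integrable fun t : ℝ => a * (1 + (b * t) ^ 2)⁻¹ :=
      (integrable_inv_one_add_sq.comp_mul_left' hb0.ne').const_mul a
    have h2 : ∫ t : ℝ, a * (1 + (b * t) ^ 2)⁻¹ = Real.pi ^ 2 / 2 := by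
      rw [integral_const_mul, Measure.integral_comp_mul_left (fun t : ℝ => (1 + t ^ 2)⁻¹) b,
        integral_univ_inv_one_add_sq, abs_of_pos (by positivity), hb, smul_eq_mul]
      field_simp
    have hnn : ∀ t : ℝ, 0 ≤ a * (1 + (b * t) ^ 2)⁻¹ := fun t => by positivity
    rw [← h2]
    refine pow_le_pow_left₀ (integral_nonneg fun t => hnn t) ?_ 2
    exact setIntegral_le_integral hint (Filter.Eventually.of_forall hnn)

variable {γ : ℕ}

/-- Put a = γ^h and w = 4 a² (1 - symbol). The n derivatives give at most (√w / a)^n and the slice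
at most a² times the filter. Decay of order n + 2 absorbs w^(n/2) and leaves a² / (1 + w)², whose
integral is bounded uniformly in a. -/
lemma exists_kernel_slice_derivBound (hγ : 0 < γ) (n : ℕ) : ∃ K : ℝ, ∀ (h : ℕ) (x : ℤ × ℤ)
    (μ : Fin n → Fin 4),
    |diffs (fun i => dir (μ i)) (kernel (slice γ h)) x| ≤ K / (γ : ℝ) ^ (h * n) := by
  obtain ⟨B, hB0, hB⟩ := exists_lowPass_decay hγ (n + 2)
  refine ⟨((2 * Real.pi) ^ 2)⁻¹ * (2 ^ (n + 2) * (1 + B) * (Real.pi ^ 2 / 2) ^ 2), ?_⟩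
  intro h x μ
  have hγ' : (0 : ℝ) < γ := by exact_mod_cast hγ
  set a : ℝ := (γ : ℝ) ^ h with ha
  have ha0 : 0 < a := by positivity
  have ha2 : (γ : ℝ) ^ (2 * h) = a ^ 2 := by rw [ha]; ring
  have ha3 : (γ : ℝ) ^ (h * n) = a ^ n := by rw [ha]; ring
  have e : List.ofFn (fun i => dir (μ i)) = (List.ofFn μ).map dir := (List.map_ofFn).symm
  rw [diffs, e, (diff_kernel (slice γ h) _ x).2, abs_mul, abs_of_nonneg (by positivity),
    ha3, mul_div_assoc]
  refine mul_le_mul_of_nonneg_left ?_ (by positivity)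
  have h0 : ∀ p, 0 ≤ 4 * (1 - symbol p) := fun p => by
    linarith [(abs_le.1 (abs_symbol_le p)).2]
  have hpt : ∀ p, |((List.ofFn μ).map dir).foldr diff (fun y => Real.cos (phase y p)) x *
      (slice γ h).eval (symbol p)| ≤ 2 ^ (n + 2) * (1 + B) / a ^ n *
        (a ^ 2 / (1 + a ^ 2 * (4 * (1 - symbol p))) ^ 2) := by
    intro p
    have h1 := abs_diff_cos_phase_le p (List.ofFn μ) x
    rw [List.length_ofFn] at h1
    have h2 := eval_slice_nonneg hγ (abs_symbol_le p) h
    have h3 := eval_slice_le hγ (abs_symbol_le p) h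
    have h4 := eval_lowPass_mem hγ (abs_symbol_le p) h
    have h5 := hB h (symbol p) (abs_symbol_le p)
    rw [ha2] at h3 h5
    set F := (lowPass γ h).eval (symbol p) with hF
    set w := a ^ 2 * (4 * (1 - symbol p)) with hw
    have hw0 : 0 ≤ w := mul_nonneg (by positivity) (h0 p)
    have h6 : √(4 * (1 - symbol p)) * a ≤ 1 + w := by
      have h7 : √(4 * (1 - symbol p)) * a = √w := by
        rw [hw, Real.sqrt_mul (sq_nonneg a), Real.sqrt_sq ha0.le, mul_comm]
      rw [h7]
      refine Real.sqrt_le_iff.2 ⟨by linarith, by nlinarith⟩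
    have h7 : (1 + w) ^ (n + 2) * F ≤ 2 ^ (n + 2) * (1 + B) := by
      have h8 : (1 + w) ^ (n + 2) ≤ 2 ^ (n + 2) * (1 + w ^ (n + 2)) := by
        rcases le_total w 1 with hw1 | hw1
        · have : (1 + w) ^ (n + 2) ≤ 2 ^ (n + 2) :=
            pow_le_pow_left₀ (by linarith) (by linarith) _
          have h9 : (0 : ℝ) ≤ 2 ^ (n + 2) * w ^ (n + 2) := by positivity
          linarith
        · have : (1 + w) ^ (n + 2) ≤ (2 * w) ^ (n + 2) :=
            pow_le_pow_left₀ (by linarith) (by linarith) _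
          rw [mul_pow] at this
          have h9 : (0 : ℝ) ≤ 2 ^ (n + 2) := by positivity
          linarith
      calc (1 + w) ^ (n + 2) * F ≤ 2 ^ (n + 2) * (1 + w ^ (n + 2)) * F := by
            gcongr; exact h4.1
        _ = 2 ^ (n + 2) * (F + w ^ (n + 2) * F) := by ring
        _ ≤ 2 ^ (n + 2) * (1 + B) := by gcongr; exact h4.2
    rw [abs_mul, abs_of_nonneg h2, div_mul_div_comm, le_div_iff₀ (by positivity)]
    calc |((List.ofFn μ).map dir).foldr diff (fun y => Real.cos (phase y p)) x| *
          (slice γ h).eval (symbol p) * (a ^ n * (1 + w) ^ 2)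
        ≤ √(4 * (1 - symbol p)) ^ n * (a ^ 2 * F) * (a ^ n * (1 + w) ^ 2) := by gcongr
      _ = (√(4 * (1 - symbol p)) * a) ^ n * (1 + w) ^ 2 * F * a ^ 2 := by ring
      _ ≤ (1 + w) ^ n * (1 + w) ^ 2 * F * a ^ 2 := by
          gcongr; exact h4.1
      _ = (1 + w) ^ (n + 2) * F * a ^ 2 := by ring
      _ ≤ _ := by gcongr
  have hden : ∀ p, (1 + a ^ 2 * (4 * (1 - symbol p))) ^ 2 ≠ 0 := by
    intro p
    have := h0 p
    positivity
  have hcont : Continuous fun p => 2 ^ (n + 2) * (1 + B) / a ^ n *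
      (a ^ 2 / (1 + a ^ 2 * (4 * (1 - symbol p))) ^ 2) :=
    continuous_const.mul (Continuous.div (by fun_prop) (by fun_prop) hden)
  rw [← Real.norm_eq_abs]
  refine (norm_integral_le_of_norm_le (integrableOn_zone hcont)
    (Filter.Eventually.of_forall hpt)).trans ?_
  rw [integral_const_mul, div_mul_eq_mul_div]
  gcongr
  exact integral_zone_decay_le ha0

lemma one_sub_cos_add_le (a b : ℝ) :
    1 - Real.cos (a + b) ≤ 2 * (1 - Real.cos a) + 2 * (1 - Real.cos b) := by
  rw [Real.cos_add]
  nlinarith [sq_nonneg (Real.cos a + Real.cos b - 2), sq_nonneg (Real.sin b - Real.sin a),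
    Real.sin_sq_add_cos_sq a, Real.sin_sq_add_cos_sq b]

lemma one_sub_cos_int_mul_le (n : ℤ) (t : ℝ) :
    1 - Real.cos (t * n) ≤ (n : ℝ) ^ 2 * (1 - Real.cos t) := by
  have h := one_sub_cos_nat_mul_le n.natAbs t
  have h1 : ((n.natAbs : ℕ) : ℝ) = |(n : ℝ)| := by
    rw [Nat.cast_natAbs, Int.cast_abs]
  rw [h1, sq_abs] at h
  have h2 : Real.cos (|(n : ℝ)| * t) = Real.cos (t * n) := by
    rcases abs_choice (n : ℝ) with h3 | h3 <;> rw [h3]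
    · rw [mul_comm]
    · rw [neg_mul, Real.cos_neg, mul_comm]
  rwa [h2] at h

/-- This bounds the Coulomb integrand near p = 0 and provides the constant that dominates the
partial sums. -/
lemma one_sub_cos_phase_le (x : ℤ × ℤ) (p : ℝ × ℝ) :
    1 - Real.cos (phase x p) ≤
      ((x.1 : ℝ) ^ 2 + (x.2 : ℝ) ^ 2) * (4 * (1 - symbol p)) := by
  have h1 := one_sub_cos_add_le (p.1 * x.1) (p.2 * x.2)
  have h2 := one_sub_cos_int_mul_le x.1 p.1
  have h3 := one_sub_cos_int_mul_le x.2 p.2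
  have h4 := mul_nonneg (sq_nonneg (x.1 : ℝ)) (sub_nonneg.2 (Real.cos_le_one p.2))
  have h5 := mul_nonneg (sq_nonneg (x.2 : ℝ)) (sub_nonneg.2 (Real.cos_le_one p.1))
  rw [phase, symbol]
  linarith

lemma kernel_sub_kernel_zero (P : ℝ[X]) (x : ℤ × ℤ) : kernel P x - kernel P 0 =
    ((2 * Real.pi) ^ 2)⁻¹ * ∫ p in zone, (Real.cos (phase x p) - 1) * P.eval (symbol p) := by
  rw [kernel, kernel, ← mul_sub, ← integral_sub (integrableOn_zone (by fun_prop))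
    (integrableOn_zone (by fun_prop))]
  simp only [phase_zero, Real.cos_zero, sub_mul]

lemma coulomb_eq (x : ℤ × ℤ) : coulomb x = ((2 * Real.pi) ^ 2)⁻¹ *
    ∫ p in zone, (Real.cos (phase x p) - 1) / (4 * (1 - symbol p)) := by
  rw [coulomb, zone]
  congr 2
  ext p
  rw [phase, symbol]
  congr 1
  ring

lemma sum_slice (hγ : 0 < γ) (H : ℕ) (u : ℝ) :
    4 * (1 - u) * ∑ h ∈ Finset.range H, (slice γ h).eval u = 1 - (lowPass γ H).eval u := by
  induction H with
  | zero => simp [lowPass_zero]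
  | succ H ih =>
    rw [Finset.sum_range_succ, mul_add, ih, slice_mul hγ]
    ring

lemma hasSum_kernel_slice (hγ : 2 ≤ γ) (x : ℤ × ℤ) :
    HasSum (fun h => kernel (slice γ h) x - kernel (slice γ h) 0) (coulomb x) := by
  have hγ0 : 0 < γ := by omega
  -- The terms have a constant sign, so convergence of the partial sums already gives `HasSum`.
  have hnonneg : ∀ h, 0 ≤ -(kernel (slice γ h) x - kernel (slice γ h) 0) := by
    intro h
    rw [kernel_sub_kernel_zero, ← mul_neg, ← integral_neg]
    refine mul_nonneg (by positivity) (integral_nonneg fun p => ?_)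
    have h1 := eval_slice_nonneg hγ0 (abs_symbol_le p) h
    have h2 := Real.cos_le_one (phase x p)
    change 0 ≤ -((Real.cos (phase x p) - 1) * (slice γ h).eval (symbol p))
    nlinarith
  have key : Filter.Tendsto (fun H => ∑ h ∈ Finset.range H,
      (kernel (slice γ h) x - kernel (slice γ h) 0)) Filter.atTop (nhds (coulomb x)) := by
    set g : ℝ × ℝ → ℝ := fun p => (Real.cos (phase x p) - 1) / (4 * (1 - symbol p)) with hg
    -- Where the symbol equals one, the Coulomb integrand is 0 / 0, which Lean evaluates to 0. The
    -- numerator vanishes there, so the identities for the partial sums still hold.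
    have hzero : ∀ p, ¬ symbol p < 1 → Real.cos (phase x p) - 1 = 0 := by
      intro p hp
      have h1 : symbol p = 1 := le_antisymm (abs_le.1 (abs_symbol_le p)).2 (not_lt.1 hp)
      have h2 := one_sub_cos_phase_le x p
      rw [h1] at h2
      linarith [Real.cos_le_one (phase x p)]
    have hsum : ∀ H, ∑ h ∈ Finset.range H, (kernel (slice γ h) x - kernel (slice γ h) 0) =
        ((2 * Real.pi) ^ 2)⁻¹ * ∫ p in zone, g p * (1 - (lowPass γ H).eval (symbol p)) := by
      intro H
      simp only [kernel_sub_kernel_zero]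
      rw [← Finset.mul_sum, ← integral_finsetSum _ fun h _ => integrableOn_zone (by fun_prop)]
      congr 2
      ext p
      rw [← Finset.mul_sum, hg]
      by_cases hp : symbol p < 1
      · have h1 : 1 - symbol p ≠ 0 := by linarith
        rw [← sum_slice hγ0]
        field_simp
      · simp only [hzero p hp]; simp
    simp only [hsum]
    rw [coulomb_eq]
    refine Filter.Tendsto.const_mul _ ?_
    refine tendsto_integral_of_dominated_convergence
      (fun _ => (x.1 : ℝ) ^ 2 + (x.2 : ℝ) ^ 2) (fun H => ?_) ?_ (fun H => ?_) ?_
    · refine Measurable.aestronglyMeasurable ?_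
      have h1 : Measurable fun p => (lowPass γ H).eval (symbol p) :=
        (continuous_eval_symbol _).measurable
      have h2 : Measurable symbol := continuous_symbol.measurable
      have h3 : Measurable (phase x) := (continuous_phase x).measurable
      fun_prop
    · exact integrableOn_zone continuous_const
    · refine Filter.Eventually.of_forall fun p => ?_
      have h1 := eval_lowPass_mem hγ0 (abs_symbol_le p) H
      have h0 : 0 ≤ 4 * (1 - symbol p) := by linarith [(abs_le.1 (abs_symbol_le p)).2]
      have h2 : ‖g p‖ ≤ (x.1 : ℝ) ^ 2 + (x.2 : ℝ) ^ 2 := by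
        rw [hg, norm_div, Real.norm_of_nonneg h0, ← norm_neg, neg_sub,
          Real.norm_of_nonneg (by linarith [Real.cos_le_one (phase x p)])]
        exact div_le_of_le_mul₀ h0 (by positivity) (one_sub_cos_phase_le x p)
      rw [norm_mul, Real.norm_of_nonneg (by linarith : 0 ≤ 1 - (lowPass γ H).eval (symbol p))]
      have := norm_nonneg (g p)
      nlinarith
    · refine Filter.Eventually.of_forall fun p => ?_
      by_cases hp : symbol p < 1
      · have h1 := (tendsto_lowPass hγ (abs_symbol_le p) hp).const_sub 1
        simpa using h1.const_mul (g p)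
      · have h1 : g p = 0 := by rw [hg]; simp only [hzero p hp]; simp
        change Filter.Tendsto _ _ (nhds (g p))
        simp [h1]
  have h1 : HasSum (fun h => -(kernel (slice γ h) x - kernel (slice γ h) 0)) (-coulomb x) := by
    rw [hasSum_iff_tendsto_nat_of_nonneg hnonneg]
    simpa only [Finset.sum_neg_distrib] using key.neg
  simpa using h1.neg

theorem exists_finiteRangeDecomposition (hγ3 : 3 ≤ γ) :
    ∃ Cov : ℕ → ℤ × ℤ → ℝ, IsFiniteRangeDecomposition γ Cov := by
  have hγ0 : 0 < γ := by omega
  refine ⟨fun h => kernel (slice γ h), fun h => ?_, fun h x hx => ?_,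
    exists_kernel_slice_derivBound hγ0, hasSum_kernel_slice (by omega)⟩
  · exact kernel_posSemidef _ fun u hu => eval_slice_nonneg hγ0 hu h
  · refine kernel_eq_zero _ ?_
    have := natDegree_slice_le hγ3 h
    have h1 : 2 * ((slice γ h).natDegree : ℤ) ≤ (γ : ℤ) ^ (h + 1) := by exact_mod_cast this
    linarith

end Fourier

end CoulombGas

/-! ### The theorem: choice of the constants. -/

theorem mainTheorem8 :
    ∃ r : ℝ, 0 < r ∧ ∀ c₁ c₃ : ℝ, 0 < c₁ → 0 < c₃ → c₃ ≤ r * c₁ →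
    ∃ γ₀ : ℕ, ∀ γ : ℕ, γ₀ ≤ γ → Odd γ →
      (∃ Cov : ℕ → ℤ × ℤ → ℝ, IsFiniteRangeDecomposition γ Cov) ∧
      ∀ Cov : ℕ → ℤ × ℤ → ℝ, IsFiniteRangeDecomposition γ Cov →
      ∃ c₀ C : ℝ, 0 < c₀ ∧ 1 < C ∧
      ∀ c : ℝ, 0 < c → c ≤ c₀ →
      ∀ (M L : ℕ) [NeZero L], 1 ≤ M → L = γ ^ M →
      ∀ κ : ℝ, κ = c / Real.log L →
      ∀ R j : ℕ, j < R →
        (torusCov (L ^ R) (scaleCov Cov M j)).PosSemidef ∧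
        ∀ (t : Touch) (φ' : Torus (L ^ R) → ℂ) (X : Finset (Torus (L ^ R))),
          (IsConnectedPolymer t (L ^ j) X →
            Integrable (fun ζ => regulator t c₁ c₃ κ (L ^ j) (shiftField 1 φ' ζ) X)
              (gaussianField (L ^ R) (scaleCov Cov M j)) ∧
            ∫ ζ, regulator t c₁ c₃ κ (L ^ j) (shiftField 1 φ' ζ) X
                ∂(gaussianField (L ^ R) (scaleCov Cov M j))
              ≤ 2 ^ (blocksIn (L ^ j) X).card *
                regulator t c₁ c₃ κ (L ^ (j + 1)) φ' (polymerClosure (L ^ (j + 1)) X)) ∧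
          (IsSmallPolymer t (L ^ j) X →
            (1 + max (supNorm 1 (L ^ (j + 1)) φ' (nbhd t (L ^ j) X))
                  (supNorm 2 (L ^ (j + 1)) φ' (nbhd t (L ^ j) X))) ^ 3 *
              ∫ ζ, regulator t c₁ c₃ κ (L ^ j) (shiftField 1 φ' ζ) X
                ∂(gaussianField (L ^ R) (scaleCov Cov M j))
              ≤ C * (2 ^ (blocksIn (L ^ j) X).card / κ ^ (3 / 2 : ℝ)) *
                regulator t c₁ c₃ κ (L ^ (j + 1)) φ' (polymerClosure (L ^ (j + 1)) X)) ∧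
          (IsSmallPolymer t (L ^ j) X →
            Integrable (fun ζ => ⨆ s : Set.Icc (0 : ℝ) 1,
                regulator t c₁ c₃ κ (L ^ j) (shiftField (s : ℝ) φ' ζ) X)
              (gaussianField (L ^ R) (scaleCov Cov M j)) ∧
            (1 + max (supNorm 1 (L ^ (j + 1)) φ' (nbhd t (L ^ j) X))
                  (supNorm 2 (L ^ (j + 1)) φ' (nbhd t (L ^ j) X))) ^ 3 *
              ∫ ζ, (⨆ s : Set.Icc (0 : ℝ) 1,
                  regulator t c₁ c₃ κ (L ^ j) (shiftField (s : ℝ) φ' ζ) X)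
                ∂(gaussianField (L ^ R) (scaleCov Cov M j))
              ≤ C * (2 ^ (blocksIn (L ^ j) X).card / κ ^ (3 / 2 : ℝ)) *
                regulator t c₁ c₃ κ (L ^ (j + 1)) φ' (polymerClosure (L ^ (j + 1)) X)) := by 
  refine ⟨1 / 200, by norm_num, fun c₁ c₃ hc₁ hc₃ hc => ⟨3, fun γ hγ3 hγ =>
    ⟨exists_finiteRangeDecomposition hγ3, fun Cov hFRD => ?_⟩⟩⟩
  obtain ⟨A, hA0, hA⟩ := integral_regulator_le hFRD hγ hγ3 hc₁ hc₃ (by linarith)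
  have hγ1 : (1 : ℝ) < γ := by exact_mod_cast (by omega : 1 < γ)
  have hlog : 0 < Real.log γ := Real.log_pos hγ1
  -- This c₀ makes κ A M = A c / ln γ at most 1/2. In particular κ ≤ 1 / (2A), which makes the
  -- constant C independent of M.
  refine ⟨Real.log γ / (2 * A), 1 + 4 * (√(1 / (2 * A)) ^ 3 + 1 + 2 / (c₁ / 3136) ^ 2),
    by positivity, ?_, ?_⟩
  · have : 0 < 4 * (√(1 / (2 * A)) ^ 3 + 1 + 2 / (c₁ / 3136) ^ 2) := by positivity
    linarith
  intro c hc0 hcc M L _ hM hL κ hκ R j hj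
  subst hL
  obtain ⟨n, rfl⟩ : ∃ n, M = n + 1 := ⟨M - 1, by omega⟩
  set h := j * (n + 1) with hh
  -- As ln L = M ln γ, the factor 1 / ln L in κ cancels the number M = n + 1 of layers.
  have hκe : κ * (n + 1) = c / Real.log γ := by
    rw [hκ]; push_cast; rw [Real.log_pow]; push_cast; field_simp
  have hcA : c / Real.log γ * A ≤ 1 / 2 := by
    rw [div_mul_eq_mul_div, div_le_iff₀ hlog]
    rw [le_div_iff₀ (by positivity)] at hcc
    linarith
  have hn1 : (1 : ℝ) ≤ (n : ℝ) + 1 := by linarith [(Nat.cast_nonneg n : (0 : ℝ) ≤ n)]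
  have hκ0 : 0 < κ := by
    have : 0 < κ * (n + 1) := by rw [hκe]; positivity
    exact pos_of_mul_pos_left this (by linarith)
  have hκA1 : κ * A * (n + 1) ≤ 1 / 2 := by
    rw [mul_right_comm, hκe]; exact hcA
  have hκA : κ * A ≤ 1 / 2 := by
    have : κ * A * 1 ≤ κ * A * (n + 1) := by gcongr
    linarith
  have hκ₁ : κ ≤ 1 / (2 * A) := by
    rw [le_div_iff₀ (by positivity)]; linarith
  have hodd : Odd ((γ ^ (n + 1)) ^ R) := hγ.pow.pow
  have hN : γ ^ (h + n + 1) ∣ (γ ^ (n + 1)) ^ R := by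
    rw [← pow_mul]
    refine pow_dvd_pow γ ?_
    calc h + n + 1 = (n + 1) * (j + 1) := by rw [hh]; ring
      _ ≤ (n + 1) * R := Nat.mul_le_mul_left _ hj
  have hLj : (γ ^ (n + 1)) ^ j = γ ^ h := by rw [← pow_mul, hh, mul_comm]
  have hLj1 : (γ ^ (n + 1)) ^ (j + 1) = γ ^ (h + n + 1) := by
    rw [← pow_mul, hh]; congr 1; ring
  have hΓ : scaleCov Cov (n + 1) j = fun x => ∑ k ∈ Finset.Ico h (h + n + 1), Cov k x := by
    ext x
    rw [scaleCov, hh]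
    congr 2
    ring
  -- Each block costs at most exp (1/2), which is less than 2.
  have h2 : ∀ m : ℕ, Real.exp (κ * A * (n + 1) * m) ≤ 2 ^ m := by
    intro m
    rw [mul_comm, Real.exp_nat_mul]
    refine pow_le_pow_left₀ (Real.exp_pos _).le ?_ m
    refine (Real.exp_le_exp.2 hκA1).trans ?_
    have := Real.exp_one_lt_d9
    have h3 : Real.exp (1 / 2) ^ 2 = Real.exp 1 := by
      rw [← Real.exp_nat_mul]; norm_num
    nlinarith [Real.exp_pos (1 / 2)]
  rw [hLj, hLj1, hΓ]
  refine ⟨torusCov_sum_posSemidef hFRD hodd _ fun k hk =>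
    (pow_dvd_pow γ (by have := Finset.mem_Ico.1 hk; omega)).trans hN, fun t φ' X => ?_⟩
  have key := fun hX => hA _ t κ hodd hκ0.le hκA n h hN X hX φ'
  have hb : ∀ {I : ℝ}, IsSmallPolymer t (γ ^ h) X →
      I ≤ Real.exp (κ * A * (n + 1) * (blocksIn (γ ^ h) X).card) * Real.exp (κ *
        stepEnergy t c₁ c₃ γ (γ ^ (h + n)) φ' (polymerClosure (γ ^ (h + n)) X)) →
      (1 + max (supNorm 1 (γ ^ (h + n + 1)) φ' (nbhd t (γ ^ h) X))
        (supNorm 2 (γ ^ (h + n + 1)) φ' (nbhd t (γ ^ h) X))) ^ 3 * I ≤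
      (1 + 4 * (√(1 / (2 * A)) ^ 3 + 1 + 2 / (c₁ / 3136) ^ 2)) *
        (2 ^ (blocksIn (γ ^ h) X).card / κ ^ (3 / 2 : ℝ)) *
        regulator t c₁ c₃ κ (γ ^ (h + n + 1)) φ' (polymerClosure (γ ^ (h + n + 1)) X) := by
    intro I hX hI
    have h3 := supNorm_mul_exp_stepEnergy_le (c₃ := c₃) hγ hγ3 hN hX hc₁ hκ0 hκ₁ φ'
    set y := 1 + max (supNorm 1 (γ ^ (h + n + 1)) φ' (nbhd t (γ ^ h) X))
        (supNorm 2 (γ ^ (h + n + 1)) φ' (nbhd t (γ ^ h) X)) with hy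
    have hy0 : 0 ≤ y := by
      have := (supNorm_nonneg (ℓ := γ ^ (h + n + 1)) 1 φ' (nbhd t (γ ^ h) X)).trans
        (le_max_left _ (supNorm 2 (γ ^ (h + n + 1)) φ' (nbhd t (γ ^ h) X)))
      linarith
    calc y ^ 3 * I ≤ y ^ 3 * (Real.exp (κ * A * (n + 1) * (blocksIn (γ ^ h) X).card) *
          Real.exp (κ * stepEnergy t c₁ c₃ γ (γ ^ (h + n)) φ'
            (polymerClosure (γ ^ (h + n)) X))) := by gcongr
      _ = Real.exp (κ * A * (n + 1) * (blocksIn (γ ^ h) X).card) * (y ^ 3 *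
          Real.exp (κ * stepEnergy t c₁ c₃ γ (γ ^ (h + n)) φ'
            (polymerClosure (γ ^ (h + n)) X))) := by ring
      _ ≤ 2 ^ (blocksIn (γ ^ h) X).card * ((1 + 4 * (√(1 / (2 * A)) ^ 3 + 1 +
          2 / (c₁ / 3136) ^ 2)) / κ ^ (3 / 2 : ℝ) *
          regulator t c₁ c₃ κ (γ ^ (h + n + 1)) φ' (polymerClosure (γ ^ (h + n + 1)) X)) :=
        mul_le_mul (h2 _) h3 (by positivity) (by positivity)
      _ = _ := by ring
  refine ⟨fun hX => ⟨(key hX.1).1.1, (key hX.1).1.2.trans ?_⟩,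
    fun hX => hb hX (key hX.1.1).1.2, fun hX => ⟨(key hX.1.1).2.1, hb hX (key hX.1.1).2.2⟩⟩
  exact mul_le_mul (h2 _) (exp_stepEnergy_le hγ hN hc₁.le hκ0.le φ') (Real.exp_pos _).le
    (by positivity)
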